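/- **Model.** Let $l\le 0<b$, $\lambda,q>0$, $0<\sigma_2<\sigma_1$, $\sigma_0=0$. Demands arrive at the times $\tau_1<\tau_2<\cdots$ of a Poisson process $N$ of rate $\lambda$; their sizes $Y_1,Y_2,\dots$ are i.i.d. positive random variables, independent of $N$, with distribution $F$ and finite mean. Let $(\mathcal F_t)_{t\ge0}$ be the filtration generated by the cumulative demand $\sum_{n\le N_t}Y_n$. The holding and production cost rates $h_1,h_2:[l,b)\to[0,\infty)$ are bounded, have finitely many discontinuities and are Lipschitz between discontinuities; $h_0(b)\ge0$; the penalty function $p:[0,\infty)\to[0,\infty)$ is non-decreasing with $\int_0^\infty p\,dF<\infty$; the switching costs $K_{ij}\in\mathbb R$ ($i\ne j$ in $\{0,1,2\}$) satisfy $K_{01}\le K_{02}+K_{21}$, $K_{02}\le K_{01}+K_{12}$ and $K_{12}+K_{21}>0$. **Strategies.** Let $i\in\{1,2\}$, $x\in[l,b)$. A strategy $\pi=(T_k,J_k)_{k\ge0}$ consists of $(\mathcal F_t)$-stopping times with $T_0=0\le T_1<T_2<\cdots$, $T_k\to\infty$, and $\mathcal F_{T_k}$-measurable phases $J_k\in\{0,1,2\}$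 with $J_0=i$ and $J_k\ne J_{k-1}$. Its phase process is $\mathcal J_t=J_k$ for $t\in[T_k,T_{k+1})$, and its inventory process is $$X_t=x+\int_0^t\sigma_{\mathcal J_s}\,ds-\sum_{n=1}^{N_t}\min\{Y_n,\,X_{\tau_n^-}-l\}.$$ It is *admissible*, $\pi\in\Pi_{x,i}$, if almost surely, for all $t\ge0$: $X_t\le b$; $\mathcal J_t\in\{1,2\}$ whenever $X_t<b$; and $\mathcal J_t=0$ whenever $X_t=b$. (So production is switched off exactly when the level reaches $b$, and it is switched on again, in phase $1$ or $2$, at the next demand.) Its cost is $$V_i^\pi(x)=\mathbb E\Big[\int_0^\infty e^{-qt}h_{\mathcal J_t}(X_t)\,dt\Big]+\mathbb E\Big[\sum_{k=0}^\infty e^{-qT_{k+1}}K_{J_k,J_{k+1}}\Big]+\mathbb E\Big[\sum_{n=1}^\infty e^{-q\tau_n}1_{\{X_{\tau_n^-}-l<Y_n\}}\,p\big(Y_n-X_{\tau_n^-}+l\big)\Big],$$ understood as $+\infty$ if the sum of these expectations with $K_{J_k,J_{k+1}}$ replaced by its positive part is infinite. The optimal cost functions are $V_i(x)=\inf_{\pi\in\Pi_{x,i}}V_i^\pi(x)$.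 **Proposition (Lipschitz optimal cost functions).** For $i=1,2$ the optimal cost function $V_i$ is finite on $[l,b)$ and Lipschitz there: there is a constant $m_i$ such that $|V_i(x)-V_i(y)|\le m_i|x-y|$ for all $x,y\in[l,b)$. -/

import Mathlib

open MeasureTheory ProbabilityTheory Filter Set
open scoped NNReal ENNReal Topology

namespace ProductionInventory

/-- The data of the model: storage capacity `b`, minimum inventory level `l`, demand arrival rate
`lam`, discount rate `q`, production rates `σ i` in the phases `i = 0, 1, 2` (phase `0` is
"production off"), demand size distribution `F`, holding and production cost rates `h i`
(`h i x` is used only for `i = 1, 2` and `x ∈ [l, b)`, and for `i = 0` and `x = b`), shortage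
penalty `p` (used only on `[0, ∞)`), and switching costs `K i j`. -/
structure Model where
  b : ℝ
  l : ℝ
  lam : ℝ
  q : ℝ
  σ : Fin 3 → ℝ
  F : Measure ℝ
  h : Fin 3 → ℝ → ℝ
  p : ℝ → ℝ
  K : Fin 3 → Fin 3 → ℝ

/-- The discontinuity points in `[l, b)` of the holding cost rate of phase `i`. -/
def Model.discontinuities (M : Model) (i : Fin 3) : Set ℝ :=
  {x | x ∈ Ico M.l M.b ∧ ¬ ContinuousWithinAt (M.h i) (Ico M.l M.b) x}

/-- The standing assumptions on the data. -/
structure Model.Standing (M : Model) : Prop where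
  b_pos : 0 < M.b
  l_nonpos : M.l ≤ 0
  lam_pos : 0 < M.lam
  q_pos : 0 < M.q
  σ_zero : M.σ 0 = 0
  σ_two_pos : 0 < M.σ 2
  σ_two_lt_σ_one : M.σ 2 < M.σ 1
  F_prob : IsProbabilityMeasure M.F
  F_pos : M.F (Iic 0) = 0
  F_mean : Integrable (fun y => y) M.F
  h_nonneg : ∀ i, i ≠ 0 → ∀ x ∈ Ico M.l M.b, 0 ≤ M.h i x
  h_bounded : ∃ C : ℝ, ∀ i, i ≠ 0 → ∀ x ∈ Ico M.l M.b, M.h i x ≤ C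
  h_discontinuities : ∀ i, i ≠ 0 → (M.discontinuities i).Finite
  h_lipschitz : ∃ m : ℝ, ∀ i, i ≠ 0 → ∀ x ∈ Ico M.l M.b, ∀ y ∈ Ico M.l M.b, x ≤ y →
    Disjoint (Icc x y) (M.discontinuities i) → |M.h i x - M.h i y| ≤ m * |x - y|
  h_zero_nonneg : 0 ≤ M.h 0 M.b
  p_nonneg : ∀ y, 0 ≤ y → 0 ≤ M.p y
  p_mono : MonotoneOn M.p (Ici 0)
  p_integrable : Integrable M.p M.F
  K_zero_one : M.K 0 1 ≤ M.K 0 2 + M.K 2 1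
  K_zero_two : M.K 0 2 ≤ M.K 0 1 + M.K 1 2
  K_sum_pos : 0 < M.K 1 2 + M.K 2 1

/-- A compound Poisson demand with arrival rate `M.lam` and size distribution `M.F` on the
probability space `(Ω, P)`. The Poisson process is the counting process whose interarrival times
`W 0, W 1, …` are i.i.d. exponential; `Y n` is the size of the `(n + 1)`-st demand. -/
structure Demand {Ω : Type*} [MeasurableSpace Ω] (P : Measure Ω) (M : Model) where
  W : ℕ → Ω → ℝ
  Y : ℕ → Ω → ℝ
  measurable_W : ∀ n, Measurable (W n)
  measurable_Y : ∀ n, Measurable (Y n)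
  W_pos : ∀ n ω, 0 < W n ω
  Y_pos : ∀ n ω, 0 < Y n ω
  no_explosion : ∀ ω, Tendsto (fun n => ∑ k ∈ Finset.range n, W k ω) atTop atTop
  law_W : ∀ n, P.map (W n) = expMeasure M.lam
  law_Y : ∀ n, P.map (Y n) = M.F
  indep : iIndepFun (fun s : ℕ ⊕ ℕ => Sum.elim W Y s) P

namespace Demand

variable {Ω : Type*} [MeasurableSpace Ω] {P : Measure Ω} {M : Model}

/-- `τ 0 = 0`, and `τ n` is the arrival time of the `n`-th demand for `n ≥ 1`. -/
noncomputable def τ (D : Demand P M) (n : ℕ) (ω : Ω) : ℝ :=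
  ∑ k ∈ Finset.range n, D.W k ω

/-- The number `N t` of demands that have arrived in `[0, t]`. -/
noncomputable def N (D : Demand P M) (t : ℝ) (ω : Ω) : ℕ :=
  {n : ℕ | D.τ (n + 1) ω ≤ t}.ncard

/-- The cumulative demand in `[0, t]`; only finitely many terms of the sum are nonzero. -/
noncomputable def cumulative (D : Demand P M) (t : ℝ≥0) (ω : Ω) : ℝ :=
  ∑' n : ℕ, if D.τ (n + 1) ω ≤ t then D.Y n ω else 0

theorem measurable_τ (D : Demand P M) (n : ℕ) : Measurable (D.τ n) := by
  unfold τ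
  exact Finset.measurable_fun_sum _ (fun k _ => D.measurable_W k)

theorem stronglyMeasurable_cumulative (D : Demand P M) (t : ℝ≥0) :
    StronglyMeasurable (D.cumulative t) := by
  have hs : ∀ ω, Summable (fun n : ℕ => if D.τ (n + 1) ω ≤ t then D.Y n ω else 0) := by
    intro ω
    have h1 := (D.no_explosion ω).comp (tendsto_add_atTop_nat 1)
    obtain ⟨n₀, hn₀⟩ := eventually_atTop.1 (h1.eventually_gt_atTop (t : ℝ))
    refine summable_of_ne_finset_zero (s := Finset.range n₀) (fun n hn => ?_)
    have h2 : (t : ℝ) < D.τ (n + 1) ω := hn₀ n (by simpa using hn)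
    exact if_neg (not_le.2 h2)
  have hm : Measurable (D.cumulative t) := by
    refine measurable_of_tendsto_metrizable
      (f := fun (m : ℕ) ω => ∑ n ∈ Finset.range m, if D.τ (n + 1) ω ≤ t then D.Y n ω else 0)
      (fun m => Finset.measurable_fun_sum _ (fun n _ => ?_)) ?_
    · exact Measurable.ite (measurableSet_le (D.measurable_τ (n + 1)) measurable_const)
        (D.measurable_Y n) measurable_const
    · exact tendsto_pi_nhds.2 (fun ω => (hs ω).hasSum.tendsto_sum_nat)
  exact hm.stronglyMeasurable

/-- The filtration generated by the cumulative demand process. -/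
noncomputable def filtration (D : Demand P M) : Filtration ℝ≥0 ‹MeasurableSpace Ω› :=
  Filtration.natural D.cumulative D.stronglyMeasurable_cumulative

end Demand

/-- A production strategy `(T k, J k)`: `T k` is the time of the `k`-th switch, from phase
`J (k - 1)` to phase `J k`; `T 0 = 0` and `J 0` is the initial phase. The value `T k = ⊤` means
that the `k`-th switch never takes place. -/
structure Strategy (Ω : Type*) where
  T : ℕ → Ω → WithTop ℝ≥0
  J : ℕ → Ω → Fin 3

namespace Strategy

variable {Ω : Type*} [MeasurableSpace Ω] {P : Measure Ω} {M : Model}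

/-- The phase process: the phase at time `t` is `J k` for `t ∈ [T k, T (k + 1))`, where `k` is
the number of switches in `[0, t]`. -/
noncomputable def phase (π : Strategy Ω) (t : ℝ) (ω : Ω) : Fin 3 :=
  π.J ({k : ℕ | π.T (k + 1) ω ≤ ((t.toNNReal : ℝ≥0) : WithTop ℝ≥0)}.ncard) ω

/-- The amount produced in the time interval `[s, t]`. -/
noncomputable def produced (π : Strategy Ω) (M : Model) (s t : ℝ) (ω : Ω) : ℝ :=
  ∫ r in s..t, M.σ (π.phase r ω)

/-- The inventory level at time `τ n`, just after the `n`-th demand, from initial level `x`: of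
the demand `Y n` only `min (Y n) (X - l)` is served, where `X` is the level just before it. -/
noncomputable def levelAfter (π : Strategy Ω) (D : Demand P M) (x : ℝ) : ℕ → Ω → ℝ
  | 0, _ => x
  | n + 1, ω =>
    let X := π.levelAfter D x n ω + π.produced M (D.τ n ω) (D.τ (n + 1) ω) ω
    X - min (D.Y n ω) (X - M.l)

/-- The inventory level just before the `(n + 1)`-st demand, that is, the left limit of the
inventory process at `τ (n + 1)`. -/
noncomputable def levelBefore (π : Strategy Ω) (D : Demand P M) (x : ℝ) (n : ℕ) (ω : Ω) : ℝ :=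
  π.levelAfter D x n ω + π.produced M (D.τ n ω) (D.τ (n + 1) ω) ω

/-- The controlled inventory process from initial level `x`. -/
noncomputable def inventory (π : Strategy Ω) (D : Demand P M) (x : ℝ) (t : ℝ) (ω : Ω) : ℝ :=
  π.levelAfter D x (D.N t ω) ω + π.produced M (D.τ (D.N t ω) ω) t ω

/-- Admissibility of a strategy from initial level `x` and initial phase `i`. The switching times
are stopping times of the demand filtration and the new phase is known at the switching time.
Almost surely the switches are strictly ordered, do not accumulate (so that the phase process is
càdlàg), each of them changes the phase, and production is off exactly while the level is `b`. -/
structure Admissible (π : Strategy Ω) (D : Demand P M) (x : ℝ) (i : Fin 3) : Prop where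
  T_zero : ∀ ω, π.T 0 ω = 0
  J_zero : ∀ ω, π.J 0 ω = i
  adapted : ∀ k, ∃ hT : IsStoppingTime D.filtration (π.T k),
    Measurable[hT.measurableSpace] (π.J k)
  T_mono : ∀ᵐ ω ∂P, ∀ k, π.T (k + 1) ω ≤ π.T (k + 2) ω
  T_strict : ∀ᵐ ω ∂P, ∀ k, π.T (k + 1) ω ≠ ⊤ → π.T (k + 1) ω < π.T (k + 2) ω
  T_locally_finite : ∀ᵐ ω ∂P, ∀ t : ℝ≥0, {k : ℕ | π.T k ω ≤ (t : WithTop ℝ≥0)}.Finite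
  J_ne : ∀ᵐ ω ∂P, ∀ k, π.T (k + 1) ω ≠ ⊤ → π.J (k + 1) ω ≠ π.J k ω
  level_le : ∀ᵐ ω ∂P, ∀ t : ℝ, 0 ≤ t → π.inventory D x t ω ≤ M.b
  phase_on : ∀ᵐ ω ∂P, ∀ t : ℝ, 0 ≤ t → π.inventory D x t ω < M.b → π.phase t ω ≠ 0
  phase_off : ∀ᵐ ω ∂P, ∀ t : ℝ, 0 ≤ t → π.inventory D x t ω = M.b → π.phase t ω = 0

/-- Expected discounted holding and production cost. -/
noncomputable def holdingCost (π : Strategy Ω) (D : Demand P M) (x : ℝ) : ℝ≥0∞ :=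
  ∫⁻ ω, (∫⁻ t in Ici (0 : ℝ),
    ENNReal.ofReal (Real.exp (-M.q * t) * M.h (π.phase t ω) (π.inventory D x t ω))) ∂P

/-- Expected discounted shortage penalty. -/
noncomputable def penaltyCost (π : Strategy Ω) (D : Demand P M) (x : ℝ) : ℝ≥0∞ :=
  ∫⁻ ω, ∑' n : ℕ,
    (if π.levelBefore D x n ω - M.l < D.Y n ω then
      ENNReal.ofReal (Real.exp (-M.q * D.τ (n + 1) ω) *
        M.p (D.Y n ω - π.levelBefore D x n ω + M.l))
    else 0) ∂P

/-- Expected discounted switching cost for the nonnegative switching costs `c i j`; a switch that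
never takes place costs nothing. -/
noncomputable def switchingCost (π : Strategy Ω) (P : Measure Ω) (q : ℝ)
    (c : Fin 3 → Fin 3 → ℝ≥0∞) : ℝ≥0∞ :=
  ∫⁻ ω, ∑' k : ℕ,
    (if π.T (k + 1) ω = ⊤ then 0
    else ENNReal.ofReal (Real.exp (-q * ((π.T (k + 1) ω).untopD 0 : ℝ≥0))) *
      c (π.J k ω) (π.J (k + 1) ω)) ∂P

open Classical in
/-- The expected discounted total cost of the strategy. No sign is imposed on the switching costs,
so their positive and negative parts are summed separately; the cost is `⊤` when the positive
part is infinite. (For nonnegative `K` the negative part is `0`.) -/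
noncomputable def cost (π : Strategy Ω) (D : Demand P M) (x : ℝ) : EReal :=
  let pos : ℝ≥0∞ := π.holdingCost D x + π.penaltyCost D x +
    π.switchingCost P M.q (fun i j => ENNReal.ofReal (M.K i j))
  let neg : ℝ≥0∞ := π.switchingCost P M.q (fun i j => ENNReal.ofReal (-M.K i j))
  if pos = ⊤ then ⊤ else (pos : EReal) - (neg : EReal)

end Strategy

/-- The optimal cost function `V i`: the infimum of the cost over the strategies that are
admissible from initial level `x` and initial phase `i`. -/
noncomputable def optimalCost {Ω : Type*} [MeasurableSpace Ω] {P : Measure Ω} {M : Model}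
    (D : Demand P M) (i : Fin 3) (x : ℝ) : EReal :=
  ⨅ π ∈ {π : Strategy Ω | π.Admissible D x i}, π.cost D x

end ProductionInventory

/-! Let $x\le y$ in $[l,b)$. The proof rests on a uniform bound for $V_i$ and on two comparisons
whose constants do not depend on $x,y$: $V_i(x)\le e^{-(\lambda+q)s}V_i(y)+Cs$ with
$s=(y-x)/\sigma_i$, and $e^{-(\lambda+q)\delta}V_i(y)\le V_i(x)+C\delta$ for some
$\delta\le(y-x)/\sigma_2$. Since $V_i$ is bounded, the discount factors cost only $O(s)$ and
$O(\delta)$, and both times are $O(y-x)$.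

For the first comparison (`Strategy.exists_wait_cost_le`), stay in phase $i$ for the time $s$. With
probability $e^{-\lambda s}$ there is no demand; the level is then $y$, the exponential waiting time
starts afresh, and a nearly optimal strategy for $y$ takes over. An earlier demand has probability
at most $\lambda s$; then a strategy is used whose conditional cost is bounded.

For the second (`Strategy.Reference.exists_cost_le`), take a nearly optimal strategy for $x$. Until
the first demand an adapted strategy is deterministic, because all outcomes without a demand look
alike to it. Along this common path the level passes $y$ at some time $\delta\le(y-x)/\sigma_2$,
because production runs at rate at least $\sigma_2$ below $b$. What the strategy does after $\delta$
is a strategy from level $y$, but in whatever phase the switches up to $\delta$ have led to.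
Starting at $y$ in phase $i$, one immediate switch repairs this. Replacing the earlier switches by a
single one loses at most $O(\delta)$: a round trip between the phases $1$ and $2$ has positive cost
$K_{12}+K_{21}$, and the discount factors on $[0,\delta]$ differ by $O(\delta)$
(`Model.Standing.switchK_le_sum`).

Switching costs may be negative, so the lower bound for $V_i$ is not automatic. Production is
resumed only at demand times, which bounds the discounted number of switches from and to phase $0$.
The discounted numbers of switches $1\to2$ and $2\to1$ then differ by a controlled amount, so gains
from one direction are paid for by the other (`Strategy.PathAdmissible.pathNeg_le`). The upper bound
comes from the strategy with a single production phase. All these errors are dominated by a variable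
independent of the first arrival time, so on the event of a demand before $\delta$ they contribute
only $O(\delta)$ (`Demand.exists_setLIntegral_dominating_le`).

Moving the first arrival requires a space of outcomes that is closed under this operation. The
problem is therefore transferred to the space of demand sequences (`optimalCost_canonical`), where
adaptedness becomes a pathwise condition, Galmarino's test (`Demand.IsCanonical.adapted_iff`). -/

set_option linter.unusedSectionVars false

namespace ProductionInventory

/-! ### Counting events indexed by the natural numbers -/

section General

/-- Demands and switches are counted by cardinalities. For monotone times the count at `t` is the
index of the interval containing `t`, which evaluates both `Demand.N` and `Strategy.phase`. -/
theorem setOf_succ_le_eq_Iio {α : Type*} [LinearOrder α] {f : ℕ → α} (hf : Monotone f) {k : ℕ}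
    {t : α} (h1 : f k ≤ t) (h2 : t < f (k + 1)) : {n : ℕ | f (n + 1) ≤ t} = Iio k := by
  ext n
  simp only [mem_ofPred_eq, mem_Iio]
  constructor
  · intro h
    by_contra! hk
    exact absurd (h2.trans_le ((hf (by omega : k + 1 ≤ n + 1)).trans h)) (lt_irrefl _)
  · intro h
    exact (hf (by omega : n + 1 ≤ k)).trans h1

theorem ncard_Iio_nat (k : ℕ) : (Iio k : Set ℕ).ncard = k := by
  rw [← Finset.coe_range, Set.ncard_coe_finset, Finset.card_range]

/-- The number of the events `E 0, E 1, …` that occur is measurable. -/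
theorem measurable_ncard {α : Type*} [MeasurableSpace α] {E : ℕ → α → Prop}
    (hE : ∀ k, MeasurableSet {a | E k a}) : Measurable fun a => {k | E k a}.ncard := by
  have key : ∀ s : Finset ℕ, MeasurableSet {a | ∀ k, E k a ↔ k ∈ s} := by
    intro s
    rw [ofPred_forall]
    refine MeasurableSet.iInter fun k => ?_
    by_cases hk : k ∈ s
    · simp only [hk, iff_true]
      exact hE k
    · simp only [hk, iff_false]
      exact (hE k).compl
  have hpos : ∀ n, n ≠ 0 → MeasurableSet {a | {k | E k a}.ncard = n} := by
    intro n hn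
    have : {a | {k | E k a}.ncard = n} =
        ⋃ s : Finset ℕ, ⋃ _ : s.card = n, {a | ∀ k, E k a ↔ k ∈ s} := by
      ext a
      simp only [mem_ofPred_eq, mem_iUnion, exists_prop]
      constructor
      · intro h
        have hfin : {k | E k a}.Finite := Set.finite_of_ncard_ne_zero (h ▸ hn)
        refine ⟨hfin.toFinset, ?_, fun k => by simp⟩
        rw [← h, Set.ncard_eq_toFinset_card _ hfin]
      · rintro ⟨s, hs, h⟩
        have : {k | E k a} = (s : Set ℕ) := by ext k; simp [h k]
        rw [this, Set.ncard_coe_finset, hs]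
    rw [this]
    exact MeasurableSet.iUnion fun s => MeasurableSet.iUnion fun _ => key s
  refine measurable_to_countable' fun n => ?_
  -- An infinite set also has `ncard` equal to `0`, so this fibre is obtained as the complement of
  -- the others.
  by_cases hn : n = 0
  · subst hn
    have : (fun a => {k | E k a}.ncard) ⁻¹' {0} =
        (⋃ n : ℕ, ⋃ _ : n ≠ 0, {a | {k | E k a}.ncard = n})ᶜ := by
      ext a
      simp only [mem_preimage, mem_singleton_iff, mem_compl_iff, mem_iUnion, mem_ofPred_eq,
        exists_prop, not_exists, not_and]
      refine ⟨fun h n hn h' => hn (h'.symm.trans h), fun h => ?_⟩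
      by_contra hc
      exact h _ hc rfl
    rw [this]
    exact (MeasurableSet.iUnion fun n => MeasurableSet.iUnion fun h => hpos n h).compl
  · exact hpos n hn

end General

/-! ### Demand times and production rates -/

namespace Demand

variable {Ω : Type*} [MeasurableSpace Ω] {P : Measure Ω} {M : Model} (D : Demand P M)

@[simp] theorem τ_zero (ω : Ω) : D.τ 0 ω = 0 := by simp [τ]

theorem τ_succ (n : ℕ) (ω : Ω) : D.τ (n + 1) ω = D.τ n ω + D.W n ω := by
  simp [τ, Finset.sum_range_succ]

theorem τ_strictMono (ω : Ω) : StrictMono fun n => D.τ n ω :=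
  strictMono_nat_of_lt_succ fun n => by
    rw [τ_succ]
    linarith [D.W_pos n ω]

theorem τ_mono (ω : Ω) : Monotone fun n => D.τ n ω := (D.τ_strictMono ω).monotone

theorem τ_nonneg (n : ℕ) (ω : Ω) : 0 ≤ D.τ n ω := by
  simpa using D.τ_mono ω (Nat.zero_le n)

theorem τ_lt_succ (n : ℕ) (ω : Ω) : D.τ n ω < D.τ (n + 1) ω := D.τ_strictMono ω n.lt_succ_self

theorem τ_succ_pos (n : ℕ) (ω : Ω) : 0 < D.τ (n + 1) ω :=
  (D.τ_nonneg n ω).trans_lt (D.τ_lt_succ n ω)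

theorem τ_one (ω : Ω) : D.τ 1 ω = D.W 0 ω := by simp [τ]

theorem exists_τ_le_lt (ω : Ω) {t : ℝ} (ht : 0 ≤ t) : ∃ n, D.τ n ω ≤ t ∧ t < D.τ (n + 1) ω := by
  classical
  have hex : ∃ n, t < D.τ n ω := ((D.no_explosion ω).eventually_gt_atTop t).exists
  have h0 : Nat.find hex ≠ 0 := by
    intro h
    have := Nat.find_spec hex
    rw [h, τ_zero] at this
    linarith
  obtain ⟨n, hn⟩ := Nat.exists_eq_succ_of_ne_zero h0
  refine ⟨n, not_lt.1 (Nat.find_min hex (by omega)), ?_⟩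
  have := Nat.find_spec hex
  rwa [hn] at this

theorem N_eq {ω : Ω} {t : ℝ} {n : ℕ} (h1 : D.τ n ω ≤ t) (h2 : t < D.τ (n + 1) ω) :
    D.N t ω = n := by
  unfold N
  rw [setOf_succ_le_eq_Iio (D.τ_mono ω) h1 h2, ncard_Iio_nat]

theorem measurable_N : Measurable fun z : ℝ × Ω => D.N z.1 z.2 :=
  measurable_ncard fun n =>
    measurableSet_le ((D.measurable_τ (n + 1)).comp measurable_snd) measurable_fst

/-- The process has no jumps between successive demands. -/
theorem cumulative_eq {ω : Ω} {t : ℝ≥0} {n : ℕ} (h1 : D.τ n ω ≤ t) (h2 : t < D.τ (n + 1) ω) :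
    D.cumulative t ω = ∑ k ∈ Finset.range n, D.Y k ω := by
  unfold cumulative
  have hset : ∀ k, D.τ (k + 1) ω ≤ t ↔ k < n := fun k => by
    have := setOf_succ_le_eq_Iio (D.τ_mono ω) h1 h2
    exact Set.ext_iff.1 this k
  rw [tsum_eq_sum (s := Finset.range n) fun k hk => ?_]
  · refine Finset.sum_congr rfl fun k hk => ?_
    rw [if_pos ((hset k).2 (Finset.mem_range.1 hk))]
  · rw [if_neg]
    rw [hset]
    simpa using hk

end Demand

theorem Model.Standing.σ_one_pos {M : Model} (hM : M.Standing) : 0 < M.σ 1 :=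
  hM.σ_two_pos.trans hM.σ_two_lt_σ_one

theorem Model.Standing.σ_pos {M : Model} (hM : M.Standing) {j : Fin 3} (hj : j ≠ 0) :
    M.σ 2 ≤ M.σ j := by
  fin_cases j
  · exact absurd rfl hj
  · exact hM.σ_two_lt_σ_one.le
  · exact le_rfl

theorem Model.Standing.σ_nonneg {M : Model} (hM : M.Standing) (j : Fin 3) : 0 ≤ M.σ j := by
  by_cases hj : j = 0
  · rw [hj, hM.σ_zero]
  · exact hM.σ_two_pos.le.trans (hM.σ_pos hj)

theorem Model.Standing.σ_le {M : Model} (hM : M.Standing) (j : Fin 3) : M.σ j ≤ M.σ 1 := by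
  fin_cases j
  · show M.σ 0 ≤ M.σ 1
    rw [hM.σ_zero]
    exact hM.σ_one_pos.le
  · exact le_rfl
  · exact hM.σ_two_lt_σ_one.le

/-! ### Phase, production and inventory along a path -/

namespace Strategy

variable {Ω : Type*} [MeasurableSpace Ω] {P : Measure Ω} {M : Model}

/-- The properties of a single path that admissibility requires almost surely. -/
structure PathAdmissible (π : Strategy Ω) (D : Demand P M) (x : ℝ) (i : Fin 3) (ω : Ω) : Prop where
  T_zero : π.T 0 ω = 0
  J_zero : π.J 0 ω = i
  T_mono : ∀ k, π.T (k + 1) ω ≤ π.T (k + 2) ω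
  T_strict : ∀ k, π.T (k + 1) ω ≠ ⊤ → π.T (k + 1) ω < π.T (k + 2) ω
  T_locally_finite : ∀ t : ℝ≥0, {k : ℕ | π.T k ω ≤ (t : WithTop ℝ≥0)}.Finite
  J_ne : ∀ k, π.T (k + 1) ω ≠ ⊤ → π.J (k + 1) ω ≠ π.J k ω
  level_le : ∀ t : ℝ, 0 ≤ t → π.inventory D x t ω ≤ M.b
  phase_on : ∀ t : ℝ, 0 ≤ t → π.inventory D x t ω < M.b → π.phase t ω ≠ 0
  phase_off : ∀ t : ℝ, 0 ≤ t → π.inventory D x t ω = M.b → π.phase t ω = 0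

theorem Admissible.path {π : Strategy Ω} {D : Demand P M} {x : ℝ} {i : Fin 3}
    (h : π.Admissible D x i) : ∀ᵐ ω ∂P, π.PathAdmissible D x i ω := by
  filter_upwards [h.T_mono, h.T_strict, h.T_locally_finite, h.J_ne, h.level_le, h.phase_on,
    h.phase_off] with ω h1 h2 h3 h4 h5 h6 h7
  exact ⟨h.T_zero ω, h.J_zero ω, h1, h2, h3, h4, h5, h6, h7⟩

theorem Admissible.of_path {π : Strategy Ω} {D : Demand P M} {x : ℝ} {i : Fin 3}
    (hT : ∀ ω, π.T 0 ω = 0) (hJ : ∀ ω, π.J 0 ω = i)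
    (ha : ∀ k, ∃ hT : IsStoppingTime D.filtration (π.T k), Measurable[hT.measurableSpace] (π.J k))
    (h : ∀ᵐ ω ∂P, π.PathAdmissible D x i ω) : π.Admissible D x i where
  T_zero := hT
  J_zero := hJ
  adapted := ha
  T_mono := h.mono fun _ h => h.T_mono
  T_strict := h.mono fun _ h => h.T_strict
  T_locally_finite := h.mono fun _ h => h.T_locally_finite
  J_ne := h.mono fun _ h => h.J_ne
  level_le := h.mono fun _ h => h.level_le
  phase_on := h.mono fun _ h => h.phase_on
  phase_off := h.mono fun _ h => h.phase_off

theorem Admissible.measurable_T {π : Strategy Ω} {D : Demand P M} {x : ℝ} {i : Fin 3}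
    (h : π.Admissible D x i) (k : ℕ) : Measurable (π.T k) := (h.adapted k).choose.measurable'

theorem Admissible.measurable_J {π : Strategy Ω} {D : Demand P M} {x : ℝ} {i : Fin 3}
    (h : π.Admissible D x i) (k : ℕ) : Measurable (π.J k) :=
  (h.adapted k).choose_spec.mono ((h.adapted k).choose.measurableSpace_le) le_rfl

section Phase

variable {π : Strategy Ω} {D : Demand P M} {x : ℝ} {i : Fin 3} {ω : Ω}

theorem monotone_T (h0 : π.T 0 ω = 0) (h : ∀ k, π.T (k + 1) ω ≤ π.T (k + 2) ω) :
    Monotone fun k => π.T k ω := by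
  refine monotone_nat_of_le_succ fun k => ?_
  cases k with
  | zero => simp [h0]
  | succ k => exact h k

theorem PathAdmissible.monotone_T (h : π.PathAdmissible D x i ω) : Monotone fun k => π.T k ω :=
  Strategy.monotone_T h.T_zero h.T_mono

theorem phase_eq (hm : Monotone fun k => π.T k ω) {k : ℕ} {t : ℝ}
    (h1 : π.T k ω ≤ ((t.toNNReal : ℝ≥0) : WithTop ℝ≥0))
    (h2 : ((t.toNNReal : ℝ≥0) : WithTop ℝ≥0) < π.T (k + 1) ω) : π.phase t ω = π.J k ω := by
  unfold phase
  rw [setOf_succ_le_eq_Iio hm h1 h2, ncard_Iio_nat]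

theorem exists_T_le_lt (h0 : π.T 0 ω = 0)
    (hf : ∀ t : ℝ≥0, {k : ℕ | π.T k ω ≤ (t : WithTop ℝ≥0)}.Finite) (t : ℝ≥0) :
    ∃ k, π.T k ω ≤ t ∧ t < π.T (k + 1) ω := by
  classical
  have hex : ∃ k, (t : WithTop ℝ≥0) < π.T k ω := by
    by_contra! hc
    exact Set.infinite_univ ((hf t).subset fun k _ => hc k)
  have hne : Nat.find hex ≠ 0 := by
    intro h
    have := Nat.find_spec hex
    rw [h, h0] at this
    exact not_lt_bot this
  obtain ⟨n, hn⟩ := Nat.exists_eq_succ_of_ne_zero hne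
  refine ⟨n, not_lt.1 (Nat.find_min hex (by omega)), ?_⟩
  have := Nat.find_spec hex
  rwa [hn] at this

theorem measurable_phase (hT : ∀ k, Measurable (π.T k)) (hJ : ∀ k, Measurable (π.J k)) :
    Measurable fun z : ℝ × Ω => π.phase z.1 z.2 := by
  have hc : Measurable fun z : ℝ × Ω =>
      {k : ℕ | π.T (k + 1) z.2 ≤ ((z.1.toNNReal : ℝ≥0) : WithTop ℝ≥0)}.ncard :=
    measurable_ncard fun k => measurableSet_le ((hT (k + 1)).comp measurable_snd)
      (measurable_fst.real_toNNReal.withTop_coe)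
  have hJ' : Measurable fun z : ℕ × Ω => π.J z.1 z.2 := measurable_from_prod_countable_right hJ
  exact hJ'.comp (hc.prodMk measurable_snd)

theorem measurable_phase_path (π : Strategy Ω) (ω : Ω) : Measurable fun t => π.phase t ω := by
  have hc : Measurable fun t : ℝ =>
      {k : ℕ | π.T (k + 1) ω ≤ ((t.toNNReal : ℝ≥0) : WithTop ℝ≥0)}.ncard :=
    measurable_ncard fun k => measurableSet_le measurable_const
      (measurable_id.real_toNNReal.withTop_coe)
  exact (measurable_from_nat (f := fun k => π.J k ω)).comp hc

end Phase

section Inventory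

variable (π : Strategy Ω) (D : Demand P M) (x : ℝ) (ω : Ω)

theorem exists_abs_σ_le (M : Model) : ∃ C, ∀ j, |M.σ j| ≤ C := by
  obtain ⟨C, hC⟩ := (Set.finite_range fun j => |M.σ j|).bddAbove
  exact ⟨C, fun j => hC ⟨j, rfl⟩⟩

theorem intervalIntegrable_σ (M : Model) (s t : ℝ) :
    IntervalIntegrable (fun r => M.σ (π.phase r ω)) volume s t := by
  obtain ⟨C, hC⟩ := exists_abs_σ_le M
  refine IntervalIntegrable.mono_fun (intervalIntegrable_const (c := C)) ?_ ?_
  · exact ((Measurable.of_discrete (f := M.σ)).comp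
      (π.measurable_phase_path ω)).aestronglyMeasurable
  · refine Eventually.of_forall fun r => ?_
    exact (hC _).trans (le_abs_self C)

theorem produced_add (M : Model) (s t u : ℝ) :
    π.produced M s t ω + π.produced M t u ω = π.produced M s u ω :=
  intervalIntegral.integral_add_adjacent_intervals (π.intervalIntegrable_σ ω M s t)
    (π.intervalIntegrable_σ ω M t u)

@[simp] theorem produced_self (M : Model) (s : ℝ) : π.produced M s s ω = 0 := by
  simp [produced]

theorem produced_eq_of_phase {M : Model} {s t : ℝ} (hst : s ≤ t) {j : Fin 3}
    (h : ∀ r, s ≤ r → r < t → π.phase r ω = j) : π.produced M s t ω = M.σ j * (t - s) := by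
  unfold produced
  rw [intervalIntegral.integral_congr_ae (g := fun _ => M.σ j)]
  · simp [mul_comm]
  -- The phase may change at `t` itself, which is a null set.
  · have : ∀ᵐ r : ℝ, r ≠ t := by simp [ae_iff]
    filter_upwards [this] with r hr hmem
    rw [uIoc_of_le hst] at hmem
    rw [h r hmem.1.le (lt_of_le_of_ne hmem.2 hr)]

theorem produced_nonneg {M : Model} (hM : M.Standing) {s t : ℝ} (hst : s ≤ t) :
    0 ≤ π.produced M s t ω :=
  intervalIntegral.integral_nonneg hst fun _ _ => hM.σ_nonneg _

theorem levelAfter_succ (n : ℕ) : π.levelAfter D x (n + 1) ω =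
    π.levelBefore D x n ω - min (D.Y n ω) (π.levelBefore D x n ω - M.l) := rfl

theorem levelBefore_eq (n : ℕ) : π.levelBefore D x n ω =
    π.levelAfter D x n ω + π.produced M (D.τ n ω) (D.τ (n + 1) ω) ω := rfl

theorem levelAfter_ge {x : ℝ} (hx : M.l ≤ x) (n : ℕ) : M.l ≤ π.levelAfter D x n ω := by
  cases n with
  | zero => exact hx
  | succ n =>
    rw [levelAfter_succ]
    linarith [min_le_right (D.Y n ω) (π.levelBefore D x n ω - M.l)]

theorem levelBefore_ge (hM : M.Standing) {x : ℝ} (hx : M.l ≤ x) (n : ℕ) :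
    M.l ≤ π.levelBefore D x n ω := by
  rw [levelBefore_eq]
  linarith [π.levelAfter_ge D ω hx n, π.produced_nonneg ω hM (D.τ_lt_succ n ω).le]

variable {D ω}

theorem inventory_eq {t : ℝ} {n : ℕ} (h1 : D.τ n ω ≤ t) (h2 : t < D.τ (n + 1) ω) :
    π.inventory D x t ω = π.levelAfter D x n ω + π.produced M (D.τ n ω) t ω := by
  unfold inventory
  rw [D.N_eq h1 h2]

theorem inventory_eq_add {s t : ℝ} {n : ℕ} (h1 : D.τ n ω ≤ s) (hst : s ≤ t)
    (h2 : t < D.τ (n + 1) ω) :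
    π.inventory D x t ω = π.inventory D x s ω + π.produced M s t ω := by
  rw [π.inventory_eq x h1 (hst.trans_lt h2), π.inventory_eq x (h1.trans hst) h2, add_assoc,
    π.produced_add]

theorem inventory_ge (hM : M.Standing) {x : ℝ} (hx : M.l ≤ x) {t : ℝ} (ht : 0 ≤ t) :
    M.l ≤ π.inventory D x t ω := by
  obtain ⟨n, h1, h2⟩ := D.exists_τ_le_lt ω ht
  rw [π.inventory_eq x h1 h2]
  linarith [π.levelAfter_ge D ω hx n, π.produced_nonneg ω hM h1]

end Inventory

end Strategy

/-- The cost rate at level `z` in phase `j`, with the value `0` outside its range of definition. -/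
noncomputable def Model.rate (M : Model) (j : Fin 3) (z : ℝ) : ℝ :=
  open Classical in
  if j = 0 then M.h 0 M.b else if z ∈ Ico M.l M.b then M.h j z else 0

/-- The sum of the absolute values of the switching costs. -/
noncomputable def Model.maxK (M : Model) : ℝ≥0∞ := ∑ a, ∑ b, ENNReal.ofReal |M.K a b|

theorem Model.maxK_ne_top (M : Model) : M.maxK ≠ ⊤ := by
  simp [maxK, ENNReal.sum_eq_top]

theorem Model.ofReal_abs_K_le (M : Model) (a b : Fin 3) : ENNReal.ofReal |M.K a b| ≤ M.maxK :=
  (Finset.single_le_sum (f := fun b => ENNReal.ofReal |M.K a b|) (fun _ _ => zero_le)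
    (Finset.mem_univ b)).trans
  (Finset.single_le_sum (f := fun a => ∑ b, ENNReal.ofReal |M.K a b|) (fun _ _ => zero_le)
    (Finset.mem_univ a))

theorem Model.ofReal_K_le (M : Model) (a b : Fin 3) : ENNReal.ofReal (M.K a b) ≤ M.maxK :=
  (ENNReal.ofReal_le_ofReal (le_abs_self _)).trans (M.ofReal_abs_K_le a b)

theorem Model.ofReal_neg_K_le (M : Model) (a b : Fin 3) : ENNReal.ofReal (-M.K a b) ≤ M.maxK :=
  (ENNReal.ofReal_le_ofReal (neg_le_abs _)).trans (M.ofReal_abs_K_le a b)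

/-- The sum of the discount factors at the demand times. -/
noncomputable def Demand.disc {Ω : Type*} [MeasurableSpace Ω] {P : Measure Ω} {M : Model}
    (D : Demand P M) (ω : Ω) : ℝ≥0∞ :=
  ∑' n, ENNReal.ofReal (Real.exp (-M.q * D.τ (n + 1) ω))

/-! ### Discounted costs along a single path -/

namespace Strategy

variable {Ω : Type*} [MeasurableSpace Ω] {P : Measure Ω} {M : Model}

/-- The discount factor at the time of the `k`-th switch, `0` if it never takes place. -/
noncomputable def disc (π : Strategy Ω) (q : ℝ) (k : ℕ) (ω : Ω) : ℝ≥0∞ :=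
  open Classical in
  if π.T k ω = ⊤ then 0 else ENNReal.ofReal (Real.exp (-q * ((π.T k ω).untopD 0 : ℝ≥0)))

/-- The discounted switching cost along a path. -/
noncomputable def pathSwitch (π : Strategy Ω) (q : ℝ) (c : Fin 3 → Fin 3 → ℝ≥0∞) (ω : Ω) : ℝ≥0∞ :=
  ∑' k : ℕ, π.disc q (k + 1) ω * c (π.J k ω) (π.J (k + 1) ω)

/-- The discounted holding and production cost along a path. -/
noncomputable def pathHold (π : Strategy Ω) (D : Demand P M) (x : ℝ) (ω : Ω) : ℝ≥0∞ :=
  ∫⁻ t in Ici (0 : ℝ),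
    ENNReal.ofReal (Real.exp (-M.q * t) * M.rate (π.phase t ω) (π.inventory D x t ω))

/-- The discounted shortage penalty along a path. -/
noncomputable def pathPenalty (π : Strategy Ω) (D : Demand P M) (x : ℝ) (ω : Ω) : ℝ≥0∞ :=
  ∑' n : ℕ,
    (if π.levelBefore D x n ω - M.l < D.Y n ω then
      ENNReal.ofReal (Real.exp (-M.q * D.τ (n + 1) ω) *
        M.p (D.Y n ω - π.levelBefore D x n ω + M.l))
    else 0)

/-- The positive part of the discounted cost along a path. -/
noncomputable def pathPos (π : Strategy Ω) (D : Demand P M) (x : ℝ) (ω : Ω) : ℝ≥0∞ :=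
  π.pathHold D x ω + π.pathPenalty D x ω +
    π.pathSwitch M.q (fun a b => ENNReal.ofReal (M.K a b)) ω

/-- The negative part of the discounted cost along a path. -/
noncomputable def pathNeg (π : Strategy Ω) (M : Model) (ω : Ω) : ℝ≥0∞ :=
  π.pathSwitch M.q (fun a b => ENNReal.ofReal (-M.K a b)) ω

theorem switchingCost_eq (π : Strategy Ω) (P : Measure Ω) (q : ℝ) (c : Fin 3 → Fin 3 → ℝ≥0∞) :
    π.switchingCost P q c = ∫⁻ ω, π.pathSwitch q c ω ∂P := by
  unfold switchingCost pathSwitch disc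
  refine lintegral_congr fun ω => tsum_congr fun k => ?_
  split_ifs <;> simp

/-! ### Discounted numbers of switches -/

section Flow

variable {π : Strategy Ω} {q : ℝ} {ω : Ω}

theorem disc_antitone (hq : 0 < q) (hm : Monotone fun k => π.T k ω) :
    Antitone fun k => π.disc q k ω := by
  intro a b hab
  have h := hm hab
  simp only [disc]
  by_cases hb : π.T b ω = ⊤
  · simp [hb]
  · have ha : π.T a ω ≠ ⊤ := ne_top_of_le_ne_top hb h
    rw [if_neg hb, if_neg ha]
    refine ENNReal.ofReal_le_ofReal (Real.exp_le_exp.2 ?_)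
    obtain ⟨s, hs⟩ := WithTop.ne_top_iff_exists.1 ha
    obtain ⟨t, ht⟩ := WithTop.ne_top_iff_exists.1 hb
    simp only [← hs, ← ht, WithTop.untopD_coe] at h ⊢
    have : (s : ℝ) ≤ t := by exact_mod_cast h
    nlinarith

theorem disc_zero (h0 : π.T 0 ω = 0) : π.disc q 0 ω = 1 := by
  have : (0 : WithTop ℝ≥0) ≠ ⊤ := WithTop.zero_ne_top
  simp [disc, h0, this]

theorem disc_of_top {k : ℕ} (h : π.T k ω = ⊤) : π.disc q k ω = 0 := if_pos h

theorem disc_of_coe {k : ℕ} {t : ℝ≥0} (h : π.T k ω = t) :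
    π.disc q k ω = ENNReal.ofReal (Real.exp (-q * t)) := by
  rw [disc, if_neg (by rw [h]; exact WithTop.coe_ne_top), h, WithTop.untopD_coe]

theorem pathSwitch_mono {c c' : Fin 3 → Fin 3 → ℝ≥0∞}
    (h : ∀ k, π.T (k + 1) ω ≠ ⊤ →
      c (π.J k ω) (π.J (k + 1) ω) ≤ c' (π.J k ω) (π.J (k + 1) ω)) :
    π.pathSwitch q c ω ≤ π.pathSwitch q c' ω := by
  refine ENNReal.tsum_le_tsum fun k => ?_
  by_cases hk : π.T (k + 1) ω = ⊤
  · simp [disc_of_top hk]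
  · gcongr
    exact h k hk

theorem pathSwitch_add (c c' : Fin 3 → Fin 3 → ℝ≥0∞) :
    π.pathSwitch q (fun a b => c a b + c' a b) ω = π.pathSwitch q c ω + π.pathSwitch q c' ω := by
  simp only [pathSwitch, mul_add]
  exact ENNReal.tsum_add

theorem pathSwitch_const_mul (r : ℝ≥0∞) (c : Fin 3 → Fin 3 → ℝ≥0∞) :
    π.pathSwitch q (fun a b => r * c a b) ω = r * π.pathSwitch q c ω := by
  simp only [pathSwitch]
  rw [← ENNReal.tsum_mul_left]
  exact tsum_congr fun k => by ring

/-- A path leaves a set of phases at most once more often than it enters it. -/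
theorem pathSwitch_out_le (hq : 0 < q) (h0 : π.T 0 ω = 0) (hm : Monotone fun k => π.T k ω)
    (A : Finset (Fin 3)) :
    π.pathSwitch q (fun a b => if a ∈ A ∧ b ∉ A then 1 else 0) ω ≤
      1 + π.pathSwitch q (fun a b => if a ∉ A ∧ b ∈ A then 1 else 0) ω := by
  -- The extra term, the current discount factor while the phase lies in `A`, is what makes the
  -- induction close: it pays for the next exit, since discount factors decrease.
  have key : ∀ n, (∑ k ∈ Finset.range n, π.disc q (k + 1) ω *
        (if π.J k ω ∈ A ∧ π.J (k + 1) ω ∉ A then 1 else 0)) +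
        π.disc q n ω * (if π.J n ω ∈ A then 1 else 0) ≤
      1 + ∑ k ∈ Finset.range n, π.disc q (k + 1) ω *
        (if π.J k ω ∉ A ∧ π.J (k + 1) ω ∈ A then 1 else 0) := by
    intro n
    induction n with
    | zero =>
      rw [disc_zero h0]
      split_ifs <;> simp
    | succ n ih =>
      have hd : π.disc q (n + 1) ω ≤ π.disc q n ω := disc_antitone hq hm n.le_succ
      rw [Finset.sum_range_succ, Finset.sum_range_succ]
      by_cases h1 : π.J n ω ∈ A <;> by_cases h2 : π.J (n + 1) ω ∈ A <;>
        simp only [h1, h2, not_true, not_false_eq_true, and_true, and_false, if_true, if_false,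
          mul_one, mul_zero, add_zero] at ih ⊢
      · exact (add_le_add le_rfl hd).trans ih
      · exact (add_le_add le_rfl hd).trans ih
      · rw [← add_assoc]
        exact add_le_add ih le_rfl
      · exact ih
  unfold pathSwitch
  rw [ENNReal.tsum_eq_iSup_nat]
  refine iSup_le fun n => ?_
  exact le_self_add.trans ((key n).trans (add_le_add le_rfl (ENNReal.sum_le_tsum _)))

end Flow

/-! ### Pathwise bounds for switching, penalty and holding costs -/

section Bounds

variable {π : Strategy Ω} {D : Demand P M} {x : ℝ} {i : Fin 3} {ω : Ω}

/-- Production is switched on again only at a demand time. -/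
theorem PathAdmissible.exists_eq_τ (hM : M.Standing) (h : π.PathAdmissible D x i ω) (hi : i ≠ 0)
    {k : ℕ} (hk : π.T (k + 1) ω ≠ ⊤) (hJ : π.J k ω = 0) :
    ∃ n, (((π.T (k + 1) ω).untopD 0 : ℝ≥0) : ℝ) = D.τ (n + 1) ω := by
  -- The initial phase is not `0`, so production was switched off at an earlier switch, at a time
  -- `s` before `t`.
  obtain ⟨k, rfl⟩ : ∃ k', k = k' + 1 := by
    refine Nat.exists_eq_succ_of_ne_zero fun h0 => hi ?_
    rw [← h.J_zero, ← hJ, h0]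
  have hk' : π.T (k + 1) ω ≠ ⊤ := ne_top_of_le_ne_top hk (h.T_mono k)
  obtain ⟨s, hs⟩ := WithTop.ne_top_iff_exists.1 hk'
  obtain ⟨t, ht⟩ := WithTop.ne_top_iff_exists.1 hk
  rw [← ht]
  simp only [WithTop.untopD_coe]
  have hst : (s : ℝ) < t := by
    have := h.T_strict k hk'
    rw [← hs, ← ht] at this
    exact_mod_cast this
  have hlt : (t : WithTop ℝ≥0) < π.T (k + 1 + 1 + 1) ω := by
    have := h.T_strict (k + 1) hk
    rwa [← ht] at this
  have hpt : π.phase t ω = π.J (k + 1 + 1) ω :=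
    phase_eq h.monotone_T (by rw [← ht, Real.toNNReal_coe]) (by simpa using hlt)
  have hps : ∀ r : ℝ, s ≤ r → r < t → π.phase r ω = 0 := by
    intro r h1 h2
    rw [← hJ]
    refine phase_eq h.monotone_T ?_ ?_
    · rw [← hs]
      exact_mod_cast NNReal.le_toNNReal_of_coe_le h1
    · rw [← ht]
      have : r.toNNReal < t := (Real.toNNReal_lt_iff_lt_coe (s.coe_nonneg.trans h1)).2 h2
      exact_mod_cast this
  have hne : π.phase t ω ≠ 0 := by
    rw [hpt, ← hJ]
    exact h.J_ne (k + 1) hk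
  obtain ⟨n, h1, h2⟩ := D.exists_τ_le_lt ω t.coe_nonneg
  rcases h1.eq_or_lt with h1 | h1
  · cases n with
    | zero =>
      rw [D.τ_zero] at h1
      have := s.coe_nonneg
      linarith
    | succ n => exact ⟨n, h1.symm⟩
  · exfalso
    -- If `t` is not a demand time, production is off at some `r < t` after the last demand. The
    -- level at `r` is then `b`; it is still `b` at `t`, and production must stay off.
    obtain ⟨r, hr1, hr2⟩ := exists_between (max_lt h1 hst)
    have hr3 : D.τ n ω ≤ r := (le_max_left _ _).trans hr1.le
    have hr4 : (s : ℝ) ≤ r := (le_max_right _ _).trans hr1.le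
    have hr0 : 0 ≤ r := s.coe_nonneg.trans hr4
    have hb : π.inventory D x r ω = M.b := by
      by_contra hc
      exact h.phase_on r hr0 (lt_of_le_of_ne (h.level_le r hr0) hc) (hps r hr4 hr2)
    refine hne (h.phase_off t t.coe_nonneg ?_)
    have h2' : (t : ℝ) < D.τ (n + 1) ω := h2
    rw [π.inventory_eq_add x hr3 hr2.le h2', hb, π.produced_eq_of_phase ω hr2.le
      fun u hu1 hu2 => hps u (hr4.trans hu1) hu2, hM.σ_zero]
    simp

/-- Distinct switches out of phase `0` happen at distinct demand times, so their discount factors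
form a subfamily of those of the demands. -/
theorem PathAdmissible.pathSwitch_on_le (hM : M.Standing) (h : π.PathAdmissible D x i ω)
    (hi : i ≠ 0) :
    π.pathSwitch M.q (fun a _ => if a = 0 then 1 else 0) ω ≤ D.disc ω := by
  classical
  let S : Set ℕ := {k | π.T (k + 1) ω ≠ ⊤ ∧ π.J k ω = 0}
  have hex : ∀ k : S, ∃ n, (((π.T (k + 1) ω).untopD 0 : ℝ≥0) : ℝ) = D.τ (n + 1) ω := fun k =>
    h.exists_eq_τ hM hi k.2.1 k.2.2
  choose f hf using hex
  have hinj : Function.Injective f := by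
    have hlt : ∀ a b : S, (a : ℕ) < b → f a ≠ f b := by
      intro a b hab he
      have h1 := hf a
      rw [he, ← hf b] at h1
      have h1 := NNReal.coe_injective h1
      obtain ⟨s, hs⟩ := WithTop.ne_top_iff_exists.1 a.2.1
      obtain ⟨t, ht⟩ := WithTop.ne_top_iff_exists.1 b.2.1
      have h2 : π.T (a + 1) ω < π.T (b + 1) ω :=
        (h.T_strict a a.2.1).trans_le (h.monotone_T (by omega : (a : ℕ) + 2 ≤ b + 1))
      rw [← hs, ← ht] at h1 h2
      simp only [WithTop.untopD_coe] at h1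
      rw [h1] at h2
      exact lt_irrefl _ h2
    intro a b he
    rcases lt_trichotomy (a : ℕ) b with hab | hab | hab
    · exact absurd he (hlt a b hab)
    · exact Subtype.ext hab
    · exact absurd he.symm (hlt b a hab)
  calc π.pathSwitch M.q (fun a _ => if a = 0 then 1 else 0) ω
      = ∑' k : S, π.disc M.q (k + 1) ω := by
        unfold pathSwitch
        rw [tsum_subtype S fun k => π.disc M.q (k + 1) ω]
        refine tsum_congr fun k => ?_
        by_cases hT : π.T (k + 1) ω = ⊤
        · simp [disc_of_top hT, indicator]
        · by_cases hJ : π.J k ω = 0 <;> simp [S, indicator, hT, hJ]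
    _ = ∑' k : S, ENNReal.ofReal (Real.exp (-M.q * D.τ (f k + 1) ω)) := by
        refine tsum_congr fun k => ?_
        rw [← hf k, disc, if_neg k.2.1]
    _ ≤ D.disc ω :=
        ENNReal.tsum_comp_le_tsum_of_injective hinj
          fun n => ENNReal.ofReal (Real.exp (-M.q * D.τ (n + 1) ω))

/-- Flow balance for the set of phases $\{1,2\}$: it is left at most once more than it is entered,
and it is entered only from phase `0`. -/
theorem PathAdmissible.pathSwitch_off_le (hM : M.Standing) (h : π.PathAdmissible D x i ω)
    (hi : i ≠ 0) :
    π.pathSwitch M.q (fun _ b => if b = 0 then 1 else 0) ω ≤ 1 + D.disc ω := by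
  have h1 := pathSwitch_out_le (π := π) hM.q_pos h.T_zero h.monotone_T {1, 2}
  refine (pathSwitch_mono fun k hk => ?_).trans (h1.trans (add_le_add le_rfl
    ((pathSwitch_mono fun k hk => ?_).trans (h.pathSwitch_on_le hM hi))))
  · have := h.J_ne k hk
    generalize π.J k ω = a at *
    generalize π.J (k + 1) ω = b at *
    revert this
    fin_cases a <;> fin_cases b <;> simp
  · generalize π.J k ω = a
    generalize π.J (k + 1) ω = b
    fin_cases a <;> fin_cases b <;> simp

/-- Switches involving phase `0` are bounded through the demand times. Of $K_{12}$ and $K_{21}$ at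
most one is negative, and it is smaller in absolute value than the other. By flow balance each
switch with the negative cost is matched by one in the opposite direction, up to $1+d$ of them in
discounted count, so what it earns is covered by the positive part. -/
theorem PathAdmissible.pathNeg_le (hM : M.Standing) (h : π.PathAdmissible D x i ω) (hi : i ≠ 0) :
    π.pathNeg M ω ≤ π.pathSwitch M.q (fun a b => ENNReal.ofReal (M.K a b)) ω +
      3 * M.maxK * (1 + D.disc ω) := by
  have hon := h.pathSwitch_on_le hM hi
  have hoff := h.pathSwitch_off_le hM hi
  set κ := M.maxK
  set d := D.disc ω
  set n12 := ENNReal.ofReal (-M.K 1 2)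
  set n21 := ENNReal.ofReal (-M.K 2 1)
  set s12 := π.pathSwitch M.q (fun a b => if a = 1 ∧ b = 2 then 1 else 0) ω
  set s21 := π.pathSwitch M.q (fun a b => if a = 2 ∧ b = 1 then 1 else 0) ω
  have hneg : π.pathNeg M ω ≤ κ * (1 + 2 * d) + (n12 * s12 + n21 * s21) := by
    calc π.pathNeg M ω ≤ π.pathSwitch M.q (fun a b =>
          (κ * (if a = 0 then 1 else 0) + κ * (if b = 0 then 1 else 0)) +
          (n12 * (if a = 1 ∧ b = 2 then 1 else 0) + n21 * (if a = 2 ∧ b = 1 then 1 else 0))) ω := by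
          refine pathSwitch_mono fun k hk => ?_
          have h1 := h.J_ne k hk
          have h2 := M.ofReal_neg_K_le (π.J k ω) (π.J (k + 1) ω)
          generalize π.J k ω = a at *
          generalize π.J (k + 1) ω = b at *
          by_cases ha : a = 0
          · refine h2.trans ?_
            rw [if_pos ha, mul_one, add_assoc]
            exact le_self_add
          by_cases hb : b = 0
          · refine h2.trans ?_
            rw [if_pos hb, mul_one, add_right_comm]
            exact le_add_self
          · fin_cases a <;> fin_cases b <;> simp_all [n12, n21]
      _ = (κ * π.pathSwitch M.q (fun a _ => if a = 0 then 1 else 0) ω +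
            κ * π.pathSwitch M.q (fun _ b => if b = 0 then 1 else 0) ω) +
          (n12 * s12 + n21 * s21) := by
          simp only [pathSwitch_add, pathSwitch_const_mul, s12, s21]
      _ ≤ (κ * d + κ * (1 + d)) + (n12 * s12 + n21 * s21) := by gcongr
      _ = _ := by ring
  have hpos : ∀ a b : Fin 3, ENNReal.ofReal (M.K a b) *
      π.pathSwitch M.q (fun a' b' => if a' = a ∧ b' = b then 1 else 0) ω ≤
      π.pathSwitch M.q (fun a b => ENNReal.ofReal (M.K a b)) ω := by
    intro a b
    rw [← pathSwitch_const_mul]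
    refine pathSwitch_mono fun k _ => ?_
    split_ifs with hc
    · rw [hc.1, hc.2, mul_one]
    · simp
  -- Flow balance for phase `1` alone: it is entered from phase `2` or from phase `0`.
  have h12 : s12 ≤ 1 + (s21 + d) := by
    have h1 := pathSwitch_out_le (π := π) hM.q_pos h.T_zero h.monotone_T {1}
    refine (pathSwitch_mono fun k hk => ?_).trans (h1.trans (add_le_add le_rfl
      ((pathSwitch_mono (c' := fun a b => (if a = 2 ∧ b = 1 then 1 else 0) +
        (if a = 0 then 1 else 0)) fun k hk => ?_).trans ?_)))
    · generalize π.J k ω = a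
      generalize π.J (k + 1) ω = b
      fin_cases a <;> fin_cases b <;> simp
    · generalize π.J k ω = a
      generalize π.J (k + 1) ω = b
      fin_cases a <;> fin_cases b <;> simp
    · rw [pathSwitch_add]
      exact add_le_add le_rfl hon
  have h21 : s21 ≤ 1 + (s12 + d) := by
    have h1 := pathSwitch_out_le (π := π) hM.q_pos h.T_zero h.monotone_T {2}
    refine (pathSwitch_mono fun k hk => ?_).trans (h1.trans (add_le_add le_rfl
      ((pathSwitch_mono (c' := fun a b => (if a = 1 ∧ b = 2 then 1 else 0) +
        (if a = 0 then 1 else 0)) fun k hk => ?_).trans ?_)))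
    · generalize π.J k ω = a
      generalize π.J (k + 1) ω = b
      fin_cases a <;> fin_cases b <;> simp
    · generalize π.J k ω = a
      generalize π.J (k + 1) ω = b
      fin_cases a <;> fin_cases b <;> simp
    · rw [pathSwitch_add]
      exact add_le_add le_rfl hon
  have hK := hM.K_sum_pos
  set kp := π.pathSwitch M.q (fun a b => ENNReal.ofReal (M.K a b)) ω
  -- Only one of the two terms can be nonzero, and the condition $K_{12}+K_{21}>0$ compares its
  -- coefficient with the cost of the reverse switch.
  have hmain : n12 * s12 + n21 * s21 ≤ kp + κ * (1 + d) := by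
    rcases le_or_gt 0 (M.K 2 1) with hc | hc
    · have e21 : n21 = 0 := ENNReal.ofReal_of_nonpos (by linarith)
      rw [e21, zero_mul, add_zero]
      calc n12 * s12 ≤ n12 * (1 + (s21 + d)) := by gcongr
        _ = n12 * s21 + n12 * (1 + d) := by ring
        _ ≤ kp + κ * (1 + d) := by
          gcongr
          · refine le_trans ?_ (hpos 2 1)
            gcongr
            exact ENNReal.ofReal_le_ofReal (by linarith)
          · exact M.ofReal_neg_K_le 1 2
    · have e12 : n12 = 0 := ENNReal.ofReal_of_nonpos (by linarith)
      rw [e12, zero_mul, zero_add]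
      calc n21 * s21 ≤ n21 * (1 + (s12 + d)) := by gcongr
        _ = n21 * s12 + n21 * (1 + d) := by ring
        _ ≤ kp + κ * (1 + d) := by
          gcongr
          · refine le_trans ?_ (hpos 1 2)
            gcongr
            exact ENNReal.ofReal_le_ofReal (by linarith)
          · exact M.ofReal_neg_K_le 2 1
  calc π.pathNeg M ω ≤ κ * (1 + 2 * d) + (kp + κ * (1 + d)) := by
        exact hneg.trans (add_le_add le_rfl hmain)
    _ = kp + κ * (2 + 3 * d) := by ring
    _ ≤ kp + κ * (3 + 3 * d) := by
        gcongr
        norm_num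
    _ = kp + 3 * κ * (1 + d) := by ring

/-- Along a path that switches only to and from phase `0`, the switching cost is controlled by the
demand times. -/
theorem PathAdmissible.pathSwitch_le_of_simple (hM : M.Standing) (h : π.PathAdmissible D x i ω)
    (hi : i ≠ 0) (hs : ∀ k, π.J k ω = 0 ∨ π.J (k + 1) ω = 0) :
    π.pathSwitch M.q (fun a b => ENNReal.ofReal (M.K a b)) ω ≤ 3 * M.maxK * (1 + D.disc ω) := by
  calc π.pathSwitch M.q (fun a b => ENNReal.ofReal (M.K a b)) ω
      ≤ π.pathSwitch M.q (fun a b =>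
          M.maxK * (if a = 0 then 1 else 0) + M.maxK * (if b = 0 then 1 else 0)) ω := by
        refine pathSwitch_mono fun k _ => (M.ofReal_K_le _ _).trans ?_
        rcases hs k with hk | hk <;> simp [hk]
    _ = M.maxK * π.pathSwitch M.q (fun a _ => if a = 0 then 1 else 0) ω +
          M.maxK * π.pathSwitch M.q (fun _ b => if b = 0 then 1 else 0) ω := by
        simp only [pathSwitch_add, pathSwitch_const_mul]
    _ ≤ M.maxK * D.disc ω + M.maxK * (1 + D.disc ω) :=
        add_le_add (mul_le_mul_right (h.pathSwitch_on_le hM hi) _)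
          (mul_le_mul_right (h.pathSwitch_off_le hM hi) _)
    _ = M.maxK * (1 + 2 * D.disc ω) := by ring
    _ ≤ M.maxK * (3 + 3 * D.disc ω) := by
        gcongr <;> norm_num
    _ = 3 * M.maxK * (1 + D.disc ω) := by ring

/-- The level before a demand is at least `l`, so the shortage is at most the demand, and `p` is
monotone. -/
theorem pathPenalty_le (hM : M.Standing) (hx : M.l ≤ x) :
    π.pathPenalty D x ω ≤ ∑' n : ℕ, ENNReal.ofReal (Real.exp (-M.q * D.τ (n + 1) ω)) *
      ENNReal.ofReal (M.p (D.Y n ω)) := by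
  refine ENNReal.tsum_le_tsum fun n => ?_
  split_ifs with hc
  · rw [← ENNReal.ofReal_mul (Real.exp_pos _).le]
    refine ENNReal.ofReal_le_ofReal (mul_le_mul_of_nonneg_left ?_ (Real.exp_pos _).le)
    have := π.levelBefore_ge D ω hM hx n
    exact hM.p_mono (mem_Ici.2 (by linarith)) (mem_Ici.2 (D.Y_pos n ω).le) (by linarith)
  · exact zero_le

theorem exists_rate_bound (hM : M.Standing) :
    ∃ C, 0 ≤ C ∧ ∀ j z, 0 ≤ M.rate j z ∧ M.rate j z ≤ C := by
  obtain ⟨C, hC⟩ := hM.h_bounded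
  refine ⟨max (max C 0) (M.h 0 M.b), (le_max_right C 0).trans (le_max_left _ _), fun j z => ?_⟩
  unfold Model.rate
  split_ifs with h1 h2
  · exact ⟨hM.h_zero_nonneg, le_max_right _ _⟩
  · exact ⟨hM.h_nonneg j h1 z h2, (hC j h1 z h2).trans ((le_max_left _ _).trans (le_max_left _ _))⟩
  · exact ⟨le_rfl, (le_max_right C 0).trans (le_max_left _ _)⟩

theorem lintegral_exp_Ici {q : ℝ} (hq : 0 < q) :
    ∫⁻ t in Ici (0 : ℝ), ENNReal.ofReal (Real.exp (-q * t)) = ENNReal.ofReal (1 / q) := by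
  rw [setLIntegral_congr Ioi_ae_eq_Ici.symm, ← ofReal_integral_eq_lintegral_ofReal]
  · rw [integral_exp_mul_Ioi (by linarith)]
    simp [neg_div_neg_eq]
  · exact integrableOn_exp_mul_Ioi (by linarith) 0
  · exact Eventually.of_forall fun t => (Real.exp_pos _).le

theorem pathHold_le (hM : M.Standing) {C : ℝ} (hC : ∀ j z, M.rate j z ≤ C) :
    π.pathHold D x ω ≤ ENNReal.ofReal (1 / M.q) * ENNReal.ofReal C := by
  rw [← lintegral_exp_Ici hM.q_pos, ← lintegral_mul_const _ (by fun_prop)]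
  refine lintegral_mono fun t => ?_
  rw [← ENNReal.ofReal_mul (Real.exp_pos _).le]
  exact ENNReal.ofReal_le_ofReal (mul_le_mul_of_nonneg_left (hC _ _) (Real.exp_pos _).le)

/-- Phase `0` and level `b` occur together on an admissible path, so the truncation in `Model.rate`
is invisible. The truncated rate is measurable and bounded everywhere, which `h` need not be. -/
theorem Admissible.holdingCost_eq (hM : M.Standing) (h : π.Admissible D x i) (hx : M.l ≤ x) :
    π.holdingCost D x = ∫⁻ ω, π.pathHold D x ω ∂P := by
  refine lintegral_congr_ae ?_
  filter_upwards [h.path] with ω hω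
  refine setLIntegral_congr_fun measurableSet_Ici fun t (ht : 0 ≤ t) => ?_
  have h1 := π.inventory_ge (D := D) (ω := ω) hM hx ht
  unfold Model.rate
  rcases (hω.level_le t ht).eq_or_lt with hb | hb
  · simp [hω.phase_off t ht hb, hb]
  · simp only [hω.phase_on t ht hb, if_false]
    rw [if_pos ⟨h1, hb⟩]

end Bounds

end Strategy

/-! ### Measurability of levels and pathwise costs -/

theorem Model.Standing.measurable_rate {M : Model} (hM : M.Standing) :
    Measurable fun z : Fin 3 × ℝ => M.rate z.1 z.2 := by
  refine measurable_from_prod_countable_right fun j => ?_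
  by_cases hj : j = 0
  · simp only [Model.rate, hj, if_true]
    exact measurable_const
  · have hs : MeasurableSet (Ico M.l M.b \ M.discontinuities j) :=
      measurableSet_Ico.diff (hM.h_discontinuities j hj).measurableSet
    have hcont : ContinuousOn (M.h j) (Ico M.l M.b \ M.discontinuities j) := by
      intro z hz
      have : ContinuousWithinAt (M.h j) (Ico M.l M.b) z := by
        by_contra hc
        exact hz.2 ⟨hz.1, hc⟩
      exact this.mono sdiff_subset
    classical
    have h1 : Measurable ((Ico M.l M.b \ M.discontinuities j).piecewise (M.h j) 0) :=
      hcont.measurable_piecewise continuousOn_const hs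
    refine measurable_of_measurable_on_compl_finite (M.discontinuities j)
      (hM.h_discontinuities j hj) ?_
    have h2 : (M.discontinuities j)ᶜ.domRestrict (fun z => M.rate j z) =
        (M.discontinuities j)ᶜ.domRestrict
          ((Ico M.l M.b \ M.discontinuities j).piecewise (M.h j) 0) := by
      ext ⟨z, hz⟩
      simp only [domRestrict_apply, Model.rate, hj, if_false, piecewise, Set.mem_sdiff]
      by_cases hz' : z ∈ Ico M.l M.b
      · rw [if_pos hz', if_pos ⟨hz', hz⟩]
      · rw [if_neg hz', if_neg fun h => hz' h.1]
        rfl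
    rw [h2]
    exact h1.comp measurable_subtype_coe

namespace Strategy

variable {Ω : Type*} [MeasurableSpace Ω] {P : Measure Ω} {M : Model} {π : Strategy Ω}

section Measurability

variable (hT : ∀ k, Measurable (π.T k)) (hJ : ∀ k, Measurable (π.J k))
include hT hJ

theorem measurable_produced {α : Type*} [MeasurableSpace α] {s t : α → ℝ} {g : α → Ω}
    (hs : Measurable s) (ht : Measurable t) (hg : Measurable g) :
    Measurable fun z => π.produced M (s z) (t z) (g z) := by
  have key : ∀ {s t : α → ℝ}, Measurable s → Measurable t →
      Measurable fun z => ∫ r in Ioc (s z) (t z), M.σ (π.phase r (g z)) := by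
    intro s t hs ht
    simp_rw [← integral_indicator measurableSet_Ioc]
    have hm : Measurable (Function.uncurry fun z r =>
        (Ioc (s z) (t z)).indicator (fun r => M.σ (π.phase r (g z))) r) := by
      have h0 : Measurable fun p : α × ℝ => π.phase p.2 (g p.1) := by
        have h : Measurable fun p : α × ℝ => (p.2, g p.1) :=
          measurable_snd.prodMk (hg.comp measurable_fst)
        have h' := (measurable_phase hT hJ).comp h
        exact h'
      have h1 : Measurable fun p : α × ℝ => M.σ (π.phase p.2 (g p.1)) :=
        (Measurable.of_discrete (f := M.σ)).comp h0
      have h2 : MeasurableSet {p : α × ℝ | s p.1 < p.2 ∧ p.2 ≤ t p.1} :=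
        (measurableSet_lt (hs.comp measurable_fst) measurable_snd).inter
          (measurableSet_le measurable_snd (ht.comp measurable_fst))
      exact h1.indicator h2
    exact (StronglyMeasurable.integral_prod_right hm.stronglyMeasurable).measurable
  exact (key hs ht).sub (key ht hs)

theorem measurable_levelAfter (D : Demand P M) (x : ℝ) (n : ℕ) :
    Measurable (π.levelAfter D x n) := by
  induction n with
  | zero => exact measurable_const
  | succ n ih =>
    have h1 : Measurable fun ω => π.levelAfter D x n ω +
        π.produced M (D.τ n ω) (D.τ (n + 1) ω) ω :=
      ih.add (measurable_produced hT hJ (D.measurable_τ n) (D.measurable_τ (n + 1)) measurable_id)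
    exact h1.sub ((D.measurable_Y n).min (h1.sub_const _))

theorem measurable_levelBefore (D : Demand P M) (x : ℝ) (n : ℕ) :
    Measurable (π.levelBefore D x n) :=
  (measurable_levelAfter hT hJ D x n).add
    (measurable_produced hT hJ (D.measurable_τ n) (D.measurable_τ (n + 1)) measurable_id)

theorem measurable_inventory (D : Demand P M) (x : ℝ) :
    Measurable fun z : ℝ × Ω => π.inventory D x z.1 z.2 := by
  have h1 : Measurable fun z : ℕ × Ω => π.levelAfter D x z.1 z.2 :=
    measurable_from_prod_countable_right fun n => measurable_levelAfter hT hJ D x n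
  have h2 : Measurable fun z : ℕ × Ω => D.τ z.1 z.2 :=
    measurable_from_prod_countable_right fun n => D.measurable_τ n
  have hN := D.measurable_N.prodMk (measurable_snd (α := ℝ) (β := Ω))
  exact (h1.comp hN).add (measurable_produced hT hJ (h2.comp hN) measurable_fst measurable_snd)

theorem measurable_pathHold (hM : M.Standing) (D : Demand P M) (x : ℝ) :
    Measurable (π.pathHold D x) := by
  have h1 : Measurable fun z : Ω × ℝ => ENNReal.ofReal (Real.exp (-M.q * z.2) *
      M.rate (π.phase z.2 z.1) (π.inventory D x z.2 z.1)) := by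
    have h2 := (hM.measurable_rate.comp (((measurable_phase hT hJ).comp measurable_swap).prodMk
      ((measurable_inventory hT hJ D x).comp measurable_swap)))
    have h3 : Measurable fun z : Ω × ℝ => Real.exp (-M.q * z.2) := by fun_prop
    exact (h3.mul h2).ennreal_ofReal
  exact h1.lintegral_prod_right'

theorem measurable_pathSwitch (q : ℝ) (c : Fin 3 → Fin 3 → ℝ≥0∞) :
    Measurable (π.pathSwitch q c) := by
  refine Measurable.tsum fun k => ?_
  have h1 : Measurable (π.disc q (k + 1)) := by
    refine Measurable.ite (hT _ (measurableSet_singleton _)) measurable_const ?_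
    exact (((hT (k + 1)).untopD 0).coe_nnreal_real.const_mul (-q)).exp.ennreal_ofReal
  have h2 : Measurable fun z : Fin 3 × Fin 3 => c z.1 z.2 := Measurable.of_discrete
  exact h1.mul (h2.comp ((hJ k).prodMk (hJ (k + 1))))

/-- `p` is monotone only on $[0,\infty)$. Truncating its argument below at `0` gives a monotone
function on the line, with the same values wherever a penalty is charged. -/
theorem measurable_pathPenalty (hM : M.Standing) (D : Demand P M) (x : ℝ) :
    Measurable (π.pathPenalty D x) := by
  have h1 : Measurable fun z => M.p (max z 0) :=
    Monotone.measurable fun a b hab => hM.p_mono (mem_Ici.2 (le_max_right _ _)) (mem_Ici.2 (le_max_right _ _))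
      (max_le_max_right 0 hab)
  have hB := measurable_levelBefore hT hJ D x
  refine Measurable.tsum fun n => ?_
  have h2 : Measurable fun ω => (if π.levelBefore D x n ω - M.l < D.Y n ω then
      ENNReal.ofReal (Real.exp (-M.q * D.τ (n + 1) ω) *
        M.p (max (D.Y n ω - π.levelBefore D x n ω + M.l) 0)) else 0) := by
    refine Measurable.ite (measurableSet_lt ((hB n).sub_const _) (D.measurable_Y n)) ?_
      measurable_const
    exact (((D.measurable_τ (n + 1)).const_mul _).exp.mul
      (h1.comp (((D.measurable_Y n).sub (hB n)).add_const _))).ennreal_ofReal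
  convert h2 using 1
  ext ω
  split_ifs with hc
  · rw [max_eq_left (by linarith)]
  · rfl

theorem measurable_pathPos (hM : M.Standing) (D : Demand P M) (x : ℝ) :
    Measurable (π.pathPos D x) :=
  ((measurable_pathHold hT hJ hM D x).add (measurable_pathPenalty hT hJ hM D x)).add
    (measurable_pathSwitch hT hJ _ _)

theorem measurable_pathNeg (M : Model) : Measurable (π.pathNeg M) :=
  measurable_pathSwitch hT hJ _ _

end Measurability

/-! ### Admissibility of a path is a measurable event -/

section Rational

variable {D : Demand P M} {x : ℝ} {i : Fin 3} {ω : Ω}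

/-- Immediately to the right of each time, the phase is constant and the level is affine. -/
theorem exists_right_affine (h0 : π.T 0 ω = 0) (hm : Monotone fun k => π.T k ω)
    (hf : ∀ n : ℕ, {k : ℕ | π.T k ω ≤ ((n : ℝ≥0) : WithTop ℝ≥0)}.Finite) {t : ℝ} (ht : 0 ≤ t) :
    ∃ u, t < u ∧ ∀ s, t ≤ s → s < u → π.phase s ω = π.phase t ω ∧
      π.inventory D x s ω = π.inventory D x t ω + M.σ (π.phase t ω) * (s - t) := by
  have hf' : ∀ t : ℝ≥0, {k : ℕ | π.T k ω ≤ (t : WithTop ℝ≥0)}.Finite := by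
    intro t
    obtain ⟨n, hn⟩ := exists_nat_ge t
    refine (hf n).subset fun k (hk : π.T k ω ≤ t) => hk.trans ?_
    exact_mod_cast hn
  obtain ⟨k, hk1, hk2⟩ := exists_T_le_lt h0 hf' t.toNNReal
  obtain ⟨n, hn1, hn2⟩ := D.exists_τ_le_lt ω ht
  obtain ⟨v, hv1, hv2⟩ : ∃ v : ℝ, t < v ∧ ∀ s, t ≤ s → s < v → π.phase s ω = π.phase t ω := by
    have hpt := phase_eq hm hk1 hk2
    have hstep : ∀ s, t ≤ s → ((s.toNNReal : ℝ≥0) : WithTop ℝ≥0) < π.T (k + 1) ω →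
        π.phase s ω = π.phase t ω := by
      intro s hs hlt
      rw [hpt]
      refine phase_eq hm (hk1.trans ?_) hlt
      exact_mod_cast Real.toNNReal_le_toNNReal hs
    by_cases hT : π.T (k + 1) ω = ⊤
    · exact ⟨t + 1, by linarith, fun s hs _ => hstep s hs (by rw [hT]; exact WithTop.coe_lt_top _)⟩
    · obtain ⟨v, hv⟩ := WithTop.ne_top_iff_exists.1 hT
      rw [← hv] at hk2 hstep
      refine ⟨v, ?_, fun s hs hlt => hstep s hs ?_⟩
      · exact (Real.toNNReal_lt_iff_lt_coe ht).1 (by exact_mod_cast hk2)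
      · exact_mod_cast (Real.toNNReal_lt_iff_lt_coe (ht.trans hs)).2 hlt
  refine ⟨min v (D.τ (n + 1) ω), lt_min hv1 hn2, fun s hs hlt => ?_⟩
  have h1 := hlt.trans_le (min_le_left _ _)
  refine ⟨hv2 s hs h1, ?_⟩
  rw [π.inventory_eq_add x hn1 hs (hlt.trans_le (min_le_right _ _)),
    π.produced_eq_of_phase ω hs fun r hr1 hr2 => hv2 r hr1 (hr2.trans h1)]

/-- Right after each time the phase is constant and the level affine, so rational times detect every
violation of the level and phase conditions. This leaves countably many conditions. The condition
that production is off at level `b` follows from the bound on the level. -/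
theorem pathAdmissible_iff (hM : M.Standing) : π.PathAdmissible D x i ω ↔
    ((π.T 0 ω = 0 ∧ π.J 0 ω = i) ∧ (∀ k, π.T (k + 1) ω ≤ π.T (k + 2) ω)) ∧
    ((∀ k, π.T (k + 1) ω ≠ ⊤ → π.T (k + 1) ω < π.T (k + 2) ω) ∧
      ∀ k, π.T (k + 1) ω ≠ ⊤ → π.J (k + 1) ω ≠ π.J k ω) ∧
    (∀ n : ℕ, ∃ m, ∀ k, m ≤ k → ¬ π.T k ω ≤ ((n : ℝ≥0) : WithTop ℝ≥0)) ∧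
    (∀ r : ℚ, 0 ≤ (r : ℝ) → π.inventory D x r ω ≤ M.b) ∧
    ∀ r : ℚ, 0 ≤ (r : ℝ) → π.inventory D x r ω < M.b → π.phase r ω ≠ 0 := by
  constructor
  · intro h
    refine ⟨⟨⟨h.T_zero, h.J_zero⟩, h.T_mono⟩, ⟨h.T_strict, h.J_ne⟩, fun n => ?_,
      fun r hr => h.level_le r hr, fun r hr => h.phase_on r hr⟩
    obtain ⟨m, hm⟩ := (h.T_locally_finite n).bddAbove
    exact ⟨m + 1, fun k hk hc => absurd (hm hc) (by omega)⟩
  · rintro ⟨⟨⟨h1, h2⟩, h3⟩, ⟨h4, h5⟩, h6, h7, h8⟩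
    have hm := Strategy.monotone_T h1 h3
    have hf : ∀ n : ℕ, {k : ℕ | π.T k ω ≤ ((n : ℝ≥0) : WithTop ℝ≥0)}.Finite := by
      intro n
      obtain ⟨m, hm⟩ := h6 n
      refine (Set.finite_Iio m).subset fun k hk => ?_
      by_contra hc
      exact hm k (not_lt.1 hc) hk
    have hle : ∀ t : ℝ, 0 ≤ t → π.inventory D x t ω ≤ M.b := by
      intro t ht
      obtain ⟨u, hu, hs⟩ := exists_right_affine (D := D) (x := x) h1 hm hf ht
      obtain ⟨r, hr1, hr2⟩ := exists_rat_btwn hu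
      have := h7 r (ht.trans hr1.le)
      rw [(hs r hr1.le hr2).2] at this
      have h9 := mul_nonneg (hM.σ_nonneg (π.phase t ω)) (sub_nonneg.2 hr1.le)
      linarith
    refine ⟨h1, h2, h3, h4, fun t => ?_, h5, hle, fun t ht hlt => ?_, fun t ht heq => ?_⟩
    · obtain ⟨n, hn⟩ := exists_nat_ge t
      refine (hf n).subset fun k (hk : π.T k ω ≤ t) => hk.trans ?_
      exact_mod_cast hn
    · obtain ⟨u, hu, hs⟩ := exists_right_affine (D := D) (x := x) h1 hm hf ht
      have hσ := hM.σ_one_pos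
      -- Even at the largest rate the level stays below `b` for this long.
      have hv : t < t + (M.b - π.inventory D x t ω) / M.σ 1 := by
        have : 0 < (M.b - π.inventory D x t ω) / M.σ 1 := div_pos (by linarith) hσ
        linarith
      obtain ⟨r, hr1, hr2⟩ := exists_rat_btwn (lt_min hu hv)
      have hr3 := hs r hr1.le (hr2.trans_le (min_le_left _ _))
      have hr4 : (r : ℝ) - t < (M.b - π.inventory D x t ω) / M.σ 1 := by
        linarith [hr2.trans_le (min_le_right _ _)]
      rw [lt_div_iff₀ hσ] at hr4
      rw [← hr3.1]
      refine h8 r (ht.trans hr1.le) ?_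
      rw [hr3.2]
      have := mul_le_mul_of_nonneg_right (hM.σ_le (π.phase t ω)) (sub_nonneg.2 hr1.le)
      linarith
    -- With production on at level `b`, the level would exceed `b` at once.
    · by_contra hc
      obtain ⟨u, hu, hs⟩ := exists_right_affine (D := D) (x := x) h1 hm hf ht
      obtain ⟨r, hr1, hr2⟩ := exists_rat_btwn hu
      have := hle r (ht.trans hr1.le)
      rw [(hs r hr1.le hr2).2, heq] at this
      have h9 := mul_pos (hM.σ_two_pos.trans_le (hM.σ_pos hc)) (sub_pos.2 hr1)
      linarith

/-- An almost sure statement on `Ω` is carried to the image measure on the path space only for a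
measurable event. -/
theorem measurableSet_pathAdmissible (hM : M.Standing) (hT : ∀ k, Measurable (π.T k))
    (hJ : ∀ k, Measurable (π.J k)) (D : Demand P M) (x : ℝ) (i : Fin 3) :
    MeasurableSet {ω | π.PathAdmissible D x i ω} := by
  have hpr : ∀ t : ℝ, Measurable fun ω : Ω => (t, ω) := fun t => measurable_prodMk_left
  have hI : ∀ t : ℝ, Measurable fun ω => π.inventory D x t ω := fun t => by
    have h := (measurable_inventory hT hJ D x).comp (hpr t)
    exact h
  have hP : ∀ t : ℝ, Measurable fun ω => π.phase t ω := fun t => by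
    have h := (measurable_phase hT hJ).comp (hpr t)
    exact h
  have hTop : ∀ k, Measurable fun ω => π.T k ω ≠ ⊤ := fun k =>
    measurableSet_setOfPred.1 (hT k (measurableSet_singleton ⊤).compl)
  simp only [pathAdmissible_iff hM]
  rw [measurableSet_setOfPred]
  refine Measurable.and (Measurable.and (Measurable.and ?_ ?_) (Measurable.forall fun k => ?_))
    (Measurable.and (Measurable.and (Measurable.forall fun k => (hTop _).imp ?_)
      (Measurable.forall fun k => (hTop _).imp ?_)) (Measurable.and
      (Measurable.forall fun n => Measurable.exists fun m => Measurable.forall fun k =>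
        measurable_const.imp (Measurable.not ?_)) (Measurable.and
      (Measurable.forall fun r => measurable_const.imp ?_)
      (Measurable.forall fun r => measurable_const.imp (Measurable.imp ?_ (Measurable.not ?_))))))
  · exact measurableSet_setOfPred.1 (hT 0 (measurableSet_singleton 0))
  · exact measurableSet_setOfPred.1 (hJ 0 (measurableSet_singleton i))
  · exact measurableSet_setOfPred.1 (measurableSet_le (hT _) (hT _))
  · exact measurableSet_setOfPred.1 (measurableSet_lt (hT _) (hT _))
  · exact measurableSet_setOfPred.1 (measurableSet_eq_fun (hJ _) (hJ _)).compl
  · exact measurableSet_setOfPred.1 (measurableSet_le (hT _) measurable_const)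
  · exact measurableSet_setOfPred.1 (measurableSet_le (hI _) measurable_const)
  · exact measurableSet_setOfPred.1 (measurableSet_lt (hI _) measurable_const)
  · exact measurableSet_setOfPred.1 (hP _ (measurableSet_singleton 0))

end Rational

end Strategy

/-! ### Outcomes with the same past, and the demand filtration -/

namespace Demand

variable {Ω : Type*} [MeasurableSpace Ω] {P : Measure Ω} {M : Model} (D : Demand P M)

/-- Two outcomes agree up to time `t` if they have the same demands in `[0, t]`. -/
def Agree (t : ℝ) (ω ω' : Ω) : Prop :=
  ∀ n, (D.τ (n + 1) ω ≤ t ∨ D.τ (n + 1) ω' ≤ t) → D.W n ω = D.W n ω' ∧ D.Y n ω = D.Y n ω'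

variable {D}

theorem Agree.symm {t : ℝ} {ω ω' : Ω} (h : D.Agree t ω ω') : D.Agree t ω' ω :=
  fun n hn => ⟨(h n hn.symm).1.symm, (h n hn.symm).2.symm⟩

theorem Agree.mono {s t : ℝ} {ω ω' : Ω} (h : D.Agree t ω ω') (hst : s ≤ t) : D.Agree s ω ω' :=
  fun n hn => h n (hn.imp (fun h => h.trans hst) fun h => h.trans hst)

theorem Agree.τ_eq {t : ℝ} {ω ω' : Ω} (h : D.Agree t ω ω') {n : ℕ} (hn : D.τ n ω ≤ t) :
    D.τ n ω' = D.τ n ω := by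
  induction n with
  | zero => simp
  | succ n ih =>
    rw [D.τ_succ, D.τ_succ, ih ((D.τ_lt_succ n ω).le.trans hn), (h n (Or.inl hn)).1]

theorem Agree.τ_le_iff {s t : ℝ} {ω ω' : Ω} (h : D.Agree t ω ω') (hst : s ≤ t) {n : ℕ} :
    D.τ n ω ≤ s ↔ D.τ n ω' ≤ s :=
  ⟨fun hn => by rwa [h.τ_eq (hn.trans hst)], fun hn => by rwa [h.symm.τ_eq (hn.trans hst)]⟩

theorem Agree.cumulative_eq {t : ℝ} {s : ℝ≥0} {ω ω' : Ω} (h : D.Agree t ω ω') (hst : s ≤ t) :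
    D.cumulative s ω = D.cumulative s ω' := by
  unfold cumulative
  refine tsum_congr fun n => ?_
  by_cases hn : D.τ (n + 1) ω ≤ s
  · rw [if_pos hn, if_pos ((h.τ_le_iff hst).1 hn), (h n (Or.inl (hn.trans hst))).2]
  · rw [if_neg hn, if_neg (mt (h.τ_le_iff hst).2 hn)]

/-- The σ-algebra at time `t` is generated by the cumulative demand on `[0, t]`, which agreeing
outcomes share. This is the direction of Galmarino's test that holds on any probability space. -/
theorem Agree.mem_of_measurableSet {t : ℝ≥0} {ω ω' : Ω} (h : D.Agree t ω ω') {A : Set Ω}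
    (hA : MeasurableSet[D.filtration t] A) (hω : ω ∈ A) : ω' ∈ A := by
  rw [filtration, Filtration.natural_eq_comap] at hA
  obtain ⟨B, -, rfl⟩ := hA
  have : (fun (j : Iic t) => D.cumulative j ω') = fun (j : Iic t) => D.cumulative j ω :=
    funext fun j => (h.cumulative_eq (NNReal.coe_le_coe.2 j.2)).symm
  simpa only [mem_preimage, this] using hω

theorem Agree.stoppingTime_eq {t : ℝ≥0} {ω ω' : Ω} (h : D.Agree t ω ω') {T : Ω → WithTop ℝ≥0}
    (hT : IsStoppingTime D.filtration T) (hω : T ω ≤ t) : T ω' = T ω := by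
  have key : ∀ {ω ω' : Ω}, D.Agree t ω ω' → T ω ≤ t → T ω' ≤ T ω := by
    intro ω ω' h hω
    obtain ⟨s, hs⟩ := WithTop.ne_top_iff_exists.1 (ne_top_of_le_ne_top WithTop.coe_ne_top hω)
    rw [← hs] at hω ⊢
    have hst : s ≤ t := by exact_mod_cast hω
    exact (h.mono (NNReal.coe_le_coe.2 hst)).mem_of_measurableSet (hT s) hs.symm.le
  have h1 := key h hω
  exact le_antisymm h1 (key h.symm (h1.trans hω))

theorem Agree.phase_eq {t : ℝ≥0} {ω ω' : Ω} (h : D.Agree t ω ω') {T : Ω → WithTop ℝ≥0}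
    (hT : IsStoppingTime D.filtration T) {J : Ω → Fin 3} (hJ : Measurable[hT.measurableSpace] J)
    (hω : T ω ≤ t) : J ω' = J ω := by
  have h1 := (hJ (measurableSet_singleton (J ω))).2 t
  exact (h.mem_of_measurableSet h1 ⟨rfl, hω⟩).1

/-- Arrivals do not accumulate, so neither outcome has one immediately after `t`: a form of
right-continuity of the filtration. -/
theorem Agree.exists_gt {t : ℝ} (ht : 0 ≤ t) {ω ω' : Ω} (h : D.Agree t ω ω') :
    ∃ u, t < u ∧ D.Agree u ω ω' := by
  obtain ⟨n, h1, h2⟩ := D.exists_τ_le_lt ω ht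
  obtain ⟨n', h1', h2'⟩ := D.exists_τ_le_lt ω' ht
  obtain ⟨u, hu1, hu2⟩ := exists_between (lt_min h2 h2')
  refine ⟨u, hu1, fun k hk => h k (hk.imp (fun hk => ?_) fun hk => ?_)⟩
  · have := (D.τ_strictMono ω).lt_iff_lt.1 (hk.trans_lt (hu2.trans_le (min_le_left _ _)))
    exact (D.τ_mono ω (by omega : k + 1 ≤ n)).trans h1
  · have := (D.τ_strictMono ω').lt_iff_lt.1 (hk.trans_lt (hu2.trans_le (min_le_right _ _)))
    exact (D.τ_mono ω' (by omega : k + 1 ≤ n')).trans h1'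

variable (D)

section Filtration

/-- The sum of the sizes of the first `n` demands. -/
noncomputable def S (n : ℕ) (ω : Ω) : ℝ := ∑ k ∈ Finset.range n, D.Y k ω

theorem S_succ (n : ℕ) (ω : Ω) : D.S (n + 1) ω = D.S n ω + D.Y n ω := Finset.sum_range_succ _ _

theorem S_strictMono (ω : Ω) : StrictMono fun n => D.S n ω :=
  strictMono_nat_of_lt_succ fun n => by
    rw [S_succ]
    linarith [D.Y_pos n ω]

theorem measurable_cumulative_filtration (t : ℝ≥0) :
    Measurable[D.filtration t] (D.cumulative t) :=
  ((Filtration.stronglyAdapted_natural D.stronglyMeasurable_cumulative) t).measurable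

/-- Demands are positive, so an arrival after `τ n` and up to `s` shows as a strict increase of the
cumulative demand from some rational time not before `τ n`. -/
theorem measurableSet_τ_le (n : ℕ) (s : ℝ≥0) : MeasurableSet[D.filtration s] {ω | D.τ n ω ≤ s} := by
  induction n generalizing s with
  | zero => simp
  | succ n ih =>
    have : {ω | D.τ (n + 1) ω ≤ s} = ⋃ r : ℚ, ⋃ _ : (r : ℝ).toNNReal < s,
        {ω | D.τ n ω ≤ (r : ℝ).toNNReal} ∩
          {ω | D.cumulative (r : ℝ).toNNReal ω < D.cumulative s ω} := by
      ext ω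
      simp only [mem_iUnion, mem_inter_iff, mem_ofPred_eq, exists_prop]
      obtain ⟨b, hb1, hb2⟩ := D.exists_τ_le_lt ω s.coe_nonneg
      have hb := D.cumulative_eq hb1 hb2
      constructor
      · intro h
        obtain ⟨r, hr1, hr2⟩ := exists_rat_btwn (D.τ_lt_succ n ω)
        have hr : (((r : ℝ).toNNReal : ℝ≥0) : ℝ) = r :=
          Real.coe_toNNReal _ ((D.τ_nonneg n ω).trans hr1.le)
        refine ⟨r, ?_, hr1.le.trans hr.ge, ?_⟩
        · rw [← NNReal.coe_lt_coe, hr]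
          exact hr2.trans_le h
        · rw [D.cumulative_eq (hr1.le.trans hr.ge) (hr.le.trans_lt hr2), hb]
          have := (D.τ_strictMono ω).lt_iff_lt.1 (h.trans_lt hb2)
          exact D.S_strictMono ω (by omega)
      · rintro ⟨r, -, hr2, hr3⟩
        obtain ⟨a, ha1, ha2⟩ := D.exists_τ_le_lt ω (r : ℝ).toNNReal.coe_nonneg
        rw [D.cumulative_eq ha1 ha2, hb] at hr3
        have hab := (D.S_strictMono ω).lt_iff_lt.1 hr3
        have hna := (D.τ_strictMono ω).lt_iff_lt.1 (hr2.trans_lt ha2)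
        exact (D.τ_mono ω (by omega : n + 1 ≤ b)).trans hb1
    rw [this]
    refine MeasurableSet.iUnion fun r => MeasurableSet.iUnion fun hr => ?_
    refine ((D.filtration.mono hr.le) _ (ih _)).inter ?_
    exact measurableSet_lt ((D.measurable_cumulative_filtration _).mono (D.filtration.mono hr.le)
      le_rfl) (D.measurable_cumulative_filtration s)

/-- `S n` is read off the cumulative demand: at `t` itself if `τ n = t`, and otherwise at a rational
time between `τ n` and both `t` and the next arrival. At later times the cumulative demand is only
larger, so no false positives arise. -/
theorem measurableSet_τ_le_S_le (n : ℕ) (t : ℝ≥0) (c : ℝ) :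
    MeasurableSet[D.filtration t] {ω | D.τ n ω ≤ t ∧ D.S n ω ≤ c} := by
  have : {ω | D.τ n ω ≤ t ∧ D.S n ω ≤ c} =
      ({ω | D.τ n ω ≤ t} ∩ {ω | D.cumulative t ω ≤ c}) ∪
      ⋃ r : ℚ, ⋃ _ : (r : ℝ).toNNReal < t,
        {ω | D.τ n ω ≤ (r : ℝ).toNNReal} ∩ {ω | D.cumulative (r : ℝ).toNNReal ω ≤ c} := by
    ext ω
    simp only [mem_iUnion, mem_inter_iff, mem_ofPred_eq, exists_prop, mem_union]
    have hback : ∀ s : ℝ≥0, D.τ n ω ≤ s → D.cumulative s ω ≤ c → D.S n ω ≤ c := by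
      intro s hs hsc
      obtain ⟨b, hb1, hb2⟩ := D.exists_τ_le_lt ω s.coe_nonneg
      rw [D.cumulative_eq hb1 hb2] at hsc
      have := (D.τ_strictMono ω).lt_iff_lt.1 (hs.trans_lt hb2)
      exact ((D.S_strictMono ω).monotone (by omega : n ≤ b)).trans hsc
    constructor
    · rintro ⟨h1, h2⟩
      rcases h1.eq_or_lt with h1 | h1
      · left
        refine ⟨h1.le, ?_⟩
        rw [D.cumulative_eq h1.le (h1.symm.le.trans_lt (D.τ_lt_succ n ω))]
        exact h2
      · right
        obtain ⟨r, hr1, hr2⟩ := exists_rat_btwn (lt_min h1 (D.τ_lt_succ n ω))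
        have hr : (((r : ℝ).toNNReal : ℝ≥0) : ℝ) = r :=
          Real.coe_toNNReal _ ((D.τ_nonneg n ω).trans hr1.le)
        refine ⟨r, ?_, hr1.le.trans hr.ge, ?_⟩
        · rw [← NNReal.coe_lt_coe, hr]
          exact hr2.trans_le (min_le_left _ _)
        · rw [D.cumulative_eq (hr1.le.trans hr.ge)
            (hr.le.trans_lt (hr2.trans_le (min_le_right _ _)))]
          exact h2
    · rintro (⟨h1, h2⟩ | ⟨r, hr, h1, h2⟩)
      · exact ⟨h1, hback t h1 h2⟩
      · exact ⟨h1.trans (NNReal.coe_le_coe.2 hr.le), hback _ h1 h2⟩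
  rw [this]
  refine ((D.measurableSet_τ_le n t).inter (measurableSet_le
    (D.measurable_cumulative_filtration t) measurable_const)).union
    (MeasurableSet.iUnion fun r => MeasurableSet.iUnion fun hr => ?_)
  refine ((D.filtration.mono hr.le) _ (D.measurableSet_τ_le n _)).inter ?_
  exact measurableSet_le ((D.measurable_cumulative_filtration _).mono (D.filtration.mono hr.le)
      le_rfl) measurable_const

/-- The default value `t + 1` lies above every observable value, so a sublevel set is everything,
empty, or an event that `τ n` has occurred by a time at most `t`. -/
theorem measurable_τ_indicator (n : ℕ) (t : ℝ≥0) :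
    Measurable[D.filtration t] fun ω => if D.τ n ω ≤ t then D.τ n ω else (t : ℝ) + 1 := by
  refine measurable_of_Iic fun c => ?_
  by_cases hc : (t : ℝ) + 1 ≤ c
  · convert MeasurableSet.univ
    ext ω
    simp only [mem_preimage, mem_Iic, mem_univ, iff_true]
    split_ifs with h
    · linarith
    · exact hc
  by_cases hc0 : c < 0
  · convert MeasurableSet.empty
    ext ω
    simp only [mem_preimage, mem_Iic, mem_empty_iff_false, iff_false, not_le]
    split_ifs with h
    · exact hc0.trans_le (D.τ_nonneg n ω)
    · exact not_le.1 hc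
  · have h1 : (((min c t).toNNReal : ℝ≥0) : ℝ) = min c t :=
      Real.coe_toNNReal _ (le_min (not_lt.1 hc0) t.coe_nonneg)
    have h2 : (min c t).toNNReal ≤ t := by
      rw [← NNReal.coe_le_coe, h1]
      exact min_le_right _ _
    convert (D.filtration.mono h2) _ (D.measurableSet_τ_le n _) using 1
    ext ω
    simp only [mem_preimage, mem_Iic, mem_ofPred_eq, h1, le_min_iff]
    split_ifs with h
    · simp [h]
    · simp [h, hc]

theorem measurable_S_indicator (n : ℕ) (t : ℝ≥0) :
    Measurable[D.filtration t] fun ω => if D.τ n ω ≤ t then D.S n ω else 0 := by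
  refine measurable_of_Iic fun c => ?_
  have : (fun ω => if D.τ n ω ≤ t then D.S n ω else 0) ⁻¹' Iic c =
      {ω | D.τ n ω ≤ t ∧ D.S n ω ≤ c} ∪ ({ω | D.τ n ω ≤ t}ᶜ ∩ {_ω | 0 ≤ c}) := by
    ext ω
    simp only [mem_preimage, mem_Iic, mem_union, mem_ofPred_eq, mem_inter_iff, mem_compl_iff]
    split_ifs with h <;> simp [h]
  rw [this]
  exact (D.measurableSet_τ_le_S_le n t c).union ((D.measurableSet_τ_le n t).compl.inter
    (MeasurableSet.const _))

end Filtration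

end Demand

/-- The space of all sequences of interarrival times and demand sizes. -/
abbrev Paths : Type :=
  {w : ℕ → ℝ × ℝ // (∀ n, 0 < (w n).1 ∧ 0 < (w n).2) ∧
    Tendsto (fun n => ∑ k ∈ Finset.range n, (w k).1) atTop atTop}

/-! ### Galmarino's test on the path space -/

namespace Demand

variable {P : Measure Paths} {M : Model} {D : Demand P M}

/-- The demand process given by the coordinates of the path space. -/
structure IsCanonical (D : Demand P M) : Prop where
  W_eq : ∀ n w, D.W n w = (w.1 n).1
  Y_eq : ∀ n w, D.Y n w = (w.1 n).2

/-- Paths with the demands of `w` in `[0, t]`, followed by demands of size `1` at the times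
`t + 1`, `t + 2`, and so on. -/
theorem IsCanonical.exists_stopped (hc : D.IsCanonical) (t : ℝ≥0) :
    ∃ f : Paths → Paths, Measurable[D.filtration t] f ∧ ∀ w, D.Agree t w (f w) := by
  classical
  let g : Paths → ℕ → ℝ × ℝ := fun w n =>
    (if D.τ (n + 1) w ≤ t then D.W n w else if D.τ n w ≤ t then t - D.τ n w + 1 else 1,
      if D.τ (n + 1) w ≤ t then D.Y n w else 1)
  have hpos : ∀ w n, 0 < (g w n).1 ∧ 0 < (g w n).2 := by
    intro w n
    constructor
    · simp only [g]
      split_ifs with h1 h2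
      · exact D.W_pos n w
      · linarith
      · exact one_pos
    · simp only [g]
      split_ifs with h1
      · exact D.Y_pos n w
      · exact one_pos
  have htend : ∀ w, Tendsto (fun n => ∑ k ∈ Finset.range n, (g w k).1) atTop atTop := by
    intro w
    obtain ⟨m, h1, h2⟩ := D.exists_τ_le_lt w t.coe_nonneg
    have hg : ∀ k, m + 1 ≤ k → (g w k).1 = 1 := by
      intro k hk
      have h3 : ¬ D.τ k w ≤ t := not_le.2 (h2.trans_le (D.τ_mono w hk))
      have h4 : ¬ D.τ (k + 1) w ≤ t :=
        not_le.2 (h2.trans_le (D.τ_mono w (by omega : m + 1 ≤ k + 1)))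
      simp [g, h3, h4]
    have hle : ∀ n : ℕ, (n : ℝ) - (m + 1) ≤ ∑ k ∈ Finset.range n, (g w k).1 := by
      intro n
      induction n with
      | zero =>
        have := m.cast_nonneg (α := ℝ)
        simp
        linarith
      | succ n ih =>
        rw [Finset.sum_range_succ]
        by_cases hn : m + 1 ≤ n
        · rw [hg n hn]
          push_cast
          linarith
        · have h5 : (0 : ℝ) ≤ ∑ k ∈ Finset.range n, (g w k).1 :=
            Finset.sum_nonneg fun k _ => (hpos w k).1.le
          have h6 : ((n + 1 : ℕ) : ℝ) ≤ m + 1 := by exact_mod_cast (by omega : n + 1 ≤ m + 1)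
          have := (hpos w n).1
          linarith
    refine tendsto_atTop_mono hle ?_
    exact tendsto_atTop_add_const_right _ _ tendsto_natCast_atTop_atTop
  refine ⟨fun w => ⟨g w, hpos w, htend w⟩, ?_, ?_⟩
  · refine Measurable.subtype_mk ?_
    refine (@measurable_pi_iff _ _ _ (D.filtration t) _ _).2 fun n => ?_
    have hE := D.measurableSet_τ_le n t
    have hE' := D.measurableSet_τ_le (n + 1) t
    refine Measurable.prodMk ?_ ?_
    · have h1 : Measurable[D.filtration t] fun w => if D.τ (n + 1) w ≤ t then
          (if D.τ (n + 1) w ≤ t then D.τ (n + 1) w else (t : ℝ) + 1) -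
            (if D.τ n w ≤ t then D.τ n w else (t : ℝ) + 1)
          else if D.τ n w ≤ t then
            t - (if D.τ n w ≤ t then D.τ n w else (t : ℝ) + 1) + 1 else 1 := by
        refine Measurable.ite hE' ?_ (Measurable.ite hE ?_ measurable_const)
        · exact (D.measurable_τ_indicator (n + 1) t).sub (D.measurable_τ_indicator n t)
        · exact ((D.measurable_τ_indicator n t).const_sub _).add_const _
      convert h1 using 1
      ext w
      by_cases h2 : D.τ (n + 1) w ≤ t
      · have h3 : D.τ n w ≤ t := (D.τ_lt_succ n w).le.trans h2
        simp only [if_pos h2, if_pos h3]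
        rw [D.τ_succ]
        ring
      · by_cases h3 : D.τ n w ≤ t <;> simp [h2, h3]
    · have h1 : Measurable[D.filtration t] fun w => if D.τ (n + 1) w ≤ t then
          (if D.τ (n + 1) w ≤ t then D.S (n + 1) w else 0) -
            (if D.τ n w ≤ t then D.S n w else 0) else 1 := by
        refine Measurable.ite hE' ?_ measurable_const
        exact (D.measurable_S_indicator (n + 1) t).sub (D.measurable_S_indicator n t)
      convert h1 using 1
      ext w
      by_cases h2 : D.τ (n + 1) w ≤ t
      · have h3 : D.τ n w ≤ t := (D.τ_lt_succ n w).le.trans h2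
        simp [h2, h3, D.S_succ]
      · simp [h2]
  · intro w
    set w' : Paths := ⟨g w, hpos w, htend w⟩ with hw'
    have hW : ∀ n, D.W n w' = (g w n).1 := fun n => hc.W_eq n w'
    have hY : ∀ n, D.Y n w' = (g w n).2 := fun n => hc.Y_eq n w'
    obtain ⟨m, h1, h2⟩ := D.exists_τ_le_lt w t.coe_nonneg
    have hle : ∀ n ≤ m, D.τ n w ≤ t := fun n hn => (D.τ_mono w hn).trans h1
    have hτ : ∀ n ≤ m, D.τ n w' = D.τ n w := by
      intro n hn
      induction n with
      | zero => simp
      | succ n ih =>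
        rw [D.τ_succ, D.τ_succ, ih (by omega), hW]
        simp [g, hle (n + 1) hn]
    have hm : D.τ (m + 1) w' = t + 1 := by
      rw [D.τ_succ, hτ m le_rfl, hW]
      simp only [g, if_neg (not_le.2 h2), if_pos h1]
      ring
    -- The stopped path has its next arrival at `t + 1`, so it shows no arrivals up to `t` beyond
    -- those of `w`.
    have hiff : ∀ n, D.τ (n + 1) w' ≤ t → D.τ (n + 1) w ≤ t := by
      intro n hn
      refine hle _ ?_
      by_contra hc
      have := D.τ_mono w' (by omega : m + 1 ≤ n + 1)
      simp only [hm] at this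
      linarith
    intro n hn
    have hn' : D.τ (n + 1) w ≤ t := hn.elim id (hiff n)
    rw [hW, hY]
    simp [g, hn']

/-- A measurable set that is invariant under agreement up to `t` equals its preimage under the
stopping map of `exists_stopped`, and that map is measurable for the σ-algebra at time `t`. -/
theorem IsCanonical.measurableSet_iff (hc : D.IsCanonical) (t : ℝ≥0) (A : Set Paths) :
    MeasurableSet[D.filtration t] A ↔
      MeasurableSet A ∧ ∀ w w', D.Agree t w w' → w ∈ A → w' ∈ A := by
  refine ⟨fun h => ⟨D.filtration.le t _ h, fun w w' ha hw => ha.mem_of_measurableSet h hw⟩, ?_⟩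
  rintro ⟨hA, h⟩
  obtain ⟨f, hf, hag⟩ := hc.exists_stopped t
  have : A = f ⁻¹' A := by
    ext w
    exact ⟨fun hw => h _ _ (hag w) hw, fun hw => h _ _ (hag w).symm hw⟩
  rw [this]
  exact hf hA

/-- The coordinates of a path are increments of `τ` and `S`, which the filtration reveals. This is
needed because the σ-algebra of a stopping time consists of events in the supremum of the
filtration. -/
theorem IsCanonical.le_iSup_filtration (hc : D.IsCanonical) :
    (inferInstance : MeasurableSpace Paths) ≤ ⨆ t, D.filtration t := by
  have hle : ∀ t, D.filtration t ≤ ⨆ t, D.filtration t := fun t => le_iSup D.filtration t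
  have hτ : ∀ n, Measurable[⨆ t, D.filtration t] (D.τ n) := by
    intro n
    refine measurable_of_Iic fun c => ?_
    by_cases hc : 0 ≤ c
    · have h1 := hle _ _ (D.measurableSet_τ_le n c.toNNReal)
      rwa [Real.coe_toNNReal _ hc] at h1
    · convert MeasurableSet.empty
      ext w
      simp only [mem_preimage, mem_Iic, mem_empty_iff_false, iff_false, not_le]
      exact (not_le.1 hc).trans_le (D.τ_nonneg n w)
  have hS : ∀ n, Measurable[⨆ t, D.filtration t] (D.S n) := by
    intro n
    refine measurable_of_Iic fun c => ?_
    have : D.S n ⁻¹' Iic c = ⋃ k : ℕ, {w | D.τ n w ≤ (k : ℝ≥0) ∧ D.S n w ≤ c} := by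
      ext w
      simp only [mem_preimage, mem_Iic, mem_iUnion, mem_ofPred_eq, exists_and_right]
      exact ⟨fun h => ⟨by simpa using exists_nat_ge (D.τ n w), h⟩, fun h => h.2⟩
    rw [this]
    exact MeasurableSet.iUnion fun k => hle _ _ (D.measurableSet_τ_le_S_le n k c)
  have hid : Measurable[⨆ t, D.filtration t] fun w : Paths => w := by
    have h1 : Measurable[⨆ t, D.filtration t] fun w : Paths => w.1 := by
      refine (@measurable_pi_iff _ _ _ (⨆ t, D.filtration t) _ _).2 fun n => ?_
      have h2 := ((hτ (n + 1)).sub (hτ n)).prodMk ((hS (n + 1)).sub (hS n))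
      convert h2 using 1
      ext w
      · simp [D.τ_succ, hc.W_eq]
      · simp [D.S_succ, hc.Y_eq]
    exact h1.subtype_mk
  intro A hA
  exact hid hA

/-- A random time and a random phase are adapted when they depend only on the demands up to that
time. -/
theorem IsCanonical.adapted_iff (hc : D.IsCanonical) {T : Paths → WithTop ℝ≥0}
    {J : Paths → Fin 3} :
    (∃ hT : IsStoppingTime D.filtration T, Measurable[hT.measurableSpace] J) ↔
      (Measurable T ∧ Measurable J) ∧ ∀ (t : ℝ≥0) (w w' : Paths), D.Agree t w w' → T w ≤ t →
        T w' = T w ∧ J w' = J w := by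
  constructor
  · rintro ⟨hT, hJ⟩
    exact ⟨⟨hT.measurable', hJ.mono hT.measurableSpace_le le_rfl⟩, fun t w w' ha hw =>
      ⟨ha.stoppingTime_eq hT hw, ha.phase_eq hT hJ hw⟩⟩
  · rintro ⟨⟨hTm, hJm⟩, h⟩
    have hT : IsStoppingTime D.filtration T := by
      intro t
      rw [hc.measurableSet_iff]
      refine ⟨measurableSet_le hTm measurable_const, fun w w' ha (hw : T w ≤ t) => ?_⟩
      show T w' ≤ t
      rwa [(h t w w' ha hw).1]
    refine ⟨hT, fun A hA => ?_⟩
    rw [hT.measurableSet]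
    refine ⟨hc.le_iSup_filtration _ (hJm hA), fun t => ?_⟩
    rw [hc.measurableSet_iff]
    refine ⟨(hJm hA).inter (measurableSet_le hTm measurable_const), ?_⟩
    rintro w w' ha ⟨hw1, hw2⟩
    obtain ⟨h1, h2⟩ := h t w w' ha hw2
    refine ⟨?_, ?_⟩
    · rwa [mem_preimage, h2]
    · show T w' ≤ t
      rw [h1]
      exact hw2

end Demand

/-! ### Transfer of the control problem to the path space -/

namespace Strategy

variable {Ω : Type*} [MeasurableSpace Ω] {P : Measure Ω} {M : Model}

/-- The cost of an admissible strategy in terms of the pathwise costs. -/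
theorem Admissible.cost_eq {π : Strategy Ω} {D : Demand P M} {x : ℝ} {i : Fin 3}
    (h : π.Admissible D x i) (hM : M.Standing) (hx : M.l ≤ x) :
    π.cost D x = if ∫⁻ ω, π.pathPos D x ω ∂P = ⊤ then ⊤ else
      ((∫⁻ ω, π.pathPos D x ω ∂P : ℝ≥0∞) : EReal) - ((∫⁻ ω, π.pathNeg M ω ∂P : ℝ≥0∞) : EReal) := by
  have h1 : ∫⁻ ω, π.pathPos D x ω ∂P = π.holdingCost D x + π.penaltyCost D x +
      π.switchingCost P M.q (fun i j => ENNReal.ofReal (M.K i j)) := by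
    unfold pathPos
    rw [lintegral_add_right _ (measurable_pathSwitch h.measurable_T h.measurable_J _ _),
      lintegral_add_right _ (measurable_pathPenalty h.measurable_T h.measurable_J hM D x),
      h.holdingCost_eq hM hx, switchingCost_eq]
    rfl
  have h2 : ∫⁻ ω, π.pathNeg M ω ∂P =
      π.switchingCost P M.q (fun i j => ENNReal.ofReal (-M.K i j)) := by
    rw [switchingCost_eq]
    rfl
  rw [h1, h2]
  rfl

/-- The strategy that applies `π` to the image of the outcome under `f`. -/
def comap {Ω' : Type*} (π : Strategy Ω') (f : Ω → Ω') : Strategy Ω where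
  T k ω := π.T k (f ω)
  J k ω := π.J k (f ω)

end Strategy

namespace Demand

variable {Ω : Type*} [MeasurableSpace Ω] {P : Measure Ω} {M : Model} (D : Demand P M)

/-- The path of interarrival times and demand sizes. -/
def toPaths (ω : Ω) : Paths :=
  ⟨fun n => (D.W n ω, D.Y n ω), fun n => ⟨D.W_pos n ω, D.Y_pos n ω⟩, D.no_explosion ω⟩

theorem measurable_toPaths : Measurable D.toPaths :=
  Measurable.subtype_mk (measurable_pi_iff.2 fun n => (D.measurable_W n).prodMk (D.measurable_Y n))

/-- The coordinate demand process on the path space. -/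
noncomputable def canonical : Demand (P.map D.toPaths) M where
  W n w := (w.1 n).1
  Y n w := (w.1 n).2
  measurable_W n := ((measurable_pi_apply n).comp measurable_subtype_coe).fst
  measurable_Y n := ((measurable_pi_apply n).comp measurable_subtype_coe).snd
  W_pos n w := (w.2.1 n).1
  Y_pos n w := (w.2.1 n).2
  no_explosion w := w.2.2
  law_W n := by
    have hm : Measurable fun w : Paths => (w.1 n).1 :=
      ((measurable_pi_apply n).comp measurable_subtype_coe).fst
    rw [Measure.map_map hm D.measurable_toPaths]
    exact D.law_W n
  law_Y n := by
    have hm : Measurable fun w : Paths => (w.1 n).2 :=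
      ((measurable_pi_apply n).comp measurable_subtype_coe).snd
    rw [Measure.map_map hm D.measurable_toPaths]
    exact D.law_Y n
  indep := by
    have hm : ∀ s : ℕ ⊕ ℕ, Measurable fun w : Paths =>
        Sum.elim (fun n (w : Paths) => (w.1 n).1) (fun n w => (w.1 n).2) s w := by
      rintro (n | n)
      · exact ((measurable_pi_apply n).comp measurable_subtype_coe).fst
      · exact ((measurable_pi_apply n).comp measurable_subtype_coe).snd
    have hcomp : ∀ s : ℕ ⊕ ℕ, ∀ ω,
        Sum.elim (fun n (w : Paths) => (w.1 n).1) (fun n w => (w.1 n).2) s (D.toPaths ω) =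
        Sum.elim D.W D.Y s ω := by
      rintro (n | n) ω <;> rfl
    rw [iIndepFun_iff_measure_inter_preimage_eq_mul]
    intro S A hA
    have h := iIndepFun_iff_measure_inter_preimage_eq_mul.1 D.indep S (sets := A) hA
    rw [Measure.map_apply D.measurable_toPaths
      (Finset.measurableSet_biInter S fun s hs => hm s (hA s hs))]
    convert h using 1
    · congr 1
      ext ω
      simp only [mem_preimage, mem_iInter, hcomp]
    · refine Finset.prod_congr rfl fun s hs => ?_
      rw [Measure.map_apply D.measurable_toPaths (hm s (hA s hs))]
      congr 1
      ext ω
      simp only [mem_preimage, hcomp]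

theorem isCanonical_canonical : D.canonical.IsCanonical := ⟨fun _ _ => rfl, fun _ _ => rfl⟩

theorem filtration_eq_comap (t : ℝ≥0) :
    D.filtration t = (D.canonical.filtration t).comap D.toPaths := by
  rw [filtration, filtration, Filtration.natural_eq_comap, Filtration.natural_eq_comap,
    MeasurableSpace.comap_comp]
  rfl

theorem iSup_filtration_eq_comap :
    ⨆ t, D.filtration t = (⨆ t, D.canonical.filtration t).comap D.toPaths := by
  rw [MeasurableSpace.comap_iSup]
  exact iSup_congr fun t => D.filtration_eq_comap t

theorem adapted_comp {T : Paths → WithTop ℝ≥0} {J : Paths → Fin 3}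
    (h : ∃ hT : IsStoppingTime D.canonical.filtration T, Measurable[hT.measurableSpace] J) :
    ∃ hT : IsStoppingTime D.filtration fun ω => T (D.toPaths ω),
      Measurable[hT.measurableSpace] fun ω => J (D.toPaths ω) := by
  obtain ⟨hT, hJ⟩ := h
  have hT' : IsStoppingTime D.filtration fun ω => T (D.toPaths ω) := by
    intro t
    rw [D.filtration_eq_comap]
    exact ⟨_, hT t, rfl⟩
  refine ⟨hT', fun A hA => ?_⟩
  obtain ⟨h1, h2⟩ := hJ hA
  rw [hT'.measurableSet, D.iSup_filtration_eq_comap]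
  refine ⟨⟨_, h1, rfl⟩, fun t => ?_⟩
  rw [D.filtration_eq_comap]
  exact ⟨_, h2 t, rfl⟩

/-- A stopping time of the demand filtration is a function of the path of the demands. -/
theorem exists_stoppingTime_canonical {T : Ω → WithTop ℝ≥0} (hT : IsStoppingTime D.filtration T) :
    ∃ T₀ : Paths → WithTop ℝ≥0, IsStoppingTime D.canonical.filtration T₀ ∧
      ∀ ω, T ω = T₀ (D.toPaths ω) := by
  classical
  have hex : ∀ r : ℚ, ∃ A, MeasurableSet[D.canonical.filtration (r : ℝ).toNNReal] A ∧
      D.toPaths ⁻¹' A = {ω | T ω ≤ (r : ℝ).toNNReal} := by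
    intro r
    have h := hT (r : ℝ).toNNReal
    rw [D.filtration_eq_comap] at h
    exact h
  choose A hA hpre using hex
  have hmem : ∀ r ω, D.toPaths ω ∈ A r ↔ T ω ≤ (r : ℝ).toNNReal := fun r ω =>
    Set.ext_iff.1 (hpre r) ω
  -- Each level set of `T` at a rational time lifts to the path space, but the lifts need not be
  -- nested off the image of `Ω`. The infimum is defined regardless.
  let T₀ : Paths → WithTop ℝ≥0 := fun w =>
    ⨅ r : ℚ, if w ∈ A r then (((r : ℝ).toNNReal : ℝ≥0) : WithTop ℝ≥0) else ⊤
  refine ⟨T₀, fun t => ?_, fun ω => le_antisymm ?_ ?_⟩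
  · rw [D.isCanonical_canonical.measurableSet_iff]
    constructor
    · refine measurableSet_le (Measurable.iInf fun r => ?_) measurable_const
      exact Measurable.ite (D.canonical.filtration.le _ _ (hA r)) measurable_const measurable_const
    · intro w w' ha hw
      by_contra hc
      have hc : (t : WithTop ℝ≥0) < T₀ w' := not_le.1 hc
      -- The infimum may be approached from times above `t`. Agreement persists slightly beyond `t`,
      -- which covers them.
      obtain ⟨u, htu, hu⟩ := ha.exists_gt t.coe_nonneg
      have htu' : (t : WithTop ℝ≥0) < (u.toNNReal : ℝ≥0) := by
        have : t < u.toNNReal := Real.lt_toNNReal_iff_coe_lt.2 htu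
        exact_mod_cast this
      obtain ⟨v, hv1, hv2⟩ := exists_between (lt_min hc htu')
      have hv3 := hv2.trans_le (min_le_right _ _)
      obtain ⟨r, hr⟩ := iInf_lt_iff.1 ((show T₀ w ≤ t from hw).trans_lt hv1)
      split_ifs at hr with hwr
      · have hru : ((r : ℝ).toNNReal : ℝ) ≤ u := by
          have h1 : (r : ℝ).toNNReal < u.toNNReal := by exact_mod_cast hr.trans hv3
          exact (Real.lt_toNNReal_iff_coe_lt.1 h1).le
        have h2 := (hu.mono hru).mem_of_measurableSet (hA r) hwr
        have h3 : T₀ w' ≤ ((r : ℝ).toNNReal : ℝ≥0) := by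
          refine (iInf_le _ r).trans ?_
          rw [if_pos h2]
        exact absurd (h3.trans_lt (hr.trans (hv2.trans_le (min_le_left _ _)))) (lt_irrefl _)
      · exact absurd hr not_top_lt
  · refine le_iInf fun r => ?_
    split_ifs with h
    · exact (hmem r ω).1 h
    · exact le_top
  · by_contra hc
    obtain ⟨v, hv1, hv2⟩ := exists_between (not_le.1 hc)
    obtain ⟨s, hs⟩ := WithTop.ne_top_iff_exists.1 hv1.ne_top
    obtain ⟨v', hv'⟩ := WithTop.ne_top_iff_exists.1 hv2.ne_top
    rw [← hs, ← hv'] at hv1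
    have hsv : (s : ℝ) < v' := by exact_mod_cast hv1
    obtain ⟨r, hr1, hr2⟩ := exists_rat_btwn hsv
    have h1 : s ≤ (r : ℝ).toNNReal := NNReal.le_toNNReal_of_coe_le hr1.le
    have h2 : D.toPaths ω ∈ A r := (hmem r ω).2 (by rw [← hs]; exact_mod_cast h1)
    have h3 : T₀ (D.toPaths ω) ≤ ((r : ℝ).toNNReal : ℝ≥0) := by
      refine (iInf_le _ r).trans ?_
      rw [if_pos h2]
    have h4 : (r : ℝ).toNNReal ≤ v' :=
      Real.toNNReal_le_iff_le_coe.2 hr2.le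
    rw [← hv'] at hv2
    exact absurd (hv2.trans_le h3) (not_lt.2 (by exact_mod_cast h4))

/-- The restriction of `T` to each event `J = j`, set to `⊤` elsewhere, is a stopping time and lifts
separately. The minimum of the three lifts gives the time, and an index attaining it gives the
phase. Where the time is `⊤`, the phase is lifted as an event of the supremum of the filtration. -/
theorem exists_adapted_canonical {T : Ω → WithTop ℝ≥0} {J : Ω → Fin 3}
    (h : ∃ hT : IsStoppingTime D.filtration T, Measurable[hT.measurableSpace] J) :
    ∃ (T₀ : Paths → WithTop ℝ≥0) (J₀ : Paths → Fin 3),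
      (∃ hT : IsStoppingTime D.canonical.filtration T₀, Measurable[hT.measurableSpace] J₀) ∧
      (∀ ω, T ω = T₀ (D.toPaths ω)) ∧ ∀ ω, J ω = J₀ (D.toPaths ω) := by
  classical
  obtain ⟨hT, hJ⟩ := h
  have hS : ∀ j : Fin 3, IsStoppingTime D.filtration fun ω => if J ω = j then T ω else ⊤ := by
    intro j t
    convert (hJ (measurableSet_singleton j)).2 t using 1
    ext ω
    simp only [mem_ofPred_eq, mem_inter_iff, mem_preimage, mem_singleton_iff]
    split_ifs with hj
    · simp [hj]
    · simp only [hj, false_and, iff_false, not_le]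
      exact WithTop.coe_lt_top t
  choose S hS hSeq using fun j => D.exists_stoppingTime_canonical (hS j)
  have hex : ∀ j : Fin 3, ∃ C : Set Paths, MeasurableSet C ∧ D.toPaths ⁻¹' C = J ⁻¹' {j} := by
    intro j
    have h1 := (hJ (measurableSet_singleton j)).1
    rw [D.iSup_filtration_eq_comap] at h1
    obtain ⟨C, hC, hC'⟩ := h1
    exact ⟨C, (iSup_le fun t => D.canonical.filtration.le t) _ hC, hC'⟩
  choose C hC hpre using hex
  have hmem : ∀ j ω, D.toPaths ω ∈ C j ↔ J ω = j := fun j ω => Set.ext_iff.1 (hpre j) ω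
  let T₀ : Paths → WithTop ℝ≥0 := fun w => ⨅ j, S j w
  let J₀ : Paths → Fin 3 := fun w =>
    if T₀ w = ⊤ then (if w ∈ C 0 then 0 else if w ∈ C 1 then 1 else 2)
    else if S 0 w = T₀ w then 0 else if S 1 w = T₀ w then 1 else 2
  have hTeq : ∀ ω, T ω = T₀ (D.toPaths ω) := by
    intro ω
    refine le_antisymm (le_iInf fun j => ?_) ((iInf_le _ (J ω)).trans ?_)
    · rw [← hSeq]
      split_ifs
      · exact le_rfl
      · exact le_top
    · rw [← hSeq, if_pos rfl]
  have hSm : ∀ j, Measurable (S j) := fun j => (hS j).measurable'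
  have hTm : Measurable T₀ := Measurable.iInf hSm
  refine ⟨T₀, J₀, ?_, hTeq, fun ω => ?_⟩
  · rw [D.isCanonical_canonical.adapted_iff]
    refine ⟨⟨hTm, ?_⟩, fun t w w' ha hw => ?_⟩
    · refine Measurable.ite (hTm (measurableSet_singleton ⊤)) (Measurable.ite (hC 0)
        measurable_const (Measurable.ite (hC 1) measurable_const measurable_const))
        (Measurable.ite (measurableSet_eq_fun (hSm 0) hTm) measurable_const
        (Measurable.ite (measurableSet_eq_fun (hSm 1) hTm) measurable_const measurable_const))
    · have key : ∀ {w w' : Paths}, D.canonical.Agree t w w' → T₀ w ≤ t → T₀ w' ≤ T₀ w := by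
        intro w w' ha hw
        obtain ⟨j, hj⟩ := exists_eq_ciInf_of_finite (f := fun j => S j w)
        have hj : S j w = T₀ w := hj
        refine (iInf_le _ j).trans ?_
        rw [ha.stoppingTime_eq (hS j) (hj.le.trans hw), hj]
      have hTle := key ha hw
      have hTw : T₀ w' = T₀ w := le_antisymm hTle (key ha.symm (hTle.trans hw))
      have hiff : ∀ j, S j w' = T₀ w' ↔ S j w = T₀ w := by
        intro j
        constructor
        · intro hj
          rw [ha.symm.stoppingTime_eq (hS j) (hj.le.trans (hTw.le.trans hw)), hj, hTw]
        · intro hj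
          rw [ha.stoppingTime_eq (hS j) (hj.le.trans hw), hj, hTw]
      have hne : T₀ w ≠ ⊤ := ne_top_of_le_ne_top WithTop.coe_ne_top hw
      have hne' : T₀ w' ≠ ⊤ := hTw ▸ hne
      refine ⟨hTw, ?_⟩
      simp only [J₀, if_neg hne, if_neg hne', hiff]
  · simp only [J₀, ← hTeq, ← hSeq, hmem]
    by_cases hT' : T ω = ⊤
    · simp only [hT', if_true]
      generalize J ω = j
      fin_cases j <;> simp
    · rw [if_neg hT']
      have : ∀ j, (if J ω = j then T ω else ⊤) = T ω ↔ J ω = j := by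
        intro j
        split_ifs with hj
        · simp [hj]
        · simp [hj, Ne.symm hT']
      simp only [this]
      generalize J ω = j
      fin_cases j <;> simp

end Demand

namespace Strategy

variable {Ω : Type*} [MeasurableSpace Ω] {P : Measure Ω} {M : Model} (D : Demand P M)
  (π : Strategy Paths) (x : ℝ) (i : Fin 3)

theorem levelAfter_comap (n : ℕ) (ω : Ω) :
    (π.comap D.toPaths).levelAfter D x n ω = π.levelAfter D.canonical x n (D.toPaths ω) := by
  induction n with
  | zero => rfl
  | succ n ih =>
    rw [levelAfter_succ, levelAfter_succ, levelBefore_eq, levelBefore_eq, ih]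
    rfl

theorem inventory_comap (t : ℝ) (ω : Ω) :
    (π.comap D.toPaths).inventory D x t ω = π.inventory D.canonical x t (D.toPaths ω) := by
  unfold inventory
  rw [levelAfter_comap]
  rfl

theorem pathPos_comap (ω : Ω) :
    (π.comap D.toPaths).pathPos D x ω = π.pathPos D.canonical x (D.toPaths ω) := by
  unfold pathPos pathHold pathPenalty
  simp only [levelBefore_eq, levelAfter_comap, inventory_comap]
  rfl

theorem pathAdmissible_comap (ω : Ω) : (π.comap D.toPaths).PathAdmissible D x i ω ↔
    π.PathAdmissible D.canonical x i (D.toPaths ω) := by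
  constructor
  · rintro ⟨h1, h2, h3, h4, h5, h6, h7, h8, h9⟩
    simp only [inventory_comap] at h7 h8 h9
    exact ⟨h1, h2, h3, h4, h5, h6, h7, h8, h9⟩
  · rintro ⟨h1, h2, h3, h4, h5, h6, h7, h8, h9⟩
    simp only [← inventory_comap] at h7 h8 h9
    exact ⟨h1, h2, h3, h4, h5, h6, h7, h8, h9⟩

variable {D π x i}

theorem Admissible.comap (h : π.Admissible D.canonical x i) :
    (π.comap D.toPaths).Admissible D x i := by
  refine Admissible.of_path (fun ω => h.T_zero _) (fun ω => h.J_zero _)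
    (fun k => D.adapted_comp (h.adapted k)) ?_
  filter_upwards [ae_of_ae_map D.measurable_toPaths.aemeasurable h.path] with ω hω
  exact (pathAdmissible_comap D π x i ω).2 hω

theorem Admissible.cost_comap (h : π.Admissible D.canonical x i) (hM : M.Standing) (hx : M.l ≤ x) :
    (π.comap D.toPaths).cost D x = π.cost D.canonical x := by
  rw [h.comap.cost_eq hM hx, h.cost_eq hM hx,
    lintegral_map (measurable_pathPos h.measurable_T h.measurable_J hM _ _) D.measurable_toPaths,
    lintegral_map (measurable_pathNeg h.measurable_T h.measurable_J M) D.measurable_toPaths]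
  simp only [pathPos_comap]
  rfl

theorem Admissible.exists_canonical {π : Strategy Ω} (h : π.Admissible D x i)
    (hM : M.Standing) : ∃ π₀ : Strategy Paths, π₀.Admissible D.canonical x i ∧
      π = π₀.comap D.toPaths := by
  choose T J hTJ hT hJ using fun k => D.exists_adapted_canonical (h.adapted k)
  -- The initial time and phase are prescribed at every path, also outside the image of `Ω`, so
  -- index `0` is reset by hand.
  let π₀ : Strategy Paths := ⟨fun k w => if k = 0 then 0 else T k w,
    fun k w => if k = 0 then i else J k w⟩
  have hπ : π = π₀.comap D.toPaths := by
    have h1 : π.T = (π₀.comap D.toPaths).T := by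
      ext k ω : 2
      by_cases hk : k = 0
      · rw [hk]
        exact h.T_zero ω
      · simp [Strategy.comap, π₀, hk, hT]
    have h2 : π.J = (π₀.comap D.toPaths).J := by
      ext k ω : 2
      by_cases hk : k = 0
      · rw [hk]
        exact h.J_zero ω
      · simp [Strategy.comap, π₀, hk, hJ]
    calc π = ⟨π.T, π.J⟩ := rfl
      _ = _ := by rw [h1, h2]
  refine ⟨π₀, ?_, hπ⟩
  have had : ∀ k, ∃ hT : IsStoppingTime D.canonical.filtration (π₀.T k),
      Measurable[hT.measurableSpace] (π₀.J k) := by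
    intro k
    by_cases hk : k = 0
    · rw [D.isCanonical_canonical.adapted_iff]
      simp [π₀, hk]
    · have e1 : π₀.T k = T k := by
        ext w
        simp [π₀, hk]
      have e2 : π₀.J k = J k := by
        ext w
        simp [π₀, hk]
      rw [e1, e2]
      exact hTJ k
  have hTm : ∀ k, Measurable (π₀.T k) := fun k => (had k).choose.measurable'
  have hJm : ∀ k, Measurable (π₀.J k) := fun k =>
    (had k).choose_spec.mono ((had k).choose.measurableSpace_le) le_rfl
  refine Admissible.of_path (fun w => rfl) (fun w => rfl) had ?_
  rw [ae_map_iff D.measurable_toPaths.aemeasurable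
    (measurableSet_pathAdmissible hM hTm hJm D.canonical x i)]
  filter_upwards [h.path] with ω hω
  rw [hπ] at hω
  exact (pathAdmissible_comap D π₀ x i ω).1 hω

end Strategy

/-- Admissible strategies on `Ω` are exactly the pullbacks of admissible strategies on the path
space, and the pullback preserves the cost. -/
theorem optimalCost_canonical {Ω : Type*} [MeasurableSpace Ω] {P : Measure Ω} {M : Model}
    (D : Demand P M) (hM : M.Standing) (i : Fin 3) {x : ℝ} (hx : M.l ≤ x) :
    optimalCost D i x = optimalCost D.canonical i x := by
  unfold optimalCost
  refine le_antisymm (le_iInf₂ fun π hπ => ?_) (le_iInf₂ fun π hπ => ?_)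
  · rw [← Strategy.Admissible.cost_comap hπ hM hx]
    exact iInf₂_le (f := fun (π : Strategy Ω) (_ : π ∈ {π | π.Admissible D x i}) => π.cost D x) _
      (Strategy.Admissible.comap hπ)
  · obtain ⟨π₀, h1, rfl⟩ := Strategy.Admissible.exists_canonical hπ hM
    rw [h1.cost_comap hM hx]
    exact iInf₂_le (f := fun (π : Strategy Paths)
      (_ : π ∈ {π | π.Admissible D.canonical x i}) => π.cost D.canonical x) _ h1

/-! ### Memorylessness of the exponential distribution -/

section Exponential

theorem expMeasure_Iic {r : ℝ} (hr : 0 < r) (x : ℝ) :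
    expMeasure r (Iic x) = ENNReal.ofReal (if 0 ≤ x then 1 - Real.exp (-(r * x)) else 0) := by
  have := isProbabilityMeasure_expMeasure hr
  rw [← cdf_expMeasure_eq hr, ofReal_cdf]

/-- The exponential distribution has no memory. -/
theorem expMeasure_map_add {r : ℝ} (hr : 0 < r) {d : ℝ} (hd : 0 ≤ d) :
    (expMeasure r).map (· + d) =
      ENNReal.ofReal (Real.exp (r * d)) • (expMeasure r).restrict (Ioi d) := by
  have := isProbabilityMeasure_expMeasure hr
  have hm : Measurable fun x : ℝ => x + d := measurable_id.add_const d
  have : IsFiniteMeasure ((expMeasure r).map (· + d)) := inferInstance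
  refine Measure.ext_of_Iic _ _ fun a => ?_
  rw [Measure.map_apply hm measurableSet_Iic, Measure.smul_apply,
    Measure.restrict_apply measurableSet_Iic, smul_eq_mul]
  have h1 : (fun x : ℝ => x + d) ⁻¹' Iic a = Iic (a - d) := by
    ext x
    simp [le_sub_iff_add_le]
  rw [h1, expMeasure_Iic hr]
  split_ifs with ha
  · have h2 : Iic a ∩ Ioi d = Iic a \ Iic d := by
      ext x
      simp [and_comm]
    rw [h2, measure_sdiff (Iic_subset_Iic.2 (by linarith)) measurableSet_Iic.nullMeasurableSet
      (measure_ne_top _ _), expMeasure_Iic hr, expMeasure_Iic hr, if_pos hd,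
      if_pos (by linarith), ← ENNReal.ofReal_sub, ← ENNReal.ofReal_mul (Real.exp_pos _).le]
    · congr 1
      have h3 : Real.exp (-(r * (a - d))) = Real.exp (r * d) * Real.exp (-(r * a)) := by
        rw [← Real.exp_add]
        congr 1
        ring
      have h4 : Real.exp (r * d) * Real.exp (-(r * d)) = 1 := by
        rw [← Real.exp_add]
        simp
      rw [h3]
      linear_combination -h4
    · have : Real.exp (-(r * d)) ≤ 1 := Real.exp_le_one_iff.2 (by nlinarith)
      linarith
  · have h2 : Iic a ∩ Ioi d = ∅ := by
      ext x
      simp only [mem_inter_iff, mem_Iic, mem_Ioi, mem_empty_iff_false, iff_false, not_and, not_lt]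
      intro hx
      linarith
    rw [h2]
    simp

end Exponential

/-! ### An integrable bound independent of the first arrival -/

namespace Demand

variable {Ω : Type*} [MeasurableSpace Ω] {P : Measure Ω} {M : Model} (D : Demand P M)

/-- A quantity that dominates the cost of suitable strategies, up to a factor, and does not depend
on the first arrival time. -/
noncomputable def dominating (ω : Ω) : ℝ≥0∞ :=
  1 + ∑' n, ENNReal.ofReal (Real.exp (-M.q * (D.τ (n + 1) ω - D.W 0 ω))) *
    (1 + ENNReal.ofReal (M.p (D.Y n ω)))

theorem disc_add_penalty_le (hM : M.Standing) (ω : Ω) :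
    1 + (D.disc ω + ∑' n, ENNReal.ofReal (Real.exp (-M.q * D.τ (n + 1) ω)) *
      ENNReal.ofReal (M.p (D.Y n ω))) ≤ D.dominating ω := by
  unfold disc dominating
  rw [← ENNReal.tsum_add]
  refine add_le_add le_rfl (ENNReal.tsum_le_tsum fun n => ?_)
  rw [← mul_one_add]
  refine mul_le_mul' (ENNReal.ofReal_le_ofReal (Real.exp_le_exp.2 ?_)) le_rfl
  nlinarith [hM.q_pos, D.W_pos 0 ω]

theorem measurable_dominating_term (hM : M.Standing) (n : ℕ) : Measurable fun ω =>
    ENNReal.ofReal (Real.exp (-M.q * (D.τ (n + 1) ω - D.W 0 ω))) *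
      (1 + ENNReal.ofReal (M.p (D.Y n ω))) := by
  have h1 : Measurable fun z => M.p (max z 0) :=
    Monotone.measurable fun a b hab => hM.p_mono (mem_Ici.2 (le_max_right _ _))
      (mem_Ici.2 (le_max_right _ _)) (max_le_max_right 0 hab)
  have h2 : Measurable fun ω => M.p (D.Y n ω) := by
    have h := h1.comp (D.measurable_Y n)
    convert h using 1
    ext ω
    exact congrArg M.p (max_eq_left (D.Y_pos n ω).le).symm
  have h3 : Measurable fun ω => ENNReal.ofReal (Real.exp (-M.q * (D.τ (n + 1) ω - D.W 0 ω))) :=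
    (((D.measurable_τ _).sub (D.measurable_W 0)).const_mul _).exp.ennreal_ofReal
  exact h3.mul (h2.ennreal_ofReal.const_add 1)

theorem measurable_dominating (hM : M.Standing) : Measurable D.dominating :=
  measurable_const.add (Measurable.tsum fun n => D.measurable_dominating_term hM n)

theorem measure_W_zero_le [IsProbabilityMeasure P] (hM : M.Standing) {d : ℝ} (hd : 0 ≤ d) :
    P {ω | D.W 0 ω ≤ d} ≤ ENNReal.ofReal (M.lam * d) := by
  have h1 : P {ω | D.W 0 ω ≤ d} = (P.map (D.W 0)) (Iic d) := by
    rw [Measure.map_apply (D.measurable_W 0) measurableSet_Iic]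
    rfl
  rw [h1, D.law_W, expMeasure_Iic hM.lam_pos, if_pos hd]
  refine ENNReal.ofReal_le_ofReal ?_
  linarith [Real.add_one_le_exp (-(M.lam * d))]

/-- `dominating` does not involve `W 0`, so independence splits off the probability of the event.
The remaining expectation is a geometric series with ratio $E e^{-qW}<1$. Applied to an early first
arrival, the bound is linear in the length of the time interval. -/
theorem exists_setLIntegral_dominating_le [IsProbabilityMeasure P] (hM : M.Standing) :
    ∃ C : ℝ≥0∞, C ≠ ⊤ ∧ ∀ A : Set ℝ, MeasurableSet A →
      ∫⁻ ω in D.W 0 ⁻¹' A, D.dominating ω ∂P ≤ C * P (D.W 0 ⁻¹' A) := by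
  classical
  set r := ∫⁻ y, ENNReal.ofReal (Real.exp (-M.q * y)) ∂(expMeasure M.lam) with hr
  set c := ∫⁻ y, (1 + ENNReal.ofReal (M.p (max y 0))) ∂M.F with hc
  have hpm : Measurable fun z => M.p (max z 0) :=
    Monotone.measurable fun a b hab => hM.p_mono (mem_Ici.2 (le_max_right _ _))
      (mem_Ici.2 (le_max_right _ _)) (max_le_max_right 0 hab)
  have hexpm : Measurable fun y : ℝ => ENNReal.ofReal (Real.exp (-M.q * y)) := by fun_prop
  have hW : ∀ n, ∫⁻ ω, ENNReal.ofReal (Real.exp (-M.q * D.W n ω)) ∂P = r := by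
    intro n
    rw [hr, ← D.law_W n, lintegral_map hexpm (D.measurable_W n)]
  have hr1 : r < 1 := by
    rw [← hW 0]
    have h1 : ∫⁻ ω, ENNReal.ofReal (Real.exp (-M.q * D.W 0 ω)) ∂P < ∫⁻ _, 1 ∂P := by
      have hlt : ∀ ω, ENNReal.ofReal (Real.exp (-M.q * D.W 0 ω)) < 1 := by
        intro ω
        rw [← ENNReal.ofReal_one]
        refine (ENNReal.ofReal_lt_ofReal_iff one_pos).2 (Real.exp_lt_one_iff.2 ?_)
        nlinarith [hM.q_pos, D.W_pos 0 ω]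
      refine lintegral_strict_mono (IsProbabilityMeasure.ne_zero P) aemeasurable_const ?_
        (Eventually.of_forall hlt)
      refine ne_top_of_le_ne_top ?_ (lintegral_mono fun ω => (hlt ω).le)
      simp
    simpa using h1
  have hct : c ≠ ⊤ := by
    have := hM.F_prob
    rw [hc, lintegral_add_left measurable_const]
    simp only [lintegral_const, measure_univ, mul_one]
    refine ENNReal.add_ne_top.2 ⟨ENNReal.one_ne_top, ?_⟩
    have h2 : ∫⁻ y, ENNReal.ofReal (M.p (max y 0)) ∂M.F = ∫⁻ y, ENNReal.ofReal (M.p y) ∂M.F := by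
      refine lintegral_congr_ae ?_
      have : ∀ᵐ y ∂M.F, y ∉ Iic (0 : ℝ) := measure_eq_zero_iff_ae_notMem.1 hM.F_pos
      filter_upwards [this] with y hy
      rw [max_eq_left (not_le.1 hy).le]
    rw [h2]
    exact hM.p_integrable.lintegral_lt_top.ne
  refine ⟨1 + (1 - r)⁻¹ * c, ?_, fun A hA => ?_⟩
  · refine ENNReal.add_ne_top.2 ⟨ENNReal.one_ne_top, ENNReal.mul_ne_top ?_ hct⟩
    rw [ENNReal.inv_ne_top]
    exact (tsub_pos_of_lt hr1).ne'
  have hAm : MeasurableSet (D.W 0 ⁻¹' A) := D.measurable_W 0 hA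
  have hterm : ∀ n, ∫⁻ ω in D.W 0 ⁻¹' A,
      ENNReal.ofReal (Real.exp (-M.q * (D.τ (n + 1) ω - D.W 0 ω))) *
        (1 + ENNReal.ofReal (M.p (D.Y n ω))) ∂P = P (D.W 0 ⁻¹' A) * (r ^ n * c) := by
    intro n
    -- The `n`-th term is a product of functions of independent variables: the indicator for `W 0`,
    -- exponentials for `W 1, …, W n`, and the penalty factor for `Y n`.
    let g : ℕ ⊕ ℕ → ℝ → ℝ≥0∞ := fun s => Sum.elim
      (fun k y => if k = 0 then A.indicator 1 y else ENNReal.ofReal (Real.exp (-M.q * y)))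
      (fun _ y => 1 + ENNReal.ofReal (M.p (max y 0))) s
    have hg : ∀ s, Measurable (g s) := by
      rintro (k | k)
      · by_cases hk : k = 0
        · simp only [g, Sum.elim_inl, hk, if_true]
          exact measurable_one.indicator hA
        · simp only [g, Sum.elim_inl, hk, if_false]
          exact hexpm
      · exact hpm.ennreal_ofReal.const_add 1
    have hXm : ∀ s : ℕ ⊕ ℕ, Measurable (Sum.elim D.W D.Y s) := by
      rintro (k | k)
      · exact D.measurable_W k
      · exact D.measurable_Y k
    have hind := D.indep.comp g hg
    have hprod := lintegral_prod_eq_prod_lintegral_of_indepFun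
      ((Finset.range (n + 1)).disjSum {n}) (fun s => g s ∘ Sum.elim D.W D.Y s) hind
      fun s => (hg s).comp (hXm s)
    have hlhs : ∀ ω, ∏ s ∈ (Finset.range (n + 1)).disjSum {n}, (g s ∘ Sum.elim D.W D.Y s) ω =
        (D.W 0 ⁻¹' A).indicator (fun ω =>
          ENNReal.ofReal (Real.exp (-M.q * (D.τ (n + 1) ω - D.W 0 ω))) *
          (1 + ENNReal.ofReal (M.p (D.Y n ω)))) ω := by
      intro ω
      rw [Finset.prod_disjSum, Finset.prod_range_succ', Finset.prod_singleton]
      have h1 : ∏ k ∈ Finset.range n, (g (Sum.inl (k + 1)) ∘ Sum.elim D.W D.Y (Sum.inl (k + 1))) ω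
          = ENNReal.ofReal (Real.exp (-M.q * (D.τ (n + 1) ω - D.W 0 ω))) := by
        simp only [g, Function.comp_apply, Sum.elim_inl, Nat.succ_ne_zero, if_false]
        rw [← ENNReal.ofReal_prod_of_nonneg fun _ _ => (Real.exp_pos _).le, ← Real.exp_sum,
          τ, Finset.sum_range_succ', add_sub_cancel_right, Finset.mul_sum]
      rw [h1]
      simp only [g, Function.comp_apply, Sum.elim_inl, Sum.elim_inr, if_true,
        max_eq_left (D.Y_pos n ω).le]
      by_cases hω : D.W 0 ω ∈ A
      · rw [indicator_of_mem hω, indicator_of_mem (show ω ∈ D.W 0 ⁻¹' A from hω)]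
        simp
      · rw [indicator_of_notMem hω, indicator_of_notMem (show ω ∉ D.W 0 ⁻¹' A from hω)]
        simp
    have hrhs : ∏ s ∈ (Finset.range (n + 1)).disjSum {n},
        ∫⁻ ω, (g s ∘ Sum.elim D.W D.Y s) ω ∂P = P (D.W 0 ⁻¹' A) * (r ^ n * c) := by
      rw [Finset.prod_disjSum, Finset.prod_range_succ', Finset.prod_singleton]
      have h1 : ∏ k ∈ Finset.range n,
          ∫⁻ ω, (g (Sum.inl (k + 1)) ∘ Sum.elim D.W D.Y (Sum.inl (k + 1))) ω ∂P = r ^ n := by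
        rw [Finset.prod_congr rfl fun k _ => ?_, Finset.prod_const, Finset.card_range]
        simp only [g, Function.comp_apply, Sum.elim_inl, Nat.succ_ne_zero, if_false]
        exact hW (k + 1)
      have h2 : ∫⁻ ω, (g (Sum.inl 0) ∘ Sum.elim D.W D.Y (Sum.inl 0)) ω ∂P =
          P (D.W 0 ⁻¹' A) := by
        rw [← lintegral_indicator_one hAm]
        rfl
      have h3 : ∫⁻ ω, (g (Sum.inr n) ∘ Sum.elim D.W D.Y (Sum.inr n)) ω ∂P = c := by
        rw [hc, ← D.law_Y n, lintegral_map (hpm.ennreal_ofReal.const_add 1) (D.measurable_Y n)]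
        rfl
      rw [h1, h2, h3]
      ring
    rw [← lintegral_indicator hAm, ← hrhs, ← hprod]
    exact lintegral_congr fun ω => (hlhs ω).symm
  unfold dominating
  rw [lintegral_add_left measurable_const,
    lintegral_tsum fun n => (D.measurable_dominating_term hM n).aemeasurable]
  simp only [hterm]
  rw [ENNReal.tsum_mul_left, ENNReal.tsum_mul_right, ENNReal.tsum_geometric]
  simp only [lintegral_const, Measure.restrict_apply_univ]
  rw [add_mul, mul_comm (P _)]

end Demand

/-- The path with the first arrival delayed by `c` (and the same path if that is impossible). -/
noncomputable def Paths.shift (c : ℝ) (w : Paths) : Paths :=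
  open Classical in
  if h : 0 < (w.1 0).1 + c then
    ⟨Function.update w.1 0 ((w.1 0).1 + c, (w.1 0).2), by
      refine ⟨fun n => ?_, ?_⟩
      · cases n with
        | zero => simpa using ⟨h, (w.2.1 0).2⟩
        | succ n => simpa using w.2.1 (n + 1)
      · rw [← tendsto_add_atTop_iff_nat 1]
        have h1 := (tendsto_add_atTop_iff_nat 1).2 w.2.2
        have h2 := tendsto_atTop_add_const_right atTop c h1
        convert h2 using 1
        ext n
        rw [Finset.sum_range_succ', Finset.sum_range_succ']
        simp [add_assoc]⟩
  else w

theorem Paths.measurable_shift (c : ℝ) : Measurable (Paths.shift c) := by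
  have hm : Measurable fun w : Paths => (w.1 0).1 :=
    ((measurable_pi_apply 0).comp measurable_subtype_coe).fst
  have hm2 : Measurable fun w : Paths => (w.1 0).2 :=
    ((measurable_pi_apply 0).comp measurable_subtype_coe).snd
  have h1 : Measurable fun w => (Paths.shift c w).1 := by
    refine measurable_pi_iff.2 fun n => ?_
    have hn : Measurable fun w : Paths => w.1 n :=
      (measurable_pi_apply n).comp measurable_subtype_coe
    have h2 : Measurable fun w : Paths =>
        if 0 < (w.1 0).1 + c then (if n = 0 then ((w.1 0).1 + c, (w.1 0).2) else w.1 n)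
        else w.1 n := by
      refine Measurable.ite (measurableSet_lt measurable_const (hm.add_const c)) ?_ hn
      by_cases h0 : n = 0
      · simp only [h0, if_true]
        exact (hm.add_const c).prodMk hm2
      · simp only [h0, if_false]
        exact hn
    convert h2 using 1
    ext1 w
    unfold Paths.shift
    split_ifs with h3 h4
    · subst h4
      simp
    · simp [h4]
    · rfl
  exact h1.subtype_mk

/-! ### Delaying the first arrival on the path space -/

namespace Demand

variable {P : Measure Paths} {M : Model} {D : Demand P M}

theorem IsCanonical.W_zero_shift (hc : D.IsCanonical) {c : ℝ} {w : Paths}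
    (h : 0 < D.W 0 w + c) : D.W 0 (w.shift c) = D.W 0 w + c := by
  rw [hc.W_eq] at h ⊢
  rw [hc.W_eq]
  simp [Paths.shift, h]

theorem IsCanonical.W_succ_shift (hc : D.IsCanonical) (c : ℝ) (w : Paths) (n : ℕ) :
    D.W (n + 1) (w.shift c) = D.W (n + 1) w := by
  rw [hc.W_eq, hc.W_eq]
  unfold Paths.shift
  split_ifs <;> simp

theorem IsCanonical.Y_shift (hc : D.IsCanonical) (c : ℝ) (w : Paths) (n : ℕ) :
    D.Y n (w.shift c) = D.Y n w := by
  rw [hc.Y_eq, hc.Y_eq]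
  unfold Paths.shift
  split_ifs
  · cases n <;> simp
  · rfl

theorem IsCanonical.τ_succ_shift (hc : D.IsCanonical) {c : ℝ} {w : Paths}
    (h : 0 < D.W 0 w + c) (n : ℕ) : D.τ (n + 1) (w.shift c) = D.τ (n + 1) w + c := by
  induction n with
  | zero => rw [zero_add, D.τ_one, D.τ_one, hc.W_zero_shift h]
  | succ n ih =>
    rw [D.τ_succ, ih, D.τ_succ (n + 1) w, hc.W_succ_shift]
    ring

theorem IsCanonical.ext (hc : D.IsCanonical) {w w' : Paths} (hW : ∀ n, D.W n w = D.W n w')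
    (hY : ∀ n, D.Y n w = D.Y n w') : w = w' := by
  refine Subtype.ext (funext fun n => Prod.ext ?_ ?_)
  · rw [← hc.W_eq, ← hc.W_eq, hW]
  · rw [← hc.Y_eq, ← hc.Y_eq, hY]

theorem IsCanonical.shift_neg_shift (hc : D.IsCanonical) {c : ℝ} {w : Paths}
    (h : 0 < D.W 0 w + c) : (w.shift c).shift (-c) = w := by
  have h1 := hc.W_zero_shift h
  have h2 : 0 < D.W 0 (w.shift c) + -c := by
    rw [h1]
    linarith [D.W_pos 0 w]
  refine hc.ext (fun n => ?_) fun n => ?_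
  · cases n with
    | zero =>
      rw [hc.W_zero_shift h2, h1]
      ring
    | succ n => rw [hc.W_succ_shift, hc.W_succ_shift]
  · rw [hc.Y_shift, hc.Y_shift]

theorem IsCanonical.agree_shift (hc : D.IsCanonical) {c t : ℝ} {w w' : Paths}
    (h : 0 < D.W 0 w + c) (h' : 0 < D.W 0 w' + c) (ha : D.Agree t w w') :
    D.Agree (t + c) (w.shift c) (w'.shift c) := by
  intro n hn
  rw [hc.τ_succ_shift h, hc.τ_succ_shift h', add_le_add_iff_right, add_le_add_iff_right] at hn
  have h1 := ha n hn
  rw [hc.Y_shift, hc.Y_shift]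
  refine ⟨?_, h1.2⟩
  cases n with
  | zero => rw [hc.W_zero_shift h, hc.W_zero_shift h', h1.1]
  | succ n => rw [hc.W_succ_shift, hc.W_succ_shift, h1.1]

/-- Delaying the first arrival by `d` amounts to conditioning on its being later than `d`. -/
theorem IsCanonical.map_shift (hc : D.IsCanonical) [IsProbabilityMeasure P] (hM : M.Standing)
    {d : ℝ} (hd : 0 ≤ d) :
    P.map (Paths.shift d) =
      ENNReal.ofReal (Real.exp (M.lam * d)) • P.restrict {w | d < D.W 0 w} := by
  classical
  let X : Paths → ℕ ⊕ ℕ → ℝ := fun w s => Sum.elim D.W D.Y s w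
  have hXs : ∀ s, Measurable fun w => X w s := by
    rintro (k | k)
    · exact D.measurable_W k
    · exact D.measurable_Y k
  have hX : Measurable X := measurable_pi_iff.2 hXs
  let μ : ℕ ⊕ ℕ → Measure ℝ := fun s =>
    if s = Sum.inl 0 then (expMeasure M.lam).map (· + d) else P.map fun w => X w s
  have hexp := isProbabilityMeasure_expMeasure hM.lam_pos
  have hadd : Measurable fun x : ℝ => x + d := measurable_id.add_const d
  have hμ : ∀ s, IsProbabilityMeasure (μ s) := by
    intro s
    by_cases hs : s = Sum.inl 0
    · simp only [μ, hs, if_true]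
      exact Measure.isProbabilityMeasure_map hadd.aemeasurable
    · simp only [μ, hs, if_false]
      exact Measure.isProbabilityMeasure_map (hXs s).aemeasurable
  have hindep : ∀ (S : Finset (ℕ ⊕ ℕ)) (A : ℕ ⊕ ℕ → Set ℝ), (∀ s, MeasurableSet (A s)) →
      P {w | ∀ s ∈ S, X w s ∈ A s} = ∏ s ∈ S, P {w | X w s ∈ A s} := by
    intro S A hA
    have h := iIndepFun_iff_measure_inter_preimage_eq_mul.1 D.indep S (sets := A) fun s _ => hA s
    have h1 : {w | ∀ s ∈ S, X w s ∈ A s} = ⋂ s ∈ S, Sum.elim D.W D.Y s ⁻¹' A s := by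
      ext w
      simp [X]
    rw [h1, h]
    rfl
  have hshift : ∀ w, 0 < D.W 0 w + d := fun w => by linarith [D.W_pos 0 w]
  have hXshift : ∀ w s, X (w.shift d) s = if s = Sum.inl 0 then X w s + d else X w s := by
    rintro w ((_ | k) | k)
    · simpa [X] using hc.W_zero_shift (hshift w)
    · simpa [X] using hc.W_succ_shift d w k
    · simpa [X] using hc.Y_shift d w k
  -- Both measures are identified with the same infinite product by their values on boxes. In the
  -- product only the factor of the first arrival is translated.
  have hbox1 : (P.map (Paths.shift d)).map X = Measure.infinitePi μ := by
    refine Measure.eq_infinitePi _ fun S A hA => ?_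
    rw [Measure.map_map hX (Paths.measurable_shift d),
      Measure.map_apply (hX.comp (Paths.measurable_shift d))
        (MeasurableSet.pi S.countable_toSet fun s _ => hA s)]
    have h1 : X ∘ Paths.shift d ⁻¹' Set.pi S A = {w | ∀ s ∈ S, X w s ∈
        if s = Sum.inl 0 then (· + d) ⁻¹' A s else A s} := by
      ext w
      simp only [mem_preimage, Function.comp_apply, Set.mem_pi, Finset.mem_coe, mem_ofPred_eq]
      refine forall₂_congr fun s _ => ?_
      rw [hXshift]
      split_ifs <;> rfl
    rw [h1, hindep S _ fun s => ?_]
    · refine Finset.prod_congr rfl fun s _ => ?_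
      by_cases hs : s = Sum.inl 0
      · simp only [μ, hs, if_true]
        rw [Measure.map_apply hadd (hA _), ← D.law_W 0,
          Measure.map_apply (D.measurable_W 0) (hadd (hA _))]
        rfl
      · simp only [μ, hs, if_false]
        rw [Measure.map_apply (hXs s) (hA s)]
        rfl
    · split_ifs
      · exact hadd (hA s)
      · exact hA s
  have hbox2 : (ENNReal.ofReal (Real.exp (M.lam * d)) • P.restrict {w | d < D.W 0 w}).map X =
      Measure.infinitePi μ := by
    refine Measure.eq_infinitePi _ fun S A hA => ?_
    rw [Measure.map_smul, Measure.smul_apply, Measure.map_apply hX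
      (MeasurableSet.pi S.countable_toSet fun s _ => hA s), Measure.restrict_apply
      (hX (MeasurableSet.pi S.countable_toSet fun s _ => hA s)), smul_eq_mul]
    -- The restriction constrains the first arrival even if `S` does not contain its index. The box
    -- is therefore extended by `univ`, so that this index can always be split off.
    let A' : ℕ ⊕ ℕ → Set ℝ := fun s => if s ∈ S then A s else univ
    have hA' : ∀ s, MeasurableSet (A' s) := by
      intro s
      simp only [A']
      split_ifs
      · exact hA s
      · exact MeasurableSet.univ
    let S' := S.erase (Sum.inl 0)
    have h1 : X ⁻¹' Set.pi S A ∩ {w | d < D.W 0 w} =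
        {w | ∀ s ∈ insert (Sum.inl 0) S', X w s ∈
          if s = Sum.inl 0 then A' s ∩ Ioi d else A' s} := by
      ext w
      simp only [mem_inter_iff, mem_preimage, Set.mem_pi, Finset.mem_coe, mem_ofPred_eq,
        Finset.mem_insert, S', Finset.mem_erase]
      constructor
      · rintro ⟨h1, h2⟩ s hs
        have hAs : X w s ∈ A' s := by
          by_cases hsS : s ∈ S
          · simpa [A', hsS] using h1 s hsS
          · simp [A', hsS]
        split_ifs with h0
        · subst h0
          exact ⟨hAs, h2⟩
        · exact hAs
      · intro h
        have h0 := h (Sum.inl 0) (Or.inl rfl)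
        simp only [if_true] at h0
        refine ⟨fun s hs => ?_, h0.2⟩
        by_cases hs0 : s = Sum.inl 0
        · subst hs0
          simpa [A', hs] using h0.1
        · simpa [A', hs, hs0] using h s (Or.inr ⟨hs0, hs⟩)
    have hnot : Sum.inl 0 ∉ S' := Finset.notMem_erase _ _
    rw [h1, hindep _ _ fun s => ?_, Finset.prod_insert hnot, ← mul_assoc]
    · have h2 : ENNReal.ofReal (Real.exp (M.lam * d)) * P {w | X w (Sum.inl 0) ∈
          if (Sum.inl 0 : ℕ ⊕ ℕ) = Sum.inl 0 then A' (Sum.inl 0) ∩ Ioi d else A' (Sum.inl 0)} =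
          μ (Sum.inl 0) (A' (Sum.inl 0)) := by
        simp only [μ, if_true]
        rw [expMeasure_map_add hM.lam_pos hd, Measure.smul_apply,
          Measure.restrict_apply (hA' _), smul_eq_mul, ← D.law_W 0,
          Measure.map_apply (D.measurable_W 0) ((hA' _).inter measurableSet_Ioi)]
        rfl
      have h3 : ∏ s ∈ S', P {w | X w s ∈ if s = Sum.inl 0 then A' s ∩ Ioi d else A' s} =
          ∏ s ∈ S', μ s (A' s) := by
        refine Finset.prod_congr rfl fun s hs => ?_
        have hs0 : s ≠ Sum.inl 0 := (Finset.mem_erase.1 hs).1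
        simp only [μ, hs0, if_false]
        rw [Measure.map_apply (hXs s) (hA' s)]
        rfl
      rw [h2, h3, ← Finset.prod_insert (f := fun s => μ s (A' s)) hnot]
      have h4 : ∏ s ∈ S, μ s (A s) = ∏ s ∈ S, μ s (A' s) :=
        Finset.prod_congr rfl fun s hs => by simp [A', hs]
      rw [h4]
      symm
      refine Finset.prod_subset (fun s hs => ?_) fun s _ hs => ?_
      · by_cases hs0 : s = Sum.inl 0
        · simp [hs0]
        · exact Finset.mem_insert_of_mem (Finset.mem_erase.2 ⟨hs0, hs⟩)
      · simp only [A', hs, if_false]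
        exact measure_univ
    · split_ifs
      · exact (hA' s).inter measurableSet_Ioi
      · exact hA' s
  refine Measure.ext fun A hA => ?_
  -- The coordinate map `X` generates the σ-algebra of the path space, so equal images give equal
  -- measures.
  have hcomap : ∃ B, MeasurableSet B ∧ X ⁻¹' B = A := by
    obtain ⟨A₁, hA₁, rfl⟩ := hA
    refine ⟨{x | (fun n => (x (Sum.inl n), x (Sum.inr n))) ∈ A₁}, ?_, ?_⟩
    · refine (measurable_pi_iff.2 fun n => ?_ : Measurable fun (x : ℕ ⊕ ℕ → ℝ) (n : ℕ) =>
        (x (Sum.inl n), x (Sum.inr n))) hA₁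
      exact (measurable_pi_apply _).prodMk (measurable_pi_apply _)
    · ext w
      have : (fun n => (X w (Sum.inl n), X w (Sum.inr n))) = w.1 := by
        ext n
        · exact hc.W_eq n w
        · exact hc.Y_eq n w
      simp only [mem_preimage, mem_ofPred_eq, this]
  obtain ⟨B, hB, rfl⟩ := hcomap
  rw [← Measure.map_apply hX hB, ← Measure.map_apply hX hB, hbox1, hbox2]

theorem IsCanonical.lintegral_shift (hc : D.IsCanonical) [IsProbabilityMeasure P]
    (hM : M.Standing) {d : ℝ} (hd : 0 ≤ d) {f : Paths → ℝ≥0∞} (hf : Measurable f) :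
    ∫⁻ w in {w | d < D.W 0 w}, f w ∂P =
      ENNReal.ofReal (Real.exp (-(M.lam * d))) * ∫⁻ w, f (w.shift d) ∂P := by
  rw [← lintegral_map hf (Paths.measurable_shift d), hc.map_shift hM hd, lintegral_smul_measure,
    smul_eq_mul, ← mul_assoc, ← ENNReal.ofReal_mul (Real.exp_pos _).le, ← Real.exp_add]
  simp

/-- Used to evaluate an almost sure property of a strategy at shifted paths. -/
theorem IsCanonical.quasiMeasurePreserving_shift (hc : D.IsCanonical) [IsProbabilityMeasure P]
    (hM : M.Standing) {d : ℝ} (hd : 0 ≤ d) :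
    Measure.QuasiMeasurePreserving (Paths.shift d) P P := by
  refine ⟨Paths.measurable_shift d, ?_⟩
  rw [hc.map_shift hM hd]
  exact Measure.smul_absolutelyContinuous.trans Measure.absolutelyContinuous_restrict

end Demand

/-! ### Paths that coincide after a time translation -/

namespace Strategy

variable {Ω : Type*} [MeasurableSpace Ω] {P : Measure Ω} {M : Model}

/-- The path of `π₁` from level `x₁` at the outcome `ω₁`, observed from time `d` on, after `m`
switches and before the first demand, is the path of `π₂` from level `x₂` at the outcome `ω₂`. -/
structure Delayed (D : Demand P M) (π₁ π₂ : Strategy Ω) (x₁ x₂ : ℝ) (d : ℝ≥0) (m : ℕ)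
    (ω₁ ω₂ : Ω) : Prop where
  W_zero : D.W 0 ω₁ = D.W 0 ω₂ + d
  W_succ : ∀ n, D.W (n + 1) ω₁ = D.W (n + 1) ω₂
  Y_eq : ∀ n, D.Y n ω₁ = D.Y n ω₂
  T_zero : π₂.T 0 ω₂ = 0
  mono : Monotone fun k => π₁.T k ω₁
  finite : ∀ t : ℝ≥0, {k : ℕ | π₁.T k ω₁ ≤ (t : WithTop ℝ≥0)}.Finite
  T_le : π₁.T m ω₁ ≤ d
  T_succ : ∀ k, π₁.T (m + k + 1) ω₁ = π₂.T (k + 1) ω₂ + d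
  J_eq : ∀ k, π₁.J (m + k) ω₁ = π₂.J k ω₂
  level : x₁ + π₁.produced M 0 d ω₁ = x₂

namespace Delayed

variable {D : Demand P M} {π₁ π₂ : Strategy Ω} {x₁ x₂ : ℝ} {d : ℝ≥0} {m : ℕ} {ω₁ ω₂ : Ω}
  (h : Delayed D π₁ π₂ x₁ x₂ d m ω₁ ω₂)
include h

theorem τ_succ (n : ℕ) : D.τ (n + 1) ω₁ = D.τ (n + 1) ω₂ + d := by
  induction n with
  | zero => rw [zero_add, D.τ_one, D.τ_one, h.W_zero]
  | succ n ih =>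
    rw [D.τ_succ, ih, D.τ_succ (n + 1) ω₂, h.W_succ]
    ring

theorem T_add_le (k : ℕ) : π₁.T (m + k) ω₁ ≤ π₂.T k ω₂ + d := by
  cases k with
  | zero =>
    rw [h.T_zero, zero_add]
    exact h.T_le
  | succ k => exact (h.T_succ k).le

theorem mono' : Monotone fun k => π₂.T k ω₂ := by
  refine Strategy.monotone_T h.T_zero fun k => ?_
  have h1 := h.mono (by omega : m + k + 1 ≤ m + (k + 1) + 1)
  simp only [h.T_succ] at h1
  exact (WithTop.add_le_add_iff_right WithTop.coe_ne_top).1 h1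

theorem finite' (t : ℝ≥0) : {k : ℕ | π₂.T k ω₂ ≤ (t : WithTop ℝ≥0)}.Finite := by
  refine ((h.finite (t + d)).preimage (f := fun k => m + k) (fun a _ b _ hab => by
    simpa using hab)).subset fun k (hk : π₂.T k ω₂ ≤ t) => ?_
  show π₁.T (m + k) ω₁ ≤ ((t + d : ℝ≥0) : WithTop ℝ≥0)
  refine (h.T_add_le k).trans ?_
  rw [WithTop.coe_add]
  exact add_le_add hk le_rfl

theorem phase_add {t : ℝ} (ht : 0 ≤ t) : π₁.phase (t + d) ω₁ = π₂.phase t ω₂ := by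
  obtain ⟨k, hk1, hk2⟩ := exists_T_le_lt h.T_zero h.finite' t.toNNReal
  have hcoe : (((t + d).toNNReal : ℝ≥0) : WithTop ℝ≥0) = (t.toNNReal : ℝ≥0) + (d : WithTop ℝ≥0) := by
    rw [Real.toNNReal_add ht d.coe_nonneg, Real.toNNReal_coe, WithTop.coe_add]
  rw [Strategy.phase_eq h.mono' hk1 hk2, ← h.J_eq]
  refine Strategy.phase_eq h.mono ?_ ?_
  · rw [hcoe]
    exact (h.T_add_le k).trans (add_le_add hk1 le_rfl)
  · rw [hcoe, h.T_succ]
    exact (WithTop.add_lt_add_iff_right WithTop.coe_ne_top).2 hk2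

theorem produced_add {s t : ℝ} (hs : 0 ≤ s) (hst : s ≤ t) :
    π₁.produced M (s + d) (t + d) ω₁ = π₂.produced M s t ω₂ := by
  unfold produced
  rw [← intervalIntegral.integral_comp_add_right (fun r => M.σ (π₁.phase r ω₁))]
  refine intervalIntegral.integral_congr fun r hr => ?_
  rw [uIcc_of_le hst] at hr
  simp only [h.phase_add (hs.trans hr.1)]

theorem produced_zero_add {t : ℝ} (ht : 0 ≤ t) :
    x₁ + π₁.produced M 0 (t + d) ω₁ = x₂ + π₂.produced M 0 t ω₂ := by
  rw [← π₁.produced_add ω₁ M 0 d (t + d), ← h.level, ← h.produced_add le_rfl ht, zero_add,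
    add_assoc]

theorem levelBefore_eq (n : ℕ) : π₁.levelBefore D x₁ n ω₁ = π₂.levelBefore D x₂ n ω₂ := by
  induction n with
  | zero =>
    rw [Strategy.levelBefore_eq, Strategy.levelBefore_eq, h.τ_succ, D.τ_zero, D.τ_zero]
    exact h.produced_zero_add (D.τ_nonneg _ _)
  | succ n ih =>
    rw [Strategy.levelBefore_eq, Strategy.levelBefore_eq, levelAfter_succ, levelAfter_succ, ih,
      h.Y_eq, h.τ_succ, h.τ_succ, h.produced_add (D.τ_nonneg _ _) (D.τ_lt_succ _ _).le]

theorem inventory_add {t : ℝ} (ht : 0 ≤ t) :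
    π₁.inventory D x₁ (t + d) ω₁ = π₂.inventory D x₂ t ω₂ := by
  have hd := d.coe_nonneg
  obtain ⟨n, h1, h2⟩ := D.exists_τ_le_lt ω₂ ht
  have h2' : t + d < D.τ (n + 1) ω₁ := by
    rw [h.τ_succ]
    linarith
  rw [π₂.inventory_eq x₂ h1 h2]
  cases n with
  | zero =>
    rw [π₁.inventory_eq (n := 0) x₁ (by simp; linarith) h2', D.τ_zero, D.τ_zero]
    exact h.produced_zero_add ht
  | succ n =>
    have h1' : D.τ (n + 1) ω₁ ≤ t + d := by
      rw [h.τ_succ]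
      linarith
    rw [π₁.inventory_eq x₁ h1' h2', h.τ_succ, h.produced_add (D.τ_nonneg _ _) h1,
      levelAfter_succ, levelAfter_succ, h.levelBefore_eq, h.Y_eq]

theorem pathPenalty_eq : π₁.pathPenalty D x₁ ω₁ =
    ENNReal.ofReal (Real.exp (-M.q * d)) * π₂.pathPenalty D x₂ ω₂ := by
  unfold pathPenalty
  rw [← ENNReal.tsum_mul_left]
  refine tsum_congr fun n => ?_
  rw [h.levelBefore_eq, h.Y_eq]
  split_ifs
  · rw [← ENNReal.ofReal_mul (Real.exp_pos _).le, ← mul_assoc, ← Real.exp_add, h.τ_succ]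
    congr 4
    ring
  · simp

theorem disc_eq (q : ℝ) (k : ℕ) : π₁.disc q (m + k + 1) ω₁ =
    ENNReal.ofReal (Real.exp (-q * d)) * π₂.disc q (k + 1) ω₂ := by
  by_cases hT : π₂.T (k + 1) ω₂ = ⊤
  · rw [disc_of_top hT, disc_of_top (by rw [h.T_succ, hT, WithTop.top_add]), mul_zero]
  · obtain ⟨t, ht⟩ := WithTop.ne_top_iff_exists.1 hT
    have h1 : π₁.T (m + k + 1) ω₁ = ((t + d : ℝ≥0) : WithTop ℝ≥0) := by
      rw [h.T_succ, ← ht, WithTop.coe_add]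
    rw [disc_of_coe ht.symm, disc_of_coe h1, ← ENNReal.ofReal_mul (Real.exp_pos _).le,
      ← Real.exp_add]
    congr 2
    push_cast
    ring

theorem pathSwitch_eq (q : ℝ) (c : Fin 3 → Fin 3 → ℝ≥0∞) : π₁.pathSwitch q c ω₁ =
    ∑ k ∈ Finset.range m, π₁.disc q (k + 1) ω₁ * c (π₁.J k ω₁) (π₁.J (k + 1) ω₁) +
      ENNReal.ofReal (Real.exp (-q * d)) * π₂.pathSwitch q c ω₂ := by
  unfold pathSwitch
  rw [← ENNReal.summable.sum_add_tsum_nat_add' (k := m), ← ENNReal.tsum_mul_left]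
  congr 1
  refine tsum_congr fun k => ?_
  have h1 := h.J_eq (k + 1)
  rw [← add_assoc] at h1
  rw [add_comm k m, h.disc_eq, h.J_eq, h1, mul_assoc]

/-- Split the integral at `d` and translate its second part; the translation produces the discount
factor. -/
theorem pathHold_eq : π₁.pathHold D x₁ ω₁ =
    (∫⁻ t in Ico (0 : ℝ) d, ENNReal.ofReal (Real.exp (-M.q * t) *
      M.rate (π₁.phase t ω₁) (π₁.inventory D x₁ t ω₁))) +
    ENNReal.ofReal (Real.exp (-M.q * d)) * π₂.pathHold D x₂ ω₂ := by
  have h1 : Ici (0 : ℝ) = Ico 0 (d : ℝ) ∪ Ici (d : ℝ) := (Ico_union_Ici_eq_Ici d.coe_nonneg).symm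
  have h2 : Disjoint (Ico 0 (d : ℝ)) (Ici (d : ℝ)) := by
    rw [Set.disjoint_left]
    intro t h1 h2
    exact absurd h1.2 (not_lt.2 h2)
  have h3 : ∀ f : ℝ → ℝ≥0∞, ∫⁻ t in Ici (d : ℝ), f t = ∫⁻ t in Ici (0 : ℝ), f (t + d) := by
    intro f
    rw [← lintegral_indicator measurableSet_Ici, ← lintegral_indicator measurableSet_Ici,
      ← lintegral_add_right_eq_self _ (d : ℝ)]
    refine lintegral_congr fun t => ?_
    by_cases ht : 0 ≤ t
    · rw [indicator_of_mem (show t ∈ Ici 0 from ht), indicator_of_mem]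
      simpa using ht
    · rw [indicator_of_notMem (show t ∉ Ici 0 from ht), indicator_of_notMem]
      simpa using ht
  unfold pathHold
  rw [h1, lintegral_union measurableSet_Ici h2, h3, ← h1,
    ← lintegral_const_mul' _ _ ENNReal.ofReal_ne_top]
  congr 1
  refine setLIntegral_congr_fun measurableSet_Ici fun t (ht : 0 ≤ t) => ?_
  rw [h.phase_add ht, h.inventory_add ht, ← ENNReal.ofReal_mul (Real.exp_pos _).le, ← mul_assoc,
    ← Real.exp_add]
  congr 4
  ring

theorem pathNeg_eq : π₁.pathNeg M ω₁ =
    ∑ k ∈ Finset.range m, π₁.disc M.q (k + 1) ω₁ *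
      ENNReal.ofReal (-M.K (π₁.J k ω₁) (π₁.J (k + 1) ω₁)) +
      ENNReal.ofReal (Real.exp (-M.q * d)) * π₂.pathNeg M ω₂ :=
  h.pathSwitch_eq M.q fun a b => ENNReal.ofReal (-M.K a b)

theorem pathPos_eq : π₁.pathPos D x₁ ω₁ =
    (∫⁻ t in Ico (0 : ℝ) d, ENNReal.ofReal (Real.exp (-M.q * t) *
      M.rate (π₁.phase t ω₁) (π₁.inventory D x₁ t ω₁))) +
    ∑ k ∈ Finset.range m, π₁.disc M.q (k + 1) ω₁ *
      ENNReal.ofReal (M.K (π₁.J k ω₁) (π₁.J (k + 1) ω₁)) +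
    ENNReal.ofReal (Real.exp (-M.q * d)) * π₂.pathPos D x₂ ω₂ := by
  unfold pathPos
  rw [h.pathHold_eq, h.pathPenalty_eq, h.pathSwitch_eq]
  ring

/-- The initial phase is that of `π₂`, not `i`, since switches before time `d` may have changed it.
-/
theorem pathAdmissible_right {i : Fin 3} (hp : π₁.PathAdmissible D x₁ i ω₁) :
    π₂.PathAdmissible D x₂ (π₂.J 0 ω₂) ω₂ := by
  have hne : ∀ k, π₂.T (k + 1) ω₂ ≠ ⊤ → π₁.T (m + k + 1) ω₁ ≠ ⊤ := by
    intro k hk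
    rw [h.T_succ]
    exact WithTop.add_ne_top.2 ⟨hk, WithTop.coe_ne_top⟩
  have hd := d.coe_nonneg
  refine ⟨h.T_zero, rfl, fun k => h.mono' (by omega), fun k hk => ?_, h.finite', fun k hk => ?_,
    fun t ht => ?_, fun t ht => ?_, fun t ht => ?_⟩
  · have h1 := hp.T_strict (m + k) (hne k hk)
    have h2 := h.T_succ (k + 1)
    rw [h.T_succ, show m + k + 2 = m + (k + 1) + 1 by ring, h2] at h1
    exact (WithTop.add_lt_add_iff_right WithTop.coe_ne_top).1 h1
  · have h1 := hp.J_ne (m + k) (hne k hk)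
    rwa [h.J_eq, show m + k + 1 = m + (k + 1) by ring, h.J_eq] at h1
  · rw [← h.inventory_add ht]
    exact hp.level_le _ (by linarith)
  · rw [← h.inventory_add ht, ← h.phase_add ht]
    exact hp.phase_on _ (by linarith)
  · rw [← h.inventory_add ht, ← h.phase_add ht]
    exact hp.phase_off _ (by linarith)

end Delayed

/-- Running phase `i` for the time `d` before following an admissible path is admissible. -/
theorem Delayed.pathAdmissible_left {D : Demand P M} (hM : M.Standing) {π₁ π₂ : Strategy Ω}
    {x₁ x₂ : ℝ} {d : ℝ≥0} {ω₁ ω₂ : Ω} (h : Delayed D π₁ π₂ x₁ x₂ d 0 ω₁ ω₂) {i : Fin 3}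
    (hi : i ≠ 0) (h0 : π₁.T 0 ω₁ = 0) (hx₂ : x₂ < M.b)
    (hp : π₂.PathAdmissible D x₂ i ω₂) : π₁.PathAdmissible D x₁ i ω₁ := by
  have hT : ∀ k, π₁.T (k + 1) ω₁ = π₂.T (k + 1) ω₂ + d := by simpa using h.T_succ
  have hJ : ∀ k, π₁.J k ω₁ = π₂.J k ω₂ := by simpa using h.J_eq
  have hne : ∀ k, π₁.T (k + 1) ω₁ ≠ ⊤ → π₂.T (k + 1) ω₂ ≠ ⊤ := by
    intro k hk
    rw [hT] at hk
    exact (WithTop.add_ne_top.1 hk).1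
  have hphase : ∀ t : ℝ, 0 ≤ t → t < d → π₁.phase t ω₁ = i := by
    intro t ht htd
    have h1 : (t.toNNReal : ℝ≥0) < d := (Real.toNNReal_lt_iff_lt_coe ht).2 htd
    rw [Strategy.phase_eq (k := 0) h.mono (by rw [h0]; exact zero_le) ?_, hJ, hp.J_zero]
    rw [zero_add]
    refine lt_of_lt_of_le (b := (d : WithTop ℝ≥0)) (by exact_mod_cast h1) ?_
    rw [show (1 : ℕ) = 0 + 1 from rfl, hT]
    exact le_add_self
  have hinv : ∀ t : ℝ, 0 ≤ t → t < d → π₁.inventory D x₁ t ω₁ < M.b := by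
    intro t ht htd
    have h1 : t < D.τ (0 + 1) ω₁ := by
      rw [h.τ_succ]
      linarith [D.τ_succ_pos 0 ω₂]
    rw [π₁.inventory_eq (n := 0) x₁ (by simpa using ht) h1, D.τ_zero]
    have h2 := π₁.produced_add ω₁ M 0 t d
    have h3 := π₁.produced_nonneg ω₁ hM htd.le
    have h4 := h.level
    show x₁ + π₁.produced M 0 t ω₁ < M.b
    linarith
  refine ⟨h0, by rw [hJ, hp.J_zero], fun k => h.mono (by omega), fun k hk => ?_, h.finite,
    fun k hk => ?_, fun t ht => ?_, fun t ht => ?_, fun t ht => ?_⟩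
  · rw [hT, hT (k + 1)]
    exact (WithTop.add_lt_add_iff_right WithTop.coe_ne_top).2 (hp.T_strict k (hne k hk))
  · rw [hJ, hJ]
    exact hp.J_ne k (hne k hk)
  all_goals rcases lt_or_ge t d with htd | htd
  · exact (hinv t ht htd).le
  · rw [← sub_add_cancel t d, h.inventory_add (sub_nonneg.2 htd)]
    exact hp.level_le _ (sub_nonneg.2 htd)
  · intro _
    rw [hphase t ht htd]
    exact hi
  · rw [← sub_add_cancel t d, h.inventory_add (sub_nonneg.2 htd), h.phase_add (sub_nonneg.2 htd)]
    exact hp.phase_on _ (sub_nonneg.2 htd)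
  · intro hb
    exact absurd hb (hinv t ht htd).ne
  · rw [← sub_add_cancel t d, h.inventory_add (sub_nonneg.2 htd), h.phase_add (sub_nonneg.2 htd)]
    exact hp.phase_off _ (sub_nonneg.2 htd)

end Strategy

/-! ### The strategy with a single production phase -/

theorem exists_count_eq_of_lt {p : ℕ → Prop} [DecidablePred p] {j N : ℕ} (h : j < Nat.count p N) :
    ∃ n < N, p n ∧ Nat.count p n = j := by
  induction N with
  | zero => simp at h
  | succ N ih =>
    by_cases hj : j < Nat.count p N
    · obtain ⟨n, hn, h1⟩ := ih hj
      exact ⟨n, by omega, h1⟩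
    · rw [Nat.count_succ] at h
      by_cases hN : p N
      · rw [if_pos hN] at h
        exact ⟨N, by omega, hN, by omega⟩
      · rw [if_neg hN] at h
        omega

namespace Demand

variable {Ω : Type*} [MeasurableSpace Ω] {P : Measure Ω} {M : Model} (D : Demand P M)
  (i : Fin 3) (x : ℝ)

/-- The level just after the `n`-th demand when phase `i` is used whenever production is on. -/
noncomputable def simpleLevel : ℕ → Ω → ℝ
  | 0, _ => x
  | n + 1, ω =>
    let X := min M.b (simpleLevel n ω + M.σ i * D.W n ω)
    X - min (D.Y n ω) (X - M.l)

/-- The time at which the level would reach `b` after the `n`-th demand. -/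
noncomputable def hit (n : ℕ) (ω : Ω) : ℝ := D.τ n ω + (M.b - D.simpleLevel i x n ω) / M.σ i

/-- The level reaches `b` between the `n`-th demand and the next one. -/
def Hits (n : ℕ) (ω : Ω) : Prop := D.hit i x n ω < D.τ (n + 1) ω

open Classical in
/-- The strategy that uses phase `i` whenever production is on. -/
noncomputable def simple : Strategy Ω where
  T
    | 0, _ => 0
    | k + 1, ω => ⨅ n, if D.Hits i x n ω ∧ Nat.count (fun m => D.Hits i x m ω) n = k / 2 then
        (((if Even k then D.hit i x n ω else D.τ (n + 1) ω).toNNReal : ℝ≥0) : WithTop ℝ≥0) else ⊤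
  J k _ := if Even k then i else 0

variable {D i x} {ω : Ω}

theorem simple_T_eq {n k : ℕ} (h1 : D.Hits i x n ω)
    (h2 : open Classical in Nat.count (fun m => D.Hits i x m ω) n = k / 2) :
    (D.simple i x).T (k + 1) ω =
      ((if Even k then D.hit i x n ω else D.τ (n + 1) ω).toNNReal : ℝ≥0) := by
  classical
  refine le_antisymm ((iInf_le _ n).trans ?_) (le_iInf fun n' => ?_)
  · rw [if_pos ⟨h1, h2⟩]
  · by_cases h : D.Hits i x n' ω ∧ Nat.count (fun m => D.Hits i x m ω) n' = k / 2
    · have : n = n' := Nat.count_injective (p := fun m => D.Hits i x m ω) h1 h.1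
        (h2.trans h.2.symm)
      rw [if_pos h, this]
    · rw [if_neg h]
      exact le_top

theorem exists_of_simple_T_ne_top {k : ℕ} (h : (D.simple i x).T (k + 1) ω ≠ ⊤) :
    ∃ n, D.Hits i x n ω ∧ (open Classical in Nat.count (fun m => D.Hits i x m ω) n = k / 2) := by
  classical
  by_contra! hc
  refine h (iInf_eq_top.2 fun n => if_neg fun h => hc n h.1 ?_)
  exact h.2

section Path

variable (hM : M.Standing) (hi : i ≠ 0)
include hM hi

theorem simple_σ_pos : 0 < M.σ i := hM.σ_two_pos.trans_le (hM.σ_pos hi)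

variable (hx : x ∈ Ico M.l M.b)
include hx

theorem simpleLevel_mem (n : ℕ) : D.simpleLevel i x n ω ∈ Ico M.l M.b := by
  have hlb : M.l < M.b := hx.1.trans_lt hx.2
  induction n with
  | zero => exact hx
  | succ n ih =>
    have h1 : M.l ≤ min M.b (D.simpleLevel i x n ω + M.σ i * D.W n ω) := by
      refine le_min hlb.le ?_
      have := mul_pos (simple_σ_pos hM hi) (D.W_pos n ω)
      linarith [ih.1]
    have h2 := min_le_left M.b (D.simpleLevel i x n ω + M.σ i * D.W n ω)
    simp only [simpleLevel]
    set X := min M.b (D.simpleLevel i x n ω + M.σ i * D.W n ω)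
    refine ⟨by linarith [min_le_right (D.Y n ω) (X - M.l)], ?_⟩
    rcases h2.lt_or_eq with h3 | h3
    · have : 0 ≤ min (D.Y n ω) (X - M.l) := le_min (D.Y_pos n ω).le (by linarith)
      linarith
    · have : 0 < min (D.Y n ω) (X - M.l) := lt_min (D.Y_pos n ω) (by linarith)
      linarith

theorem τ_lt_hit (n : ℕ) : D.τ n ω < D.hit i x n ω := by
  have h1 := (simpleLevel_mem (D := D) (ω := ω) hM hi hx n).2
  have : 0 < (M.b - D.simpleLevel i x n ω) / M.σ i :=
    div_pos (by linarith) (simple_σ_pos hM hi)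
  unfold hit
  linarith

/-- Each earlier interval in which the level reached `b` contributes two switches, off and on. The
current interval contributes at most the one that switches off. -/
theorem simple_T_le_iff {N k : ℕ} {t : ℝ≥0} (h1 : D.τ N ω ≤ t) (h2 : t < D.τ (N + 1) ω) :
    (D.simple i x).T (k + 1) ω ≤ t ↔
      k < 2 * (open Classical in Nat.count (fun m => D.Hits i x m ω) N) +
        (open Classical in if D.hit i x N ω ≤ t then 1 else 0) := by
  classical
  have hcoe : ∀ (r : ℝ), 0 ≤ r → (((r.toNNReal : ℝ≥0) : WithTop ℝ≥0) ≤ t ↔ r ≤ t) := by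
    intro r _
    rw [WithTop.coe_le_coe, Real.toNNReal_le_iff_le_coe]
  have hhit : ∀ n, 0 ≤ D.hit i x n ω := fun n =>
    (D.τ_nonneg n ω).trans (τ_lt_hit hM hi hx n).le
  constructor
  · intro h
    obtain ⟨n, hn1, hn2⟩ := exists_of_simple_T_ne_top (ne_top_of_le_ne_top WithTop.coe_ne_top h)
    rw [simple_T_eq hn1 hn2] at h
    have hlt : n < N → k / 2 < Nat.count (fun m => D.Hits i x m ω) N := by
      intro hnN
      have h3 := Nat.count_monotone (fun m => D.Hits i x m ω) (Nat.succ_le_of_lt hnN)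
      rw [Nat.succ_eq_add_one, Nat.count_succ, if_pos hn1] at h3
      omega
    by_cases hk : Even k
    · rw [if_pos hk, hcoe _ (hhit n)] at h
      have hnN : n < N + 1 :=
        (D.τ_strictMono ω).lt_iff_lt.1 (((τ_lt_hit hM hi hx n).trans_le h).trans h2)
      rcases (Nat.lt_succ_iff.1 hnN).lt_or_eq with h3 | h3
      · have := hlt h3
        omega
      · subst h3
        rw [if_pos h]
        rw [Nat.even_iff] at hk
        omega
    · rw [if_neg hk, hcoe _ (D.τ_nonneg _ _)] at h
      have hnN : n + 1 < N + 1 := (D.τ_strictMono ω).lt_iff_lt.1 (h.trans_lt h2)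
      have := hlt (by omega)
      omega
  · intro h
    by_cases hj : k / 2 < Nat.count (fun m => D.Hits i x m ω) N
    · obtain ⟨n, hnN, hn1, hn2⟩ := exists_count_eq_of_lt hj
      have h3 : D.τ (n + 1) ω ≤ t := (D.τ_mono ω (by omega : n + 1 ≤ N)).trans h1
      rw [simple_T_eq hn1 hn2]
      split_ifs
      · rw [hcoe _ (hhit n)]
        exact hn1.le.trans h3
      · rwa [hcoe _ (D.τ_nonneg _ _)]
    · by_cases ht : D.hit i x N ω ≤ t
      · rw [if_pos ht] at h
        rw [simple_T_eq (n := N) (ht.trans_lt h2) (by omega),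
          if_pos (by rw [Nat.even_iff]; omega), hcoe _ (hhit N)]
        exact ht
      · rw [if_neg ht] at h
        omega

theorem simple_phase {N : ℕ} {t : ℝ} (h1 : D.τ N ω ≤ t) (h2 : t < D.τ (N + 1) ω) :
    (D.simple i x).phase t ω = if D.hit i x N ω ≤ t then 0 else i := by
  classical
  have ht : ((t.toNNReal : ℝ≥0) : ℝ) = t := Real.coe_toNNReal _ ((D.τ_nonneg _ _).trans h1)
  rw [← ht] at h1 h2
  have hset : {k : ℕ | (D.simple i x).T (k + 1) ω ≤ ((t.toNNReal : ℝ≥0) : WithTop ℝ≥0)} =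
      Iio (2 * Nat.count (fun m => D.Hits i x m ω) N + if D.hit i x N ω ≤ t then 1 else 0) := by
    ext k
    rw [mem_ofPred_eq, simple_T_le_iff hM hi hx h1 h2, ht]
    rfl
  unfold Strategy.phase
  rw [hset, ncard_Iio_nat]
  simp only [simple]
  split_ifs with h3 h4 h4
  · rw [Nat.even_iff] at h4
    omega
  · rfl
  · rfl
  · rw [Nat.even_iff] at h4
    omega

theorem simple_produced {n : ℕ} {t : ℝ} (h1 : D.τ n ω ≤ t) (h2 : t ≤ D.τ (n + 1) ω) :
    D.simpleLevel i x n ω + (D.simple i x).produced M (D.τ n ω) t ω =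
      min M.b (D.simpleLevel i x n ω + M.σ i * (t - D.τ n ω)) := by
  have hσ := simple_σ_pos hM hi
  have hphase : ∀ r, D.τ n ω ≤ r → r < t → (D.simple i x).phase r ω =
      if D.hit i x n ω ≤ r then 0 else i := fun r hr1 hr2 =>
    simple_phase hM hi hx hr1 (hr2.trans_le h2)
  have hh : M.σ i * (D.hit i x n ω - D.τ n ω) = M.b - D.simpleLevel i x n ω := by
    unfold hit
    field_simp
    ring
  rcases le_total t (D.hit i x n ω) with h3 | h3
  · rw [Strategy.produced_eq_of_phase (j := i) _ _ h1 fun r hr1 hr2 => ?_, min_eq_right]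
    · have := mul_le_mul_of_nonneg_left (sub_le_sub_right h3 (D.τ n ω)) hσ.le
      linarith
    · rw [hphase r hr1 hr2, if_neg (not_le.2 (hr2.trans_le h3))]
  · have h4 := (τ_lt_hit (D := D) (ω := ω) hM hi hx n).le
    rw [← Strategy.produced_add _ _ _ _ (D.hit i x n ω),
      Strategy.produced_eq_of_phase (j := i) _ _ h4 fun r hr1 hr2 => ?_,
      Strategy.produced_eq_of_phase (j := 0) _ _ h3 fun r hr1 hr2 => ?_, hM.σ_zero, min_eq_left, hh]
    · ring
    · have := mul_le_mul_of_nonneg_left (sub_le_sub_right h3 (D.τ n ω)) hσ.le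
      linarith
    · rw [hphase r (h4.trans hr1) hr2, if_pos hr1]
    · rw [hphase r hr1 (hr2.trans_le h3), if_neg (not_le.2 hr2)]

theorem simple_levelAfter (n : ℕ) :
    (D.simple i x).levelAfter D x n ω = D.simpleLevel i x n ω := by
  induction n with
  | zero => rfl
  | succ n ih =>
    rw [Strategy.levelAfter_succ, Strategy.levelBefore_eq, ih,
      simple_produced hM hi hx (D.τ_lt_succ n ω).le le_rfl, D.τ_succ, add_sub_cancel_left]
    rfl

theorem simple_inventory {n : ℕ} {t : ℝ} (h1 : D.τ n ω ≤ t) (h2 : t < D.τ (n + 1) ω) :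
    (D.simple i x).inventory D x t ω =
      min M.b (D.simpleLevel i x n ω + M.σ i * (t - D.τ n ω)) := by
  rw [Strategy.inventory_eq _ _ h1 h2, simple_levelAfter hM hi hx,
    simple_produced hM hi hx h1 h2.le]

theorem simple_pathAdmissible (ω : Ω) : (D.simple i x).PathAdmissible D x i ω := by
  classical
  have hσ := simple_σ_pos hM hi
  have hstrict : ∀ k, (D.simple i x).T (k + 1) ω ≠ ⊤ →
      (D.simple i x).T (k + 1) ω < (D.simple i x).T (k + 2) ω := by
    intro k hk
    obtain ⟨n, hn1, hn2⟩ := exists_of_simple_T_ne_top hk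
    by_cases hk' : (D.simple i x).T (k + 2) ω = ⊤
    · rw [hk']
      exact hk.lt_top
    obtain ⟨n', hn1', hn2'⟩ := exists_of_simple_T_ne_top (k := k + 1) hk'
    rw [simple_T_eq hn1 hn2, simple_T_eq (k := k + 1) hn1' hn2', WithTop.coe_lt_coe]
    by_cases he : Even k
    · have he' : ¬ Even (k + 1) := by rw [Nat.even_add_one]; exact not_not.2 he
      rw [if_pos he, if_neg he']
      -- For even `k` the next switch ends the same stay at `b`, since `k / 2 = (k + 1) / 2`. For
      -- odd `k` it belongs to a later interval.
      have hnn : n = n' := Nat.count_injective (p := fun m => D.Hits i x m ω) hn1 hn1' (by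
        rw [Nat.even_iff] at he
        exact hn2.trans ((by omega : k / 2 = (k + 1) / 2).trans hn2'.symm))
      subst hnn
      exact (Real.toNNReal_lt_toNNReal_iff (D.τ_succ_pos _ _)).2 hn1
    · have he' : Even (k + 1) := Nat.even_add_one.2 he
      rw [if_neg he, if_pos he']
      have hlt : n < n' := by
        by_contra hc
        have h3 := Nat.count_monotone (fun m => D.Hits i x m ω) (not_lt.1 hc)
        rw [Nat.even_iff] at he
        omega
      have h4 := (D.τ_mono ω (by omega : n + 1 ≤ n')).trans_lt (τ_lt_hit hM hi hx n')
      exact (Real.toNNReal_lt_toNNReal_iff ((D.τ_succ_pos _ _).trans h4)).2 h4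
  refine ⟨rfl, rfl, fun k => ?_, hstrict, fun t => ?_, fun k _ => ?_, fun t ht => ?_,
    fun t ht hlt => ?_, fun t ht heq => ?_⟩
  · by_cases hk : (D.simple i x).T (k + 1) ω = ⊤
    · by_contra hc
      obtain ⟨t, ht⟩ := WithTop.ne_top_iff_exists.1 (not_le.1 hc).ne_top
      obtain ⟨N, hN1, hN2⟩ := D.exists_τ_le_lt ω t.coe_nonneg
      have h1 := (simple_T_le_iff (k := k + 1) hM hi hx hN1 hN2).1 ht.symm.le
      have h2 := (simple_T_le_iff (k := k) hM hi hx hN1 hN2).2 (by omega)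
      rw [hk, top_le_iff] at h2
      exact WithTop.coe_ne_top h2
    · exact (hstrict k hk).le
  · obtain ⟨N, hN1, hN2⟩ := D.exists_τ_le_lt ω t.coe_nonneg
    refine (Set.finite_Iio (2 * Nat.count (fun m => D.Hits i x m ω) N +
      (if D.hit i x N ω ≤ t then 1 else 0) + 1)).subset fun k hk => ?_
    cases k with
    | zero => exact Nat.succ_pos _
    | succ k => exact Nat.succ_lt_succ ((simple_T_le_iff hM hi hx hN1 hN2).1 hk)
  · simp only [simple, Nat.even_add_one]
    by_cases he : Even k <;> simp [he, hi, hi.symm]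
  · obtain ⟨n, h1, h2⟩ := D.exists_τ_le_lt ω ht
    rw [simple_inventory hM hi hx h1 h2]
    exact min_le_left _ _
  · obtain ⟨n, h1, h2⟩ := D.exists_τ_le_lt ω ht
    rw [simple_inventory hM hi hx h1 h2, min_lt_iff] at hlt
    have h3 := hlt.resolve_left (lt_irrefl _)
    rw [simple_phase hM hi hx h1 h2, if_neg]
    · exact hi
    · rw [not_le, hit, ← sub_lt_iff_lt_add', lt_div_iff₀ hσ]
      linarith
  · obtain ⟨n, h1, h2⟩ := D.exists_τ_le_lt ω ht
    rw [simple_inventory hM hi hx h1 h2, min_eq_left_iff] at heq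
    rw [simple_phase hM hi hx h1 h2, if_pos]
    rw [hit, ← le_sub_iff_add_le', div_le_iff₀ hσ]
    linarith

/-- If the first demand comes before the level can reach `b`, the strategy does nothing until then.
Switching to it on observing an early demand is therefore consistent with having waited. -/
theorem simple_T_ge (h : D.W 0 ω ≤ (M.b - x) / M.σ i) (k : ℕ) :
    (((D.W 0 ω).toNNReal : ℝ≥0) : WithTop ℝ≥0) ≤ (D.simple i x).T (k + 1) ω := by
  by_cases hk : (D.simple i x).T (k + 1) ω = ⊤
  · rw [hk]
    exact le_top
  obtain ⟨n, hn1, hn2⟩ := exists_of_simple_T_ne_top hk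
  rw [simple_T_eq hn1 hn2, WithTop.coe_le_coe]
  refine Real.toNNReal_le_toNNReal ?_
  have h1 : ∀ n, D.W 0 ω ≤ D.τ (n + 1) ω := by
    intro n
    rw [← D.τ_one]
    exact D.τ_mono ω (by omega : 1 ≤ n + 1)
  split_ifs
  · cases n with
    | zero =>
      have h2 : D.hit i x 0 ω < D.τ 1 ω := hn1
      rw [D.τ_one, hit, D.τ_zero, zero_add] at h2
      exact absurd (h2.trans_le h) (lt_irrefl _)
    | succ n => exact (h1 n).trans (τ_lt_hit hM hi hx (n + 1)).le
  · exact h1 n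

end Path

/-- Holding cost is bounded by a constant, penalties by the penalty at full demand, and switching by
the discount factors at the demands. The constant serves all initial levels at once. -/
theorem exists_simple_pathPos_le (hM : M.Standing) (hi : i ≠ 0) : ∃ C : ℝ≥0∞, C ≠ ⊤ ∧
    ∀ {Ω : Type} [MeasurableSpace Ω] {P : Measure Ω} (D : Demand P M) {x : ℝ}, x ∈ Ico M.l M.b →
      ∀ ω, (D.simple i x).pathPos D x ω ≤ C * D.dominating ω := by
  obtain ⟨c, hc0, hc⟩ := Strategy.exists_rate_bound hM
  refine ⟨ENNReal.ofReal (1 / M.q) * ENNReal.ofReal c + 1 + 3 * M.maxK, ?_, ?_⟩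
  · refine ENNReal.add_ne_top.2 ⟨ENNReal.add_ne_top.2 ⟨ENNReal.mul_ne_top ENNReal.ofReal_ne_top
      ENNReal.ofReal_ne_top, ENNReal.one_ne_top⟩, ENNReal.mul_ne_top (by norm_num) M.maxK_ne_top⟩
  · intro Ω _ P D x hx ω
    have h1 := Strategy.pathHold_le (π := D.simple i x) (D := D) (x := x) (ω := ω) hM
      fun j z => (hc j z).2
    have h2 := Strategy.pathPenalty_le (π := D.simple i x) (D := D) (ω := ω) hM hx.1
    have h3 := (simple_pathAdmissible (D := D) hM hi hx ω).pathSwitch_le_of_simple hM hi fun k => by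
      simp only [simple, Nat.even_add_one]
      by_cases he : Even k <;> simp [he]
    have h4 := D.disc_add_penalty_le hM ω
    set s := ∑' n, ENNReal.ofReal (Real.exp (-M.q * D.τ (n + 1) ω)) *
      ENNReal.ofReal (M.p (D.Y n ω))
    have hone : 1 ≤ D.dominating ω := le_self_add
    have hs : s ≤ D.dominating ω := le_trans (le_add_self.trans le_add_self) h4
    have hd : 1 + D.disc ω ≤ D.dominating ω :=
      le_trans (by rw [← add_assoc]; exact le_self_add) h4
    unfold Strategy.pathPos
    rw [add_mul, add_mul, one_mul]
    refine add_le_add (add_le_add (h1.trans ?_) (h2.trans hs)) (h3.trans ?_)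
    · exact le_mul_of_one_le_right' hone
    · gcongr

section Adapted

variable {P : Measure Paths} {D : Demand P M}

theorem measurable_simpleLevel (n : ℕ) : Measurable (D.simpleLevel i x n) := by
  induction n with
  | zero => exact measurable_const
  | succ n ih =>
    have h1 : Measurable fun w => min M.b (D.simpleLevel i x n w + M.σ i * D.W n w) :=
      measurable_const.min (ih.add ((D.measurable_W n).const_mul _))
    exact h1.sub ((D.measurable_Y n).min (h1.sub_const _))

theorem measurable_hit (n : ℕ) : Measurable (D.hit i x n) :=
  (D.measurable_τ n).add (((measurable_simpleLevel n).const_sub _).div_const _)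

theorem measurableSet_hits (n : ℕ) : MeasurableSet {w | D.Hits i x n w} :=
  measurableSet_lt (measurable_hit n) (D.measurable_τ _)

theorem measurable_simple_T (k : ℕ) : Measurable ((D.simple i x).T k) := by
  classical
  cases k with
  | zero => exact measurable_const
  | succ k =>
    have hc : ∀ n, Measurable fun w => Nat.count (fun m => D.Hits i x m w) n := by
      intro n
      induction n with
      | zero => simp
      | succ n ih =>
        simp only [Nat.count_succ]
        exact ih.add (Measurable.ite (measurableSet_hits n) measurable_const measurable_const)
    refine Measurable.iInf fun n => Measurable.ite ?_ ?_ measurable_const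
    · exact (measurableSet_hits n).inter (hc n (measurableSet_singleton _))
    · split_ifs
      · exact (measurable_hit n).real_toNNReal.withTop_coe
      · exact (D.measurable_τ _).real_toNNReal.withTop_coe

/-- Levels, hitting times and their count up to a demand time depend only on the demands so far. -/
theorem Agree.simple_T_eq (hM : M.Standing) (hi : i ≠ 0) (hx : x ∈ Ico M.l M.b) {t : ℝ≥0}
    {w w' : Paths} (ha : D.Agree t w w') {k : ℕ} (hk : (D.simple i x).T k w ≤ t) :
    (D.simple i x).T k w' = (D.simple i x).T k w := by
  classical
  cases k with
  | zero => rfl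
  | succ k =>
    obtain ⟨n, hn1, hn2⟩ := exists_of_simple_T_ne_top (ne_top_of_le_ne_top WithTop.coe_ne_top hk)
    have hτ1 : ∀ m, D.τ (m + 1) w ≤ t → D.τ m w ≤ t := fun m h => (D.τ_lt_succ m w).le.trans h
    have hZ : ∀ m, D.τ m w ≤ t → D.simpleLevel i x m w' = D.simpleLevel i x m w := by
      intro m
      induction m with
      | zero => intro _; rfl
      | succ m ih =>
        intro hm
        simp only [simpleLevel]
        rw [ih (hτ1 m hm), (ha m (Or.inl hm)).1, (ha m (Or.inl hm)).2]
    have hH : ∀ m, D.τ m w ≤ t → D.hit i x m w' = D.hit i x m w := by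
      intro m hm
      unfold hit
      rw [hZ m hm, ha.τ_eq hm]
    have hC : ∀ m, D.τ m w ≤ t → Nat.count (fun l => D.Hits i x l w') m =
        Nat.count (fun l => D.Hits i x l w) m := by
      intro m
      induction m with
      | zero => simp
      | succ m ih =>
        intro hm
        have : D.Hits i x m w' ↔ D.Hits i x m w := by
          unfold Hits
          rw [hH m (hτ1 m hm), ha.τ_eq hm]
        rw [Nat.count_succ, Nat.count_succ, ih (hτ1 m hm)]
        simp only [this]
    rw [Demand.simple_T_eq hn1 hn2] at hk ⊢
    rw [WithTop.coe_le_coe, Real.toNNReal_le_iff_le_coe] at hk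
    by_cases he : Even k
    · rw [if_pos he] at hk ⊢
      have hn : D.τ n w ≤ t := (τ_lt_hit hM hi hx n).le.trans hk
      -- The hitting time is at most `t`; in `w'` the next arrival either coincides with that of `w`
      -- or comes after `t`.
      have hits : D.Hits i x n w' := by
        unfold Hits
        rw [hH n hn]
        by_cases h : D.τ (n + 1) w' ≤ t
        · rw [← ha.symm.τ_eq h]
          exact hn1
        · exact hk.trans_lt (not_le.1 h)
      rw [Demand.simple_T_eq hits ((hC n hn).trans hn2), if_pos he, hH n hn]
    · rw [if_neg he] at hk ⊢
      have hn : D.τ n w ≤ t := hτ1 n hk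
      have hits : D.Hits i x n w' := by
        unfold Hits
        rw [hH n hn, ha.τ_eq hk]
        exact hn1
      rw [Demand.simple_T_eq hits ((hC n hn).trans hn2), if_neg he, ha.τ_eq hk]

theorem IsCanonical.simple_admissible (hc : D.IsCanonical) (hM : M.Standing) (hi : i ≠ 0)
    (hx : x ∈ Ico M.l M.b) : (D.simple i x).Admissible D x i := by
  refine Strategy.Admissible.of_path (fun _ => rfl) (fun _ => rfl) (fun k => ?_)
    (Eventually.of_forall (simple_pathAdmissible hM hi hx))
  rw [hc.adapted_iff]
  exact ⟨⟨measurable_simple_T k, measurable_const⟩, fun t w w' ha hw =>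
    ⟨ha.simple_T_eq hM hi hx hw, rfl⟩⟩

end Adapted

end Demand

/-! ### Uniform bounds for the optimal cost -/

section Bounds

namespace Strategy

variable {Ω : Type*} [MeasurableSpace Ω] {P : Measure Ω} {M : Model} {D : Demand P M}
  {π : Strategy Ω} {x : ℝ} {i : Fin 3}

theorem PathAdmissible.pathNeg_le_pathPos {ω : Ω} (hM : M.Standing)
    (h : π.PathAdmissible D x i ω) (hi : i ≠ 0) :
    π.pathNeg M ω ≤ π.pathPos D x ω + 3 * M.maxK * D.dominating ω := by
  refine (h.pathNeg_le hM hi).trans (add_le_add le_add_self ?_)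
  gcongr
  exact le_trans (by rw [← add_assoc]; exact le_self_add) (D.disc_add_penalty_le hM ω)

theorem Admissible.setLIntegral_pathNeg_le (hM : M.Standing) (h : π.Admissible D x i)
    (hi : i ≠ 0) (A : Set Ω) :
    ∫⁻ ω in A, π.pathNeg M ω ∂P ≤
      ∫⁻ ω in A, π.pathPos D x ω ∂P + 3 * M.maxK * ∫⁻ ω in A, D.dominating ω ∂P := by
  rw [← lintegral_const_mul _ (D.measurable_dominating hM),
    ← lintegral_add_right _ ((D.measurable_dominating hM).const_mul _)]
  refine lintegral_mono_ae (ae_restrict_of_ae ?_)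
  filter_upwards [h.path] with ω hω using hω.pathNeg_le_pathPos hM hi

theorem Admissible.lintegral_pathPos_ne_top (hM : M.Standing) (h : π.Admissible D x i)
    (hx : M.l ≤ x) (hc : π.cost D x ≠ ⊤) : ∫⁻ ω, π.pathPos D x ω ∂P ≠ ⊤ := by
  intro hpos
  rw [h.cost_eq hM hx, if_pos hpos] at hc
  exact hc rfl

variable [IsProbabilityMeasure P]

theorem lintegral_dominating_ne_top (D : Demand P M) (hM : M.Standing) :
    ∫⁻ ω, D.dominating ω ∂P ≠ ⊤ := by
  obtain ⟨C, hC, h⟩ := D.exists_setLIntegral_dominating_le hM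
  have h1 := h univ MeasurableSet.univ
  rw [preimage_univ, measure_univ, mul_one, setLIntegral_univ] at h1
  exact ne_top_of_le_ne_top hC h1

theorem Admissible.lintegral_pathNeg_ne_top (hM : M.Standing) (h : π.Admissible D x i)
    (hi : i ≠ 0) (hpos : ∫⁻ ω, π.pathPos D x ω ∂P ≠ ⊤) : ∫⁻ ω, π.pathNeg M ω ∂P ≠ ⊤ := by
  have h1 := h.setLIntegral_pathNeg_le hM hi univ
  simp only [setLIntegral_univ] at h1
  exact ne_top_of_le_ne_top (ENNReal.add_ne_top.2 ⟨hpos, ENNReal.mul_ne_top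
    (ENNReal.mul_ne_top (by norm_num) M.maxK_ne_top) (lintegral_dominating_ne_top D hM)⟩) h1

theorem Admissible.cost_eq_coe (hM : M.Standing) (h : π.Admissible D x i) (hi : i ≠ 0)
    (hx : M.l ≤ x) (hpos : ∫⁻ ω, π.pathPos D x ω ∂P ≠ ⊤) :
    π.cost D x = (((∫⁻ ω, π.pathPos D x ω ∂P).toReal - (∫⁻ ω, π.pathNeg M ω ∂P).toReal : ℝ) :
      EReal) := by
  rw [h.cost_eq hM hx, if_neg hpos, EReal.coe_sub, EReal.coe_ennreal_toReal hpos,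
    EReal.coe_ennreal_toReal (h.lintegral_pathNeg_ne_top hM hi hpos)]

/-- The negative part is at most the positive part plus an integrable quantity, which does not
depend on the strategy or on the initial level. -/
theorem Admissible.neg_le_cost (hM : M.Standing) (h : π.Admissible D x i) (hi : i ≠ 0)
    (hx : M.l ≤ x) :
    ((-(3 * M.maxK * ∫⁻ ω, D.dominating ω ∂P).toReal : ℝ) : EReal) ≤ π.cost D x := by
  by_cases hc : π.cost D x = ⊤
  · rw [hc]
    exact le_top
  have hpos := h.lintegral_pathPos_ne_top hM hx hc
  rw [h.cost_eq_coe hM hi hx hpos, EReal.coe_le_coe_iff]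
  have hd : 3 * M.maxK * ∫⁻ ω, D.dominating ω ∂P ≠ ⊤ := ENNReal.mul_ne_top
    (ENNReal.mul_ne_top (by norm_num) M.maxK_ne_top) (lintegral_dominating_ne_top D hM)
  have h1 := h.setLIntegral_pathNeg_le hM hi univ
  simp only [setLIntegral_univ] at h1
  have h2 := ENNReal.toReal_mono (ENNReal.add_ne_top.2 ⟨hpos, hd⟩) h1
  rw [ENNReal.toReal_add hpos hd] at h2
  linarith

end Strategy

theorem optimalCost_le {Ω : Type*} [MeasurableSpace Ω] {P : Measure Ω} {M : Model}
    {D : Demand P M} {i : Fin 3} {x : ℝ} {π : Strategy Ω} (h : π.Admissible D x i) :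
    optimalCost D i x ≤ π.cost D x :=
  iInf₂_le (f := fun (π : Strategy Ω) (_ : π ∈ {π | π.Admissible D x i}) => π.cost D x) _ h

/-- The lower bound holds for every strategy, the upper one for the single-phase strategy.
Uniformity in `x` is what later turns a factor $e^{-ct}$ into an error linear in $t$. -/
theorem exists_abs_optimalCost_le {P : Measure Paths} [IsProbabilityMeasure P] {M : Model}
    {D : Demand P M} (hc : D.IsCanonical) (hM : M.Standing) {i : Fin 3} (hi : i ≠ 0) :
    ∃ C : ℝ, ∀ x ∈ Ico M.l M.b, ∃ v : ℝ, optimalCost D i x = v ∧ |v| ≤ C := by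
  have hd := Strategy.lintegral_dominating_ne_top D hM
  obtain ⟨C₁, hC₁, h₁⟩ := Demand.exists_simple_pathPos_le hM hi
  set c₁ := (C₁ * ∫⁻ w, D.dominating w ∂P).toReal
  set c₂ := (3 * M.maxK * ∫⁻ w, D.dominating w ∂P).toReal
  refine ⟨max c₁ c₂, fun x hx => ?_⟩
  have hlow : ((-c₂ : ℝ) : EReal) ≤ optimalCost D i x :=
    le_iInf₂ fun π hπ => Strategy.Admissible.neg_le_cost hM hπ hi hx.1
  have hadm := hc.simple_admissible hM hi hx
  have hfin : C₁ * ∫⁻ w, D.dominating w ∂P ≠ ⊤ := ENNReal.mul_ne_top hC₁ hd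
  have hpos : ∫⁻ w, (D.simple i x).pathPos D x w ∂P ≤ C₁ * ∫⁻ w, D.dominating w ∂P := by
    rw [← lintegral_const_mul _ (D.measurable_dominating hM)]
    exact lintegral_mono fun w => h₁ D hx w
  have hup : optimalCost D i x ≤ ((c₁ : ℝ) : EReal) := by
    refine (optimalCost_le hadm).trans ?_
    rw [hadm.cost_eq_coe hM hi hx.1 (ne_top_of_le_ne_top hfin hpos), EReal.coe_le_coe_iff]
    have := ENNReal.toReal_mono hfin hpos
    linarith [ENNReal.toReal_nonneg (a := ∫⁻ w, (D.simple i x).pathNeg M w ∂P)]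
  lift optimalCost D i x to ℝ using ⟨ne_top_of_le_ne_top (EReal.coe_ne_top _) hup,
    ne_bot_of_le_ne_bot (EReal.coe_ne_bot _) hlow⟩ with v
  rw [EReal.coe_le_coe_iff] at hlow hup
  exact ⟨v, rfl, abs_le.2 ⟨by linarith [le_max_right c₁ c₂], hup.trans (le_max_left _ _)⟩⟩

end Bounds

/-! ### Comparison from the lower level to the higher one -/

section Wait

variable {P : Measure Paths} {M : Model} {D : Demand P M}

open Classical in
/-- Wait for the time `s`, then use `π` if there has been no demand; if there has been one, use the
strategy with phase `i` whenever production is on. -/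
noncomputable def Strategy.wait (D : Demand P M) (π : Strategy Paths) (i : Fin 3) (x : ℝ)
    (s : ℝ≥0) : Strategy Paths where
  T
    | 0, _ => 0
    | k + 1, w => if (s : ℝ) < D.W 0 w then π.T (k + 1) (w.shift (-s)) + s
        else (D.simple i x).T (k + 1) w
  J k w := if (s : ℝ) < D.W 0 w then π.J k (w.shift (-s)) else (D.simple i x).J k w

theorem Demand.Agree.lt_W_zero {s t : ℝ} {w w' : Paths} (ha : D.Agree t w w') (hst : s ≤ t)
    (h : s < D.W 0 w) : s < D.W 0 w' := by
  by_cases h1 : D.τ (0 + 1) w' ≤ t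
  · rwa [← (ha 0 (Or.inr h1)).1]
  · rw [zero_add, D.τ_one, not_le] at h1
    exact hst.trans_lt h1

/-- Given no demand up to `d`, the path with its first arrival advanced by `d` has the original law.
-/
theorem Demand.IsCanonical.setLIntegral_comp_shift_neg [IsProbabilityMeasure P]
    (hc : D.IsCanonical) (hM : M.Standing) {d : ℝ} (hd : 0 ≤ d) {f : Paths → ℝ≥0∞}
    (hf : Measurable f) :
    ∫⁻ w in {w | d < D.W 0 w}, f (w.shift (-d)) ∂P =
      ENNReal.ofReal (Real.exp (-(M.lam * d))) * ∫⁻ w, f w ∂P := by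
  have h1 : Measurable fun w : Paths => f (w.shift (-d)) := hf.comp (Paths.measurable_shift _)
  rw [hc.lintegral_shift hM hd h1]
  congr 1
  refine lintegral_congr fun w => ?_
  rw [hc.shift_neg_shift (by linarith [D.W_pos 0 w])]

/-- Apply the change of variables to the indicator of a measurable null set containing the
exceptional paths. -/
theorem Demand.IsCanonical.ae_shift_neg [IsProbabilityMeasure P]
    (hc : D.IsCanonical) (hM : M.Standing) {d : ℝ} (hd : 0 ≤ d) {p : Paths → Prop}
    (hp : ∀ᵐ w ∂P, p w) : ∀ᵐ w ∂P, d < D.W 0 w → p (w.shift (-d)) := by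
  obtain ⟨N, hN1, hN2, hN3⟩ := exists_measurable_superset_of_null (ae_iff.1 hp)
  have hmeas : MeasurableSet {w | d < D.W 0 w} := measurableSet_lt measurable_const (D.measurable_W 0)
  have h1 := hc.setLIntegral_comp_shift_neg hM hd (f := N.indicator 1)
    (measurable_one.indicator hN2)
  have h2 : Measurable fun w : Paths => N.indicator (1 : Paths → ℝ≥0∞) (w.shift (-d)) :=
    (measurable_one.indicator hN2).comp (Paths.measurable_shift _)
  rw [lintegral_indicator_one hN2, hN3, mul_zero, lintegral_eq_zero_iff h2] at h1
  rw [Filter.EventuallyEq, ae_restrict_iff' hmeas] at h1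
  filter_upwards [h1] with w hw hlt
  by_contra hcon
  have h3 := hw hlt
  rw [indicator_of_mem (hN1 hcon)] at h3
  exact one_ne_zero h3

variable {π : Strategy Paths} {i : Fin 3} {x y : ℝ} {s : ℝ≥0}

/-- A switch under the first rule happens at or after `s`, when the absence of early demands is
known. Under the second rule it happens no earlier than the demand that triggers the rule. -/
theorem Strategy.wait_adapted (hc : D.IsCanonical) (hM : M.Standing) (hi : i ≠ 0)
    (hx : x ∈ Ico M.l M.b) (hs : s ≤ (M.b - x) / M.σ i) (h : π.Admissible D y i) (k : ℕ) :
    ∃ hT : IsStoppingTime D.filtration ((wait D π i x s).T k),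
      Measurable[hT.measurableSpace] ((wait D π i x s).J k) := by
  classical
  have hset : MeasurableSet {w | (s : ℝ) < D.W 0 w} :=
    measurableSet_lt measurable_const (D.measurable_W 0)
  have hadm := hc.simple_admissible hM hi hx
  have hJ0 : ∀ w, (wait D π i x s).J 0 w = i := fun w => by
    simp only [wait, h.J_zero, hadm.J_zero, ite_self]
  rw [hc.adapted_iff]
  refine ⟨⟨?_, Measurable.ite hset ((h.measurable_J k).comp (Paths.measurable_shift _))
    (hadm.measurable_J k)⟩, ?_⟩
  · cases k with
    | zero => exact measurable_const
    | succ k =>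
      refine Measurable.ite hset ?_ (hadm.measurable_T _)
      have hadd : Measurable fun z : WithTop ℝ≥0 => z + (s : WithTop ℝ≥0) :=
        Monotone.measurable fun a b hab => add_le_add hab le_rfl
      exact hadd.comp ((h.measurable_T (k + 1)).comp (Paths.measurable_shift _))
  · intro t w w' ha hw
    cases k with
    | zero => exact ⟨rfl, by rw [hJ0, hJ0]⟩
    | succ k =>
      simp only [wait] at hw ⊢
      by_cases hlt : (s : ℝ) < D.W 0 w
      · rw [if_pos hlt] at hw
        obtain ⟨r, hr⟩ := WithTop.ne_top_iff_exists.1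
          (WithTop.add_ne_top.1 (ne_top_of_le_ne_top WithTop.coe_ne_top hw)).1
        rw [← hr, ← WithTop.coe_add, WithTop.coe_le_coe] at hw
        have hst : s ≤ t := le_add_self.trans hw
        have hlt' := ha.lt_W_zero (NNReal.coe_le_coe.2 hst) hlt
        have ha' := hc.agree_shift (c := -s) (by linarith) (by linarith) ha
        have e : (t : ℝ) + -s = ((t - s : ℝ≥0) : ℝ) := by
          rw [NNReal.coe_sub hst, sub_eq_add_neg]
        rw [e] at ha'
        have h1 := ((hc.adapted_iff).1 (h.adapted (k + 1))).2 _ _ _ ha' (by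
          rw [← hr, WithTop.coe_le_coe]
          exact le_tsub_of_add_le_right hw)
        rw [if_pos hlt, if_pos hlt', if_pos hlt, if_pos hlt', h1.1, h1.2]
        exact ⟨rfl, rfl⟩
      · rw [if_neg hlt] at hw
        -- An observed switch forces the first arrival to be at most `t`, so the agreeing outcome
        -- has the same one and follows the same rule.
        have h2 := (Demand.simple_T_ge hM hi hx ((not_lt.1 hlt).trans hs) k).trans hw
        rw [WithTop.coe_le_coe, Real.toNNReal_le_iff_le_coe] at h2
        have h3 : D.W 0 w = D.W 0 w' := (ha 0 (Or.inl (by rwa [zero_add, D.τ_one]))).1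
        have hlt' : ¬ (s : ℝ) < D.W 0 w' := by rwa [← h3]
        have h1 := ((hc.adapted_iff).1 (hadm.adapted (k + 1))).2 _ _ _ ha hw
        rw [if_neg hlt, if_neg hlt', if_neg hlt, if_neg hlt', h1.1, h1.2]
        exact ⟨rfl, rfl⟩

theorem Strategy.wait_delayed (hc : D.IsCanonical) (hy : x + M.σ i * s = y)
    {w : Paths} (hw : (s : ℝ) < D.W 0 w) (hp : π.PathAdmissible D y i (w.shift (-s))) :
    Delayed D (wait D π i x s) π x y s 0 w (w.shift (-s)) := by
  have hT : ∀ k, (wait D π i x s).T (k + 1) w = π.T (k + 1) (w.shift (-s)) + s := fun k =>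
    if_pos hw
  have hJ : ∀ k, (wait D π i x s).J k w = π.J k (w.shift (-s)) := fun k => if_pos hw
  have hmono : Monotone fun k => (wait D π i x s).T k w :=
    Strategy.monotone_T rfl fun k => by
      rw [hT, hT]
      exact add_le_add (hp.T_mono k) le_rfl
  refine ⟨?_, fun n => (hc.W_succ_shift _ _ _).symm, fun n => (hc.Y_shift _ _ _).symm, hp.T_zero,
    hmono, fun t => ?_, ?_, fun k => ?_, fun k => ?_, ?_⟩
  · rw [hc.W_zero_shift (by linarith)]
    ring
  · refine (((hp.T_locally_finite t).union (finite_singleton 0))).subset fun k hk => ?_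
    cases k with
    | zero => exact Or.inr rfl
    | succ k =>
      refine Or.inl ?_
      have hk' : (wait D π i x s).T (k + 1) w ≤ t := hk
      rw [hT] at hk'
      exact (le_add_of_nonneg_right zero_le).trans hk'
  · exact zero_le
  · rw [zero_add, hT]
  · rw [zero_add, hJ]
  · rw [Strategy.produced_eq_of_phase (j := i) _ _ s.coe_nonneg fun r hr1 hr2 => ?_, sub_zero, hy]
    rw [Strategy.phase_eq (k := 0) hmono zero_le, hJ, hp.J_zero]
    rw [zero_add, hT]
    refine lt_of_lt_of_le ?_ (le_add_of_nonneg_left zero_le)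
    rw [WithTop.coe_lt_coe]
    exact (Real.toNNReal_lt_iff_lt_coe hr1).2 hr2

/-- The degenerate translation by time `0` says that the two strategies have the same path, so the
lemmas on `Delayed` also cover this case. -/
theorem Strategy.wait_delayed_simple (hM : M.Standing) (hi : i ≠ 0) (hx : x ∈ Ico M.l M.b)
    {w : Paths} (hw : ¬ (s : ℝ) < D.W 0 w) :
    Delayed D (wait D π i x s) (D.simple i x) x x 0 0 w w := by
  have hp := Demand.simple_pathAdmissible (D := D) hM hi hx w
  have hT : ∀ k, (wait D π i x s).T k w = (D.simple i x).T k w := fun k => by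
    cases k with
    | zero => rfl
    | succ k => exact if_neg hw
  have hJ : ∀ k, (wait D π i x s).J k w = (D.simple i x).J k w := fun k => if_neg hw
  refine ⟨by simp, fun n => rfl, fun n => rfl, rfl, ?_, fun t => ?_, zero_le, fun k => ?_,
    fun k => ?_, ?_⟩
  · simp only [hT]
    exact hp.monotone_T
  · simp only [hT]
    exact hp.T_locally_finite t
  · rw [zero_add, hT, WithTop.coe_zero, add_zero]
  · rw [zero_add, hJ]
  · rw [NNReal.coe_zero, Strategy.produced_self, add_zero]

theorem Strategy.wait_admissible [IsProbabilityMeasure P] (hc : D.IsCanonical) (hM : M.Standing)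
    (hi : i ≠ 0) (hx : x ∈ Ico M.l M.b) (hyb : y < M.b) (hy : x + M.σ i * s = y)
    (h : π.Admissible D y i) : (wait D π i x s).Admissible D x i := by
  have hσ : 0 < M.σ i := hM.σ_two_pos.trans_le (hM.σ_pos hi)
  have hs : s ≤ (M.b - x) / M.σ i := by
    rw [le_div_iff₀ hσ]
    linarith
  refine Admissible.of_path (fun _ => rfl) (fun w => ?_) (wait_adapted hc hM hi hx hs h) ?_
  · simp only [wait, h.J_zero, (hc.simple_admissible hM hi hx).J_zero, ite_self]
  · filter_upwards [hc.ae_shift_neg hM s.coe_nonneg h.path] with w hw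
    by_cases hlt : (s : ℝ) < D.W 0 w
    · exact (wait_delayed hc hy hlt (hw hlt)).pathAdmissible_left hM hi rfl hyb (hw hlt)
    · exact (wait_delayed_simple hM hi hx hlt).pathAdmissible_left hM hi rfl hx.2
        (Demand.simple_pathAdmissible hM hi hx w)

/-- Without a demand up to `s`, which has probability $e^{-\lambda s}$, the remaining cost is that
of `π` from `y` discounted by $e^{-qs}$. Waiting and an early demand together add a multiple of $s$.
-/
theorem Strategy.exists_wait_cost_le [IsProbabilityMeasure P] (hc : D.IsCanonical)
    (hM : M.Standing) (hi : i ≠ 0) :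
    ∃ C : ℝ, ∀ x ∈ Ico M.l M.b, ∀ y < M.b, ∀ s : ℝ≥0, x + M.σ i * s = y →
      ∀ π : Strategy Paths, π.Admissible D y i → ∀ c : ℝ, π.cost D y ≤ c →
        (wait D π i x s).cost D x ≤ ((Real.exp (-((M.lam + M.q) * s)) * c + C * s : ℝ) : EReal) := by
  obtain ⟨c₀, hc₀, hrate⟩ := exists_rate_bound hM
  obtain ⟨C₁, hC₁, h₁⟩ := Demand.exists_simple_pathPos_le hM hi
  obtain ⟨C₂, hC₂, h₂⟩ := D.exists_setLIntegral_dominating_le hM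
  -- The first term pays for a demand before `s`, the second for the holding cost while waiting.
  refine ⟨(C₁ * C₂).toReal * M.lam + c₀, fun x hx y hyb s hy π h c hcost => ?_⟩
  have hadm := wait_admissible hc hM hi hx hyb hy h
  have hly : M.l ≤ y := by
    have : 0 ≤ M.σ i * s := mul_nonneg (hM.σ_two_pos.trans_le (hM.σ_pos hi)).le s.coe_nonneg
    linarith [hx.1]
  have hpos := h.lintegral_pathPos_ne_top hM hly (ne_top_of_le_ne_top (EReal.coe_ne_top _) hcost)
  have hneg := h.lintegral_pathNeg_ne_top hM hi hpos
  rw [h.cost_eq_coe hM hi hly hpos, EReal.coe_le_coe_iff] at hcost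
  have hset : MeasurableSet {w | (s : ℝ) < D.W 0 w} :=
    measurableSet_lt measurable_const (D.measurable_W 0)
  have hcompl : {w | (s : ℝ) < D.W 0 w}ᶜ = {w | D.W 0 w ≤ s} := by
    ext w
    simp
  have hρ : ENNReal.ofReal (Real.exp (-M.q * s)) * ENNReal.ofReal (Real.exp (-(M.lam * s))) =
      ENNReal.ofReal (Real.exp (-((M.lam + M.q) * s))) := by
    rw [← ENNReal.ofReal_mul (Real.exp_pos _).le, ← Real.exp_add]
    congr 2
    ring
  have hlt_ae : ∀ᵐ w ∂P.restrict {w | (s : ℝ) < D.W 0 w},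
      Delayed D (wait D π i x s) π x y s 0 w (w.shift (-s)) := by
    rw [ae_restrict_iff' hset]
    filter_upwards [hc.ae_shift_neg hM s.coe_nonneg h.path] with w hw hlt
    exact wait_delayed hc hy hlt (hw hlt)
  have hP1 : ∫⁻ w in {w | (s : ℝ) < D.W 0 w}, (wait D π i x s).pathPos D x w ∂P ≤
      ENNReal.ofReal (c₀ * s) +
        ENNReal.ofReal (Real.exp (-((M.lam + M.q) * s))) * ∫⁻ w, π.pathPos D y w ∂P := by
    have hm := measurable_pathPos h.measurable_T h.measurable_J hM D y
    have hm' : Measurable fun w : Paths => π.pathPos D y (w.shift (-s)) :=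
      hm.comp (Paths.measurable_shift _)
    rw [← hρ, mul_assoc, ← hc.setLIntegral_comp_shift_neg hM s.coe_nonneg hm,
      ← lintegral_const_mul _ hm']
    calc _ ≤ ∫⁻ w in {w | (s : ℝ) < D.W 0 w}, (ENNReal.ofReal (c₀ * s) +
          ENNReal.ofReal (Real.exp (-M.q * s)) * π.pathPos D y (w.shift (-s))) ∂P := by
          refine lintegral_mono_ae ?_
          filter_upwards [hlt_ae] with w hw
          rw [hw.pathPos_eq, Finset.range_zero, Finset.sum_empty, add_zero]
          refine add_le_add ?_ le_rfl
          calc _ ≤ ∫⁻ t in Ico (0 : ℝ) s, ENNReal.ofReal c₀ := by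
                refine setLIntegral_mono measurable_const fun t ht => ?_
                refine ENNReal.ofReal_le_ofReal ?_
                refine (mul_le_of_le_one_left (hrate _ _).1 ?_).trans (hrate _ _).2
                exact Real.exp_le_one_iff.2 (by nlinarith [hM.q_pos, ht.1])
            _ = ENNReal.ofReal (c₀ * s) := by
                rw [setLIntegral_const, Real.volume_Ico, sub_zero, ENNReal.ofReal_mul hc₀]
      _ ≤ _ := by
          rw [lintegral_add_left measurable_const]
          refine add_le_add ?_ le_rfl
          rw [setLIntegral_const]
          exact mul_le_of_le_one_right' prob_le_one
  have hP2 : ∫⁻ w in {w | D.W 0 w ≤ s}, (wait D π i x s).pathPos D x w ∂P ≤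
      C₁ * C₂ * ENNReal.ofReal (M.lam * s) := by
    have hle : MeasurableSet {w | D.W 0 w ≤ s} := hcompl ▸ hset.compl
    calc _ ≤ ∫⁻ w in {w | D.W 0 w ≤ s}, C₁ * D.dominating w ∂P := by
          refine setLIntegral_mono' hle fun w hw => ?_
          rw [(wait_delayed_simple hM hi hx (not_lt.2 hw)).pathPos_eq]
          simpa using h₁ D hx w
      _ = C₁ * ∫⁻ w in D.W 0 ⁻¹' Iic (s : ℝ), D.dominating w ∂P :=
          lintegral_const_mul _ (D.measurable_dominating hM)
      _ ≤ C₁ * (C₂ * P (D.W 0 ⁻¹' Iic (s : ℝ))) := by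
          gcongr
          exact h₂ _ measurableSet_Iic
      _ ≤ _ := by
          rw [mul_assoc]
          gcongr
          exact D.measure_W_zero_le hM s.coe_nonneg
  -- The negative part is subtracted, so its contribution from early demands may be dropped.
  have hN : ENNReal.ofReal (Real.exp (-((M.lam + M.q) * s))) * ∫⁻ w, π.pathNeg M w ∂P ≤
      ∫⁻ w, (wait D π i x s).pathNeg M w ∂P := by
    have hm := measurable_pathNeg h.measurable_T h.measurable_J M
    have hm' : Measurable fun w : Paths => π.pathNeg M (w.shift (-s)) :=
      hm.comp (Paths.measurable_shift _)
    rw [← hρ, mul_assoc, ← hc.setLIntegral_comp_shift_neg hM s.coe_nonneg hm,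
      ← lintegral_const_mul _ hm']
    refine le_trans ?_ (setLIntegral_le_lintegral {w | (s : ℝ) < D.W 0 w} _)
    refine lintegral_mono_ae ?_
    filter_upwards [hlt_ae] with w hw
    rw [hw.pathNeg_eq, Finset.range_zero, Finset.sum_empty, zero_add]
  have hP : ∫⁻ w, (wait D π i x s).pathPos D x w ∂P ≤
      C₁ * C₂ * ENNReal.ofReal (M.lam * s) + (ENNReal.ofReal (c₀ * s) +
        ENNReal.ofReal (Real.exp (-((M.lam + M.q) * s))) * ∫⁻ w, π.pathPos D y w ∂P) := by
    rw [← lintegral_add_compl _ hset, hcompl, add_comm]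
    exact add_le_add hP2 hP1
  have hf1 : C₁ * C₂ * ENNReal.ofReal (M.lam * s) ≠ ⊤ :=
    ENNReal.mul_ne_top (ENNReal.mul_ne_top hC₁ hC₂) ENNReal.ofReal_ne_top
  have hf2 : ENNReal.ofReal (Real.exp (-((M.lam + M.q) * s))) * ∫⁻ w, π.pathPos D y w ∂P ≠ ⊤ :=
    ENNReal.mul_ne_top ENNReal.ofReal_ne_top hpos
  have hf3 := ENNReal.add_ne_top.2 ⟨ENNReal.ofReal_ne_top (r := c₀ * s), hf2⟩
  have hpos' := ne_top_of_le_ne_top (ENNReal.add_ne_top.2 ⟨hf1, hf3⟩) hP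
  have hneg' := hadm.lintegral_pathNeg_ne_top hM hi hpos'
  rw [hadm.cost_eq_coe hM hi hx.1 hpos', EReal.coe_le_coe_iff]
  have r1 := ENNReal.toReal_mono (ENNReal.add_ne_top.2 ⟨hf1, hf3⟩) hP
  have r2 := ENNReal.toReal_mono hneg' hN
  rw [ENNReal.toReal_add hf1 hf3, ENNReal.toReal_add ENNReal.ofReal_ne_top hf2,
    ENNReal.toReal_mul, ENNReal.toReal_mul (a := ENNReal.ofReal (Real.exp _)),
    ENNReal.toReal_ofReal (mul_nonneg hM.lam_pos.le s.coe_nonneg),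
    ENNReal.toReal_ofReal (mul_nonneg hc₀ s.coe_nonneg),
    ENNReal.toReal_ofReal (Real.exp_pos _).le] at r1
  rw [ENNReal.toReal_mul, ENNReal.toReal_ofReal (Real.exp_pos _).le] at r2
  have := mul_le_mul_of_nonneg_left hcost (Real.exp_pos (-((M.lam + M.q) * s))).le
  rw [mul_sub] at this
  linarith

end Wait

/-- The cost of a switch from phase `i` to phase `j`, which is `0` if no switch is needed. -/
noncomputable def Model.switchK (M : Model) (i j : Fin 3) : ℝ := if i = j then 0 else M.K i j

theorem Model.abs_K_le (M : Model) (a b : Fin 3) : |M.K a b| ≤ M.maxK.toReal := by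
  have h := ENNReal.toReal_mono M.maxK_ne_top (M.ofReal_abs_K_le a b)
  rwa [ENNReal.toReal_ofReal (abs_nonneg _)] at h

theorem Model.abs_switchK_le (M : Model) (a b : Fin 3) : |M.switchK a b| ≤ M.maxK.toReal := by
  unfold switchK
  split_ifs
  · rw [abs_zero]
    exact ENNReal.toReal_nonneg
  · exact M.abs_K_le a b

/-- Induction on the number of switches. A switch back to the initial phase closes a round trip of
positive cost. The change of the discount factor from step to step costs at most `maxK` times its
decrease, and these decreases telescope. -/
theorem Model.Standing.switchK_le_sum {M : Model} (hM : M.Standing) {e : ℕ → ℝ} (he : Antitone e)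
    (hpos : ∀ n, 0 ≤ e n) (h0 : e 0 = 1) {J : ℕ → Fin 3} {m : ℕ} (hJ : ∀ k ≤ m, J k ≠ 0)
    (hne : ∀ k < m, J (k + 1) ≠ J k) :
    e m * M.switchK (J 0) (J m) - M.maxK.toReal * (1 - e m) ≤
      ∑ k ∈ Finset.range m, e (k + 1) * M.K (J k) (J (k + 1)) := by
  suffices h : ∀ n ≤ m, e n * M.switchK (J 0) (J n) - M.maxK.toReal * (1 - e n) ≤
      ∑ k ∈ Finset.range n, e (k + 1) * M.K (J k) (J (k + 1)) from h m le_rfl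
  intro n
  induction n with
  | zero => simp [h0, switchK]
  | succ n ih =>
    intro hn
    specialize ih (by omega)
    have hd : 0 ≤ e n - e (n + 1) := sub_nonneg.2 (he n.le_succ)
    have hκ : 0 ≤ M.maxK.toReal := ENNReal.toReal_nonneg
    have hen : e (n + 1) ≤ 1 := h0 ▸ he (Nat.zero_le _)
    rw [Finset.sum_range_succ]
    have hJ0 := hJ 0 (Nat.zero_le _)
    have hJn := hJ n (by omega)
    have hJn' := hJ (n + 1) hn
    have hne' := hne n (by omega)
    generalize J 0 = a at *
    generalize J n = b at *
    generalize J (n + 1) = c at *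
    by_cases hab : a = b
    · subst hab
      simp only [switchK, if_true, if_neg hne'.symm] at ih ⊢
      nlinarith
    -- Only the phases `1` and `2` are available, so leaving `b` leads back to the initial phase.
    · have hca : c = a := by
        clear ih
        revert hab hJ0 hJn hJn' hne'
        revert a b c
        decide
      subst hca
      simp only [switchK, if_true, if_neg hab] at ih ⊢
      have hsum : 0 < M.K c b + M.K b c := by
        have : (c = 1 ∧ b = 2) ∨ (c = 2 ∧ b = 1) := by
          clear ih hne'
          revert hab hJ0 hJn
          clear hJn'
          revert b c
          decide
        rcases this with ⟨rfl, rfl⟩ | ⟨rfl, rfl⟩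
        · exact hM.K_sum_pos
        · rw [add_comm]
          exact hM.K_sum_pos
      have hK := (abs_le.1 (M.abs_K_le c b)).1
      have h1 := mul_le_mul_of_nonneg_left hK hd
      have h2 := mul_nonneg (hpos (n + 1)) hsum.le
      linarith

/-! ### Following a strategy along the path without demands -/

namespace Strategy

section Reference

variable {Ω : Type*} [MeasurableSpace Ω] {P : Measure Ω} {M : Model}

/-- At the outcome `ω`, the level rises from `x` to `y` in the time `δ` without a demand, with
production on and with `m` switches. -/
structure Reference (π : Strategy Ω) (D : Demand P M) (x y : ℝ) (i : Fin 3) (δ : ℝ≥0) (m : ℕ)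
    (ω : Ω) : Prop where
  path : π.PathAdmissible D x i ω
  lt_W : (δ : ℝ) < D.W 0 ω
  level : x + π.produced M 0 δ ω = y
  T_le : π.T m ω ≤ δ
  lt_T : δ < π.T (m + 1) ω
  J_ne_zero : ∀ k ≤ m, π.J k ω ≠ 0

theorem inventory_of_lt_W_zero (π : Strategy Ω) (D : Demand P M) (x : ℝ) {t : ℝ} {ω : Ω}
    (ht : 0 ≤ t) (h : t < D.W 0 ω) : π.inventory D x t ω = x + π.produced M 0 t ω := by
  rw [π.inventory_eq (n := 0) x (by rwa [D.τ_zero]) (by rwa [zero_add, D.τ_one]), D.τ_zero]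
  rfl

/-- Below `b` production runs at rate at least `σ 2`, so without a demand the level gains `y - x`
within time `(y - x) / σ 2`. The time `δ` comes from the intermediate value theorem, and `m` counts
the switches up to it. -/
theorem PathAdmissible.exists_reference {π : Strategy Ω} {D : Demand P M} {x y : ℝ} {i : Fin 3}
    {ω : Ω} (hM : M.Standing) (hi : i ≠ 0) (hxy : x ≤ y) (hyb : y < M.b)
    (h : π.PathAdmissible D x i ω) (hW : (y - x) / M.σ 2 < D.W 0 ω) :
    ∃ (δ : ℝ≥0) (m : ℕ), δ ≤ (y - x) / M.σ 2 ∧ π.Reference D x y i δ m ω := by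
  have hσ := hM.σ_two_pos
  set d := (y - x) / M.σ 2 with hd
  have hd0 : 0 ≤ d := div_nonneg (by linarith) hσ.le
  have hdσ : M.σ 2 * d = y - x := by
    rw [hd]
    field_simp
  have hmono : ∀ {s t : ℝ}, s ≤ t → π.produced M 0 s ω ≤ π.produced M 0 t ω := fun {s t} hst => by
    rw [← π.produced_add ω M 0 s t]
    linarith [π.produced_nonneg (ω := ω) hM hst]
  have hlast : y ≤ x + π.produced M 0 d ω := by
    by_cases hall : ∀ r, 0 ≤ r → r ≤ d → π.phase r ω ≠ 0
    · have h1 : ∫ _ in (0 : ℝ)..d, M.σ 2 ≤ π.produced M 0 d ω :=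
        intervalIntegral.integral_mono_on hd0 intervalIntegrable_const
          (π.intervalIntegrable_σ ω M 0 d) fun r hr => hM.σ_pos (hall r hr.1 hr.2)
      rw [intervalIntegral.integral_const, smul_eq_mul, sub_zero, mul_comm, hdσ] at h1
      linarith
    -- If production is off at some moment, the level is already `b`, above `y`.
    · push Not at hall
      obtain ⟨r, hr0, hrd, hr⟩ := hall
      have h1 : ¬ π.inventory D x r ω < M.b := fun hlt => h.phase_on r hr0 hlt hr
      rw [inventory_of_lt_W_zero π D x hr0 (hrd.trans_lt hW)] at h1
      linarith [hmono hrd]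
  have hcont : Continuous fun t => x + π.produced M 0 t ω :=
    continuous_const.add (intervalIntegral.continuous_primitive
      (fun s t => π.intervalIntegrable_σ ω M s t) 0)
  obtain ⟨t, ht, hty⟩ := intermediate_value_Icc hd0 hcont.continuousOn
    (show y ∈ Icc (x + π.produced M 0 0 ω) (x + π.produced M 0 d ω) from
      ⟨by simpa using hxy, hlast⟩)
  lift t to ℝ≥0 using ht.1
  obtain ⟨m, hm1, hm2⟩ := exists_T_le_lt h.T_zero h.T_locally_finite t
  refine ⟨t, m, ht.2, h, ht.2.trans_lt hW, hty, hm1, hm2, fun k hk => ?_⟩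
  cases k with
  | zero => rwa [h.J_zero]
  | succ k =>
    have h1 : π.T (k + 1) ω ≤ t := (h.monotone_T hk).trans hm1
    obtain ⟨r, hr⟩ := WithTop.ne_top_iff_exists.1 (ne_top_of_le_ne_top WithTop.coe_ne_top h1)
    have hlt := h.T_strict k (by rw [← hr]; exact WithTop.coe_ne_top)
    simp only [← hr] at h1 hlt
    rw [← phase_eq (t := r) h.monotone_T (by rw [← hr, Real.toNNReal_coe])
      (by rwa [Real.toNNReal_coe])]
    have hrt : (r : ℝ) ≤ t := by exact_mod_cast h1
    -- A switch up to `δ` takes place at a level at most `y`, hence below `b`, so its new phase is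
    -- not `0`.
    refine h.phase_on r r.coe_nonneg ?_
    rw [inventory_of_lt_W_zero π D x r.coe_nonneg ((hrt.trans ht.2).trans_lt hW)]
    exact (add_le_add le_rfl (hmono hrt)).trans_lt (hty.trans_lt hyb)

end Reference

section Restart

variable {P : Measure Paths} {M : Model} {D : Demand P M}

/-- The strategy `π` after `m` switches, observed from time `δ` on, when there is no demand before
time `δ`. -/
noncomputable def restart (π : Strategy Paths) (m : ℕ) (δ : ℝ≥0) : Strategy Paths where
  T
    | 0, _ => 0
    | k + 1, w => (π.T (m + k + 1) (w.shift δ)).map fun t => t - δ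
  J k w := π.J (m + k) (w.shift δ)

variable {π : Strategy Paths} {i : Fin 3} {x y : ℝ} {δ : ℝ≥0} {m : ℕ} {w₀ : Paths}

theorem W_zero_shift_coe (hc : D.IsCanonical) (δ : ℝ≥0) (w : Paths) :
    D.W 0 (w.shift δ) = D.W 0 w + δ :=
  hc.W_zero_shift (add_pos_of_pos_of_nonneg (D.W_pos 0 w) δ.coe_nonneg)

namespace Reference

variable (hr : π.Reference D x y i δ m w₀) (hc : D.IsCanonical)
include hr hc

/-- Neither path has a demand in `[0, δ]`. Hence every decision of an adapted strategy up to `δ` is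
the same at all shifted paths as at the reference path `w₀`. -/
theorem agree (w : Paths) : D.Agree δ w₀ (w.shift δ) := by
  have h1 : ∀ n w, D.W 0 w ≤ D.τ (n + 1) w := fun n w => by
    rw [← D.τ_one]
    exact D.τ_mono w (by omega : 1 ≤ n + 1)
  intro n hn
  exfalso
  rcases hn with hn | hn
  · exact absurd hr.lt_W (not_lt.2 ((h1 n _).trans hn))
  · have := (h1 n _).trans hn
    rw [W_zero_shift_coe hc] at this
    linarith [D.W_pos 0 w]

variable (h : π.Admissible D x i)
include h

theorem T_eq {k : ℕ} (hk : k ≤ m) (w : Paths) : π.T k (w.shift δ) = π.T k w₀ :=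
  (((hc.adapted_iff).1 (h.adapted k)).2 δ _ _ (hr.agree hc w)
    ((hr.path.monotone_T hk).trans hr.T_le)).1

theorem J_eq {k : ℕ} (hk : k ≤ m) (w : Paths) : π.J k (w.shift δ) = π.J k w₀ :=
  (((hc.adapted_iff).1 (h.adapted k)).2 δ _ _ (hr.agree hc w)
    ((hr.path.monotone_T hk).trans hr.T_le)).2

/-- The same determinism for switches that have not happened yet: an earlier switch at the shifted
path would also be visible at `w₀`. -/
theorem lt_T_of_lt {k : ℕ} {t : ℝ≥0} (ht : t ≤ δ) (hk : t < π.T k w₀) (w : Paths) :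
    t < π.T k (w.shift δ) := by
  by_contra hcon
  rw [not_lt] at hcon
  have h1 := (((hc.adapted_iff).1 (h.adapted k)).2 δ _ _ (hr.agree hc w).symm
    (hcon.trans (WithTop.coe_le_coe.2 ht))).1
  rw [h1] at hk
  exact absurd hk (not_lt.2 hcon)

theorem restart_J_zero (w : Paths) : (π.restart m δ).J 0 w = π.J m w₀ := hr.J_eq hc h le_rfl w

/-- The `(m + 1)`-st switch comes strictly after `δ`. This leaves room for an extra switch at time
`0` in front. -/
theorem restart_T_one_pos (w : Paths) : 0 < (π.restart m δ).T 1 w := by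
  have h1 := hr.lt_T_of_lt hc h le_rfl hr.lt_T w
  show 0 < (π.T (m + 0 + 1) (w.shift δ)).map fun t => t - δ
  rw [add_zero]
  by_cases ht : π.T (m + 1) (w.shift δ) = ⊤
  · rw [ht]
    exact WithTop.top_pos
  · obtain ⟨t, ht⟩ := WithTop.ne_top_iff_exists.1 ht
    rw [← ht, WithTop.coe_lt_coe] at h1
    rw [← ht, WithTop.map_coe]
    exact WithTop.coe_pos.2 (tsub_pos_of_lt h1)

theorem restart_delayed {w : Paths} (hp : π.PathAdmissible D x i (w.shift δ)) :
    Delayed D π (π.restart m δ) x y δ m (w.shift δ) w := by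
  refine ⟨W_zero_shift_coe hc δ w, fun n => hc.W_succ_shift _ _ _, fun n => hc.Y_shift _ _ _,
    rfl, hp.monotone_T, hp.T_locally_finite, ?_, fun k => ?_, fun k => rfl, ?_⟩
  · rw [hr.T_eq hc h le_rfl]
    exact hr.T_le
  · have h1 := (hr.lt_T_of_lt hc h le_rfl hr.lt_T w).trans_le
      (hp.monotone_T (by omega : m + 1 ≤ m + k + 1))
    show _ = ((π.T (m + k + 1) (w.shift δ)).map fun t => t - δ) + _
    simp only at h1
    by_cases ht : π.T (m + k + 1) (w.shift δ) = ⊤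
    · rw [ht, WithTop.map_top, WithTop.top_add]
    · obtain ⟨t, ht⟩ := WithTop.ne_top_iff_exists.1 ht
      rw [← ht, WithTop.coe_lt_coe] at h1
      rw [← ht, WithTop.map_coe, ← WithTop.coe_add, tsub_add_cancel_of_le h1.le]
  · rw [← hr.level]
    congr 1
    unfold produced
    refine intervalIntegral.integral_congr fun r hr' => ?_
    rw [uIcc_of_le δ.coe_nonneg] at hr'
    have hrδ : r.toNNReal ≤ δ := Real.toNNReal_le_iff_le_coe.2 hr'.2
    obtain ⟨k, hk1, hk2⟩ := exists_T_le_lt hr.path.T_zero hr.path.T_locally_finite r.toNNReal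
    have hkm : k ≤ m := by
      by_contra hcon
      have h1 := hr.lt_T.trans_le (hr.path.monotone_T (by omega : m + 1 ≤ k))
      exact absurd (hk1.trans (WithTop.coe_le_coe.2 hrδ)) (not_le.2 h1)
    have e1 := phase_eq hr.path.monotone_T hk1 hk2
    have e2 := phase_eq (t := r) (k := k) hp.monotone_T (by rwa [hr.T_eq hc h hkm])
      (hr.lt_T_of_lt hc h hrδ hk2 w)
    simp only [e1, e2, hr.J_eq hc h hkm]

/-- A switch of the new strategy by time `t` is a switch of `π` by `t + δ`, and shifting turns
agreement up to `t` into agreement up to `t + δ`. -/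
theorem restart_adapted (k : ℕ) :
    ∃ hT : IsStoppingTime D.filtration ((π.restart m δ).T k),
      Measurable[hT.measurableSpace] ((π.restart m δ).J k) := by
  rw [hc.adapted_iff]
  refine ⟨⟨?_, (h.measurable_J _).comp (Paths.measurable_shift _)⟩, ?_⟩
  · cases k with
    | zero => exact measurable_const
    | succ k =>
      have hsub : Measurable (WithTop.map fun t : ℝ≥0 => t - δ) :=
        Monotone.measurable (Monotone.withTop_map fun a b hab => tsub_le_tsub_right hab δ)
      exact hsub.comp ((h.measurable_T (m + k + 1)).comp (Paths.measurable_shift _))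
  · intro t w w' ha hw
    cases k with
    | zero => exact ⟨rfl, by rw [hr.restart_J_zero hc h, hr.restart_J_zero hc h]⟩
    | succ k =>
      have ha' := hc.agree_shift (c := δ)
        (add_pos_of_pos_of_nonneg (D.W_pos 0 w) δ.coe_nonneg)
        (add_pos_of_pos_of_nonneg (D.W_pos 0 w') δ.coe_nonneg) ha
      rw [← NNReal.coe_add] at ha'
      have hw' : ((π.T (m + k + 1) (w.shift δ)).map fun t => t - δ) ≤ t := hw
      have hle : π.T (m + k + 1) (w.shift δ) ≤ ((t + δ : ℝ≥0) : WithTop ℝ≥0) := by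
        by_cases ht : π.T (m + k + 1) (w.shift δ) = ⊤
        · rw [ht, WithTop.map_top, top_le_iff] at hw'
          exact absurd hw' WithTop.coe_ne_top
        · obtain ⟨r, hr⟩ := WithTop.ne_top_iff_exists.1 ht
          rw [← hr, WithTop.map_coe, WithTop.coe_le_coe] at hw'
          rw [← hr, WithTop.coe_le_coe]
          exact tsub_le_iff_right.1 hw'
      have h1 := ((hc.adapted_iff).1 (h.adapted (m + k + 1))).2 _ _ _ ha' hle
      simp only [restart]
      rw [h1.1, ← add_assoc, h1.2]
      exact ⟨rfl, rfl⟩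

theorem restart_admissible [IsProbabilityMeasure P] (hM : M.Standing) :
    (π.restart m δ).Admissible D y (π.J m w₀) := by
  refine Admissible.of_path (fun _ => rfl) (hr.restart_J_zero hc h) (hr.restart_adapted hc h) ?_
  filter_upwards [(hc.quasiMeasurePreserving_shift hM δ.coe_nonneg).ae h.path] with w hw
  have h1 := (hr.restart_delayed hc h hw).pathAdmissible_right hw
  rwa [hr.restart_J_zero hc h] at h1

end Reference

/-- Start in phase `i` and switch to the initial phase of `π` immediately. -/
noncomputable def prepend (π : Strategy Paths) (i : Fin 3) : Strategy Paths where
  T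
    | 0, _ => 0
    | k + 1, w => π.T k w
  J
    | 0, _ => i
    | k + 1, w => π.J k w

theorem PathAdmissible.prepend_delayed {j : Fin 3} {w : Paths} (hp : π.PathAdmissible D y j w) :
    Delayed D (π.prepend i) π y y 0 1 w w := by
  have hm : Monotone fun k => (π.prepend i).T k w := by
    refine monotone_nat_of_le_succ fun k => ?_
    cases k with
    | zero => exact zero_le
    | succ k => exact hp.monotone_T k.le_succ
  refine ⟨by simp, fun n => rfl, fun n => rfl, hp.T_zero, hm, fun t => ?_, ?_, fun k => ?_,
    fun k => ?_, by simp⟩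
  · refine (((hp.T_locally_finite t).image Nat.succ).union (finite_singleton 0)).subset
      fun k hk => ?_
    cases k with
    | zero => exact Or.inr rfl
    | succ k => exact Or.inl ⟨k, hk, rfl⟩
  · show π.T 0 w ≤ _
    rw [hp.T_zero]
    exact zero_le
  · rw [WithTop.coe_zero, add_zero, add_comm 1 k]
    rfl
  · rw [add_comm]
    rfl

/-- The added switch takes place at time `0`, so it leaves the phase and level unchanged at every
time. Positivity of the next switching time keeps the switches strictly ordered. -/
theorem Admissible.prepend [IsProbabilityMeasure P] {j : Fin 3} (hc : D.IsCanonical)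
    (hij : i ≠ j) (h : π.Admissible D y j) (hpos : ∀ w, 0 < π.T 1 w) :
    (π.prepend i).Admissible D y i := by
  refine Admissible.of_path (fun _ => rfl) (fun _ => rfl) (fun k => ?_) ?_
  · cases k with
    | zero =>
      rw [hc.adapted_iff]
      exact ⟨⟨measurable_const, measurable_const⟩, fun _ _ _ _ _ => ⟨rfl, rfl⟩⟩
    | succ k => exact h.adapted k
  · filter_upwards [h.path] with w hw
    have hd := hw.prepend_delayed (i := i)
    have hph : ∀ t, 0 ≤ t → (π.prepend i).phase t w = π.phase t w := fun t ht => by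
      have := hd.phase_add ht
      rwa [NNReal.coe_zero, add_zero] at this
    have hinv : ∀ t, 0 ≤ t → (π.prepend i).inventory D y t w = π.inventory D y t w :=
      fun t ht => by
        have := hd.inventory_add ht
        rwa [NNReal.coe_zero, add_zero] at this
    refine ⟨rfl, rfl, fun k => hw.monotone_T k.le_succ, fun k hk => ?_, hd.finite, fun k hk => ?_,
      fun t ht => ?_, fun t ht => ?_, fun t ht => ?_⟩
    · cases k with
      | zero =>
        show π.T 0 w < π.T 1 w
        rw [hw.T_zero]
        exact hpos w
      | succ k => exact hw.T_strict k hk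
    · cases k with
      | zero =>
        show π.J 0 w ≠ i
        rw [hw.J_zero]
        exact hij.symm
      | succ k => exact hw.J_ne k hk
    · rw [hinv t ht]
      exact hw.level_le t ht
    · rw [hinv t ht, hph t ht]
      exact hw.phase_on t ht
    · rw [hinv t ht, hph t ht]
      exact hw.phase_off t ht

end Restart

end Strategy

/-! ### Comparison from the higher level to the lower one -/

namespace Strategy

variable {P : Measure Paths} {M : Model} {D : Demand P M} [IsProbabilityMeasure P]
  {π : Strategy Paths} {i j : Fin 3} {x y : ℝ}

theorem Admissible.prepend_cost_le (hc : D.IsCanonical) (hM : M.Standing) (hi : i ≠ 0)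
    (hij : i ≠ j) (hy : M.l ≤ y) (h : π.Admissible D y j) (hT : ∀ w, 0 < π.T 1 w)
    (hpos : ∫⁻ w, π.pathPos D y w ∂P ≠ ⊤) (hneg : ∫⁻ w, π.pathNeg M w ∂P ≠ ⊤) :
    (π.prepend i).cost D y ≤ (((∫⁻ w, π.pathPos D y w ∂P).toReal -
      (∫⁻ w, π.pathNeg M w ∂P).toReal + M.K i j : ℝ) : EReal) := by
  have hadm := h.prepend hc hij hT
  have hdisc : ∀ w, (π.prepend i).disc M.q 1 w = 1 := fun w => by
    have h0 : (π.prepend i).T 1 w = ((0 : ℝ≥0) : WithTop ℝ≥0) := h.T_zero w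
    rw [disc_of_coe h0]
    simp
  have hP : ∫⁻ w, (π.prepend i).pathPos D y w ∂P =
      ENNReal.ofReal (M.K i j) + ∫⁻ w, π.pathPos D y w ∂P := by
    have h1 : ∫⁻ w, (π.prepend i).pathPos D y w ∂P =
        ∫⁻ w, (ENNReal.ofReal (M.K i j) + π.pathPos D y w) ∂P := by
      refine lintegral_congr_ae ?_
      filter_upwards [h.path] with w hw
      have hJ : (π.prepend i).J 0 w = i := rfl
      have hJ' : (π.prepend i).J 1 w = j := hw.J_zero
      rw [(hw.prepend_delayed (i := i)).pathPos_eq]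
      simp [hdisc, hJ, hJ']
    rw [h1, lintegral_add_left measurable_const, lintegral_const, measure_univ, mul_one]
  have hN : ∫⁻ w, (π.prepend i).pathNeg M w ∂P =
      ENNReal.ofReal (-M.K i j) + ∫⁻ w, π.pathNeg M w ∂P := by
    have h1 : ∫⁻ w, (π.prepend i).pathNeg M w ∂P =
        ∫⁻ w, (ENNReal.ofReal (-M.K i j) + π.pathNeg M w) ∂P := by
      refine lintegral_congr_ae ?_
      filter_upwards [h.path] with w hw
      have hJ : (π.prepend i).J 0 w = i := rfl
      have hJ' : (π.prepend i).J 1 w = j := hw.J_zero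
      rw [(hw.prepend_delayed (i := i)).pathNeg_eq]
      simp [hdisc, hJ, hJ']
    rw [h1, lintegral_add_left measurable_const, lintegral_const, measure_univ, mul_one]
  rw [hadm.cost_eq_coe hM hi hy (by
    rw [hP]
    exact ENNReal.add_ne_top.2 ⟨ENNReal.ofReal_ne_top, hpos⟩), EReal.coe_le_coe_iff, hP, hN,
    ENNReal.toReal_add ENNReal.ofReal_ne_top hpos, ENNReal.toReal_add ENNReal.ofReal_ne_top hneg]
  rw [ENNReal.toReal_ofReal', ENNReal.toReal_ofReal']
  have := max_zero_sub_max_neg_zero_eq_self (M.K i j)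
  linarith

/-- A first arrival after `d` has positive probability. This provides the reference outcome. -/
theorem Admissible.exists_path_lt_W_zero (hc : D.IsCanonical) (hM : M.Standing)
    (h : π.Admissible D x i) {d : ℝ} (hd : 0 ≤ d) :
    ∃ w, π.PathAdmissible D x i w ∧ d < D.W 0 w := by
  by_contra! hcon
  have h1 := hc.lintegral_shift hM hd (f := 1) measurable_one
  simp only [Pi.one_apply, lintegral_one, measure_univ, mul_one, Measure.restrict_apply_univ] at h1
  have h2 : P {w | d < D.W 0 w} = 0 := by
    refine measure_mono_null (t := {w | ¬ π.PathAdmissible D x i w}) ?_ (ae_iff.1 h.path)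
    exact fun w hw hp => absurd (hcon w hp) (not_le.2 hw)
  rw [h2] at h1
  exact (ENNReal.ofReal_pos.2 (Real.exp_pos _)).ne h1

theorem toReal_sum_mul_ofReal_sub {ι : Type*} (s : Finset ι) {e : ι → ℝ≥0∞} (he : ∀ k, e k ≠ ⊤)
    (a : ι → ℝ) :
    (∑ k ∈ s, e k * ENNReal.ofReal (a k)).toReal - (∑ k ∈ s, e k * ENNReal.ofReal (-a k)).toReal =
      ∑ k ∈ s, (e k).toReal * a k := by
  rw [ENNReal.toReal_sum fun k _ => ENNReal.mul_ne_top (he k) ENNReal.ofReal_ne_top,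
    ENNReal.toReal_sum fun k _ => ENNReal.mul_ne_top (he k) ENNReal.ofReal_ne_top,
    ← Finset.sum_sub_distrib]
  refine Finset.sum_congr rfl fun k _ => ?_
  rw [ENNReal.toReal_mul, ENNReal.toReal_mul, ENNReal.toReal_ofReal', ENNReal.toReal_ofReal',
    ← mul_sub, max_zero_sub_max_neg_zero_eq_self]

section Reference

variable {δ : ℝ≥0} {m : ℕ} {w₀ : Paths} (hr : π.Reference D x y i δ m w₀) (hc : D.IsCanonical)
  (h : π.Admissible D x i) (hM : M.Standing)
include hr hM

/-- `switchK_le_sum` discounts the direct switch to the time of the `m`-th switch. Moving it to `δ`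
and the loss from the sum together cost at most `maxK` times $1-e^{-q\delta}\le q\delta$. -/
theorem Reference.switchK_le :
    Real.exp (-M.q * δ) * M.switchK i (π.J m w₀) - M.maxK.toReal * (M.q * δ) ≤
      ∑ k ∈ Finset.range m, (π.disc M.q (k + 1) w₀).toReal * M.K (π.J k w₀) (π.J (k + 1) w₀) := by
  set κ := M.maxK.toReal with hκ
  have hanti := disc_antitone hM.q_pos hr.path.monotone_T
  have hle : ∀ k, π.disc M.q k w₀ ≤ 1 := fun k => by
    rw [← disc_zero (q := M.q) hr.path.T_zero]
    exact hanti (Nat.zero_le k)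
  have hne : ∀ k, π.disc M.q k w₀ ≠ ⊤ := fun k => ne_top_of_le_ne_top ENNReal.one_ne_top (hle k)
  have h1 := hM.switchK_le_sum (e := fun k => (π.disc M.q k w₀).toReal) (J := fun k => π.J k w₀)
    (m := m) (fun a b hab => ENNReal.toReal_mono (hne a) (hanti hab))
    (fun _ => ENNReal.toReal_nonneg) (by simp [disc_zero hr.path.T_zero]) hr.J_ne_zero
    fun k hk => hr.path.J_ne k (ne_top_of_le_ne_top WithTop.coe_ne_top
      ((hr.path.monotone_T (by omega : k + 1 ≤ m)).trans hr.T_le))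
  refine le_trans ?_ h1
  obtain ⟨t, ht⟩ := WithTop.ne_top_iff_exists.1 (ne_top_of_le_ne_top WithTop.coe_ne_top hr.T_le)
  have htδ : (t : ℝ) ≤ δ := by
    have := hr.T_le
    rw [← ht, WithTop.coe_le_coe] at this
    exact_mod_cast this
  have he : (π.disc M.q m w₀).toReal = Real.exp (-M.q * t) := by
    rw [disc_of_coe ht.symm, ENNReal.toReal_ofReal (Real.exp_pos _).le]
  have h2 : Real.exp (-M.q * δ) ≤ Real.exp (-M.q * t) := by
    refine Real.exp_le_exp.2 ?_
    nlinarith [hM.q_pos]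
  have h3 := Real.add_one_le_exp (-M.q * δ)
  have hK := (abs_le.1 (M.abs_switchK_le i (π.J m w₀)))
  simp only [he, hr.path.J_zero]
  nlinarith [mul_le_mul_of_nonneg_left hK.2 (sub_nonneg.2 h2),
    mul_le_mul_of_nonneg_left hK.1 (sub_nonneg.2 h2), ENNReal.toReal_nonneg (a := M.maxK)]

include hc h

/-- The nonnegative holding cost on `[0, δ)` is dropped. The switching terms up to `δ` are
constants, taken from the reference path. -/
theorem Reference.le_setLIntegral_pathPos :
    ENNReal.ofReal (Real.exp (-(M.lam * δ))) * ((∑ k ∈ Finset.range m, π.disc M.q (k + 1) w₀ *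
      ENNReal.ofReal (M.K (π.J k w₀) (π.J (k + 1) w₀))) +
      ENNReal.ofReal (Real.exp (-M.q * δ)) * ∫⁻ w, (π.restart m δ).pathPos D y w ∂P) ≤
    ∫⁻ w in {w | δ < D.W 0 w}, π.pathPos D x w ∂P := by
  have hadm := hr.restart_admissible hc h hM
  have hm := measurable_pathPos hadm.measurable_T hadm.measurable_J hM D y
  rw [hc.lintegral_shift hM δ.coe_nonneg
    (measurable_pathPos h.measurable_T h.measurable_J hM D x), ← lintegral_const_mul _ hm]
  gcongr
  set S := ∑ k ∈ Finset.range m, π.disc M.q (k + 1) w₀ *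
      ENNReal.ofReal (M.K (π.J k w₀) (π.J (k + 1) w₀))
  have h1 : S = ∫⁻ _, S ∂P := by simp
  nth_rw 1 [h1]
  rw [← lintegral_add_left measurable_const]
  refine lintegral_mono_ae ?_
  filter_upwards [(hc.quasiMeasurePreserving_shift hM δ.coe_nonneg).ae h.path] with w hw
  rw [(hr.restart_delayed hc h hw).pathPos_eq]
  refine add_le_add (le_add_left (Finset.sum_le_sum fun k hk => ?_)) le_rfl
  have hkm : k + 1 ≤ m := Finset.mem_range.1 hk
  simp only [disc, hr.T_eq hc h hkm, hr.J_eq hc h hkm, hr.J_eq hc h (k.le_succ.trans hkm), le_refl]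

theorem Reference.setLIntegral_pathNeg_eq :
    ∫⁻ w in {w | δ < D.W 0 w}, π.pathNeg M w ∂P =
    ENNReal.ofReal (Real.exp (-(M.lam * δ))) * ((∑ k ∈ Finset.range m, π.disc M.q (k + 1) w₀ *
      ENNReal.ofReal (-M.K (π.J k w₀) (π.J (k + 1) w₀))) +
      ENNReal.ofReal (Real.exp (-M.q * δ)) * ∫⁻ w, (π.restart m δ).pathNeg M w ∂P) := by
  have hadm := hr.restart_admissible hc h hM
  have hm := measurable_pathNeg hadm.measurable_T hadm.measurable_J M
  rw [hc.lintegral_shift hM δ.coe_nonneg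
    (measurable_pathNeg h.measurable_T h.measurable_J M), ← lintegral_const_mul _ hm]
  congr 1
  set S := ∑ k ∈ Finset.range m, π.disc M.q (k + 1) w₀ *
      ENNReal.ofReal (-M.K (π.J k w₀) (π.J (k + 1) w₀))
  have h1 : S = ∫⁻ _, S ∂P := by simp
  nth_rw 1 [h1]
  rw [← lintegral_add_left measurable_const]
  refine lintegral_congr_ae ?_
  filter_upwards [(hc.quasiMeasurePreserving_shift hM δ.coe_nonneg).ae h.path] with w hw
  rw [(hr.restart_delayed hc h hw).pathNeg_eq]
  refine congrArg₂ _ (Finset.sum_congr rfl fun k hk => ?_) rfl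
  have hkm : k + 1 ≤ m := Finset.mem_range.1 hk
  simp only [disc, hr.T_eq hc h hkm, hr.J_eq hc h hkm, hr.J_eq hc h (k.le_succ.trans hkm)]

/-- Split the cost of `π` according to whether a demand occurs by `δ`. If it does, the cost is
bounded below by a multiple of its probability, at most $\lambda\delta$. If not, the cost consists
of the switches up to `δ` and the restarted strategy. The new strategy from `y` replaces those
switches by at most one. -/
theorem Reference.exists_cost_le (hi : i ≠ 0) (hx : M.l ≤ x) (hy : M.l ≤ y) {C₂ : ℝ≥0∞}
    (hC₂ : C₂ ≠ ⊤) (h₂ : ∀ A : Set ℝ, MeasurableSet A →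
      ∫⁻ w in D.W 0 ⁻¹' A, D.dominating w ∂P ≤ C₂ * P (D.W 0 ⁻¹' A))
    {c : ℝ} (hcost : π.cost D x ≤ c) :
    ∃ (π' : Strategy Paths) (c' : ℝ), π'.Admissible D y i ∧ π'.cost D y ≤ c' ∧
      Real.exp (-((M.lam + M.q) * δ)) * c' ≤
        c + ((3 * M.maxK * C₂).toReal * M.lam + M.maxK.toReal * M.q) * δ := by
  have hposp := h.lintegral_pathPos_ne_top hM hx (ne_top_of_le_ne_top (EReal.coe_ne_top _) hcost)
  have hnegp := h.lintegral_pathNeg_ne_top hM hi hposp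
  rw [h.cost_eq_coe hM hi hx hposp, EReal.coe_le_coe_iff] at hcost
  have hset : MeasurableSet {w | (δ : ℝ) < D.W 0 w} :=
    measurableSet_lt measurable_const (D.measurable_W 0)
  have hcompl : {w | (δ : ℝ) < D.W 0 w}ᶜ = D.W 0 ⁻¹' Iic (δ : ℝ) := by
    ext w
    simp
  have hA := hr.le_setLIntegral_pathPos hc h hM
  have hB := hr.setLIntegral_pathNeg_eq hc h hM
  have hsw := hr.switchK_le hM
  have hN := h.setLIntegral_pathNeg_le hM hi (D.W 0 ⁻¹' Iic (δ : ℝ))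
  have hdom : 3 * M.maxK * ∫⁻ w in D.W 0 ⁻¹' Iic (δ : ℝ), D.dominating w ∂P ≤
      3 * M.maxK * C₂ * ENNReal.ofReal (M.lam * δ) := by
    rw [mul_assoc (3 * M.maxK)]
    gcongr
    refine (h₂ _ measurableSet_Iic).trans ?_
    gcongr
    exact D.measure_W_zero_le hM δ.coe_nonneg
  rw [← lintegral_add_compl _ hset, hcompl] at hposp hnegp hcost
  rw [← lintegral_add_compl (π.pathNeg M) hset, hcompl] at hcost
  obtain ⟨hpA, hpB⟩ := ENNReal.add_ne_top.1 hposp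
  obtain ⟨hnA, hnB⟩ := ENNReal.add_ne_top.1 hnegp
  rw [ENNReal.toReal_add hpA hpB, ENNReal.toReal_add hnA hnB] at hcost
  have hdisc : ∀ k, π.disc M.q k w₀ ≠ ⊤ := fun k => by
    unfold disc
    split_ifs
    · exact ENNReal.zero_ne_top
    · exact ENNReal.ofReal_ne_top
  have hsum := toReal_sum_mul_ofReal_sub (Finset.range m)
    (e := fun k => π.disc M.q (k + 1) w₀) (fun k => hdisc (k + 1))
    fun k => M.K (π.J k w₀) (π.J (k + 1) w₀)
  have hSfin : ∀ a : ℕ → ℝ, ∑ k ∈ Finset.range m, π.disc M.q (k + 1) w₀ * ENNReal.ofReal (a k) ≠ ⊤ :=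
    fun a => ENNReal.sum_ne_top.2 fun k _ => ENNReal.mul_ne_top (hdisc _) ENNReal.ofReal_ne_top
  have hSp := hSfin fun k => M.K (π.J k w₀) (π.J (k + 1) w₀)
  have hSn := hSfin fun k => -M.K (π.J k w₀) (π.J (k + 1) w₀)
  set Sp := ∑ k ∈ Finset.range m, π.disc M.q (k + 1) w₀ *
    ENNReal.ofReal (M.K (π.J k w₀) (π.J (k + 1) w₀))
  set Sn := ∑ k ∈ Finset.range m, π.disc M.q (k + 1) w₀ *
    ENNReal.ofReal (-M.K (π.J k w₀) (π.J (k + 1) w₀))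
  have hadm := hr.restart_admissible hc h hM
  have hexp : ∀ r : ℝ, ENNReal.ofReal (Real.exp r) ≠ 0 := fun r =>
    (ENNReal.ofReal_pos.2 (Real.exp_pos _)).ne'
  have hpos' : ∫⁻ w, (π.restart m δ).pathPos D y w ∂P ≠ ⊤ := by
    intro htop
    rw [htop, ENNReal.mul_top (hexp _), add_top, ENNReal.mul_top (hexp _), top_le_iff] at hA
    exact hpA hA
  have hneg' := hadm.lintegral_pathNeg_ne_top hM (hr.J_ne_zero m le_rfl) hpos'
  have hQp := ENNReal.mul_ne_top (ENNReal.ofReal_ne_top (r := Real.exp (-M.q * δ))) hpos'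
  have hQn := ENNReal.mul_ne_top (ENNReal.ofReal_ne_top (r := Real.exp (-M.q * δ))) hneg'
  have rA := ENNReal.toReal_mono hpA hA
  have rB := congrArg ENNReal.toReal hB
  have hC₂' : 3 * M.maxK * C₂ ≠ ⊤ :=
    ENNReal.mul_ne_top (ENNReal.mul_ne_top (by norm_num) M.maxK_ne_top) hC₂
  have hbound := ENNReal.mul_ne_top hC₂' (ENNReal.ofReal_ne_top (r := M.lam * δ))
  have rN := ENNReal.toReal_mono (ENNReal.add_ne_top.2 ⟨hpB, hbound⟩)
    (hN.trans (add_le_add le_rfl hdom))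
  rw [ENNReal.toReal_add hpB hbound, ENNReal.toReal_mul (b := ENNReal.ofReal _),
    ENNReal.toReal_ofReal (mul_nonneg hM.lam_pos.le δ.coe_nonneg)] at rN
  rw [ENNReal.toReal_mul, ENNReal.toReal_add hSp hQp, ENNReal.toReal_mul,
    ENNReal.toReal_ofReal (Real.exp_pos _).le, ENNReal.toReal_ofReal (Real.exp_pos _).le] at rA
  rw [ENNReal.toReal_mul, ENNReal.toReal_add hSn hQn, ENNReal.toReal_mul,
    ENNReal.toReal_ofReal (Real.exp_pos _).le, ENNReal.toReal_ofReal (Real.exp_pos _).le] at rB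
  have hρ : Real.exp (-((M.lam + M.q) * δ)) =
      Real.exp (-(M.lam * δ)) * Real.exp (-M.q * δ) := by
    rw [← Real.exp_add]
    congr 1
    ring
  have hE1 : Real.exp (-(M.lam * δ)) ≤ 1 :=
    Real.exp_le_one_iff.2 (neg_nonpos.2 (mul_nonneg hM.lam_pos.le δ.coe_nonneg))
  have hE0 := Real.exp_pos (-(M.lam * δ))
  rw [← hsum] at hsw
  have hκ : 0 ≤ M.maxK.toReal * (M.q * δ) :=
    mul_nonneg ENNReal.toReal_nonneg (mul_nonneg hM.q_pos.le δ.coe_nonneg)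
  have key : Real.exp (-((M.lam + M.q) * δ)) *
      ((∫⁻ w, (π.restart m δ).pathPos D y w ∂P).toReal -
        (∫⁻ w, (π.restart m δ).pathNeg M w ∂P).toReal + M.switchK i (π.J m w₀)) ≤
      c + ((3 * M.maxK * C₂).toReal * M.lam + M.maxK.toReal * M.q) * δ := by
    rw [hρ]
    have h1 := mul_le_mul_of_nonneg_left hsw hE0.le
    have h2 := mul_le_mul_of_nonneg_right hE1 hκ
    linarith
  -- If the switches up to `δ` lead back to phase `i`, the restarted strategy is used as it is;
  -- otherwise an immediate switch is put in front.
  by_cases hij : i = π.J m w₀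
  · refine ⟨π.restart m δ, _, hij ▸ hadm, ?_, key⟩
    rw [hadm.cost_eq_coe hM (hr.J_ne_zero m le_rfl) hy hpos', Model.switchK, if_pos hij, add_zero]
  · refine ⟨(π.restart m δ).prepend i, _, hadm.prepend hc hij (hr.restart_T_one_pos hc h), ?_, key⟩
    rw [Model.switchK, if_neg hij]
    exact hadm.prepend_cost_le hc hM hi hij hy (hr.restart_T_one_pos hc h) hpos' hneg'

end Reference

end Strategy

/-- Both comparisons are applied to ε-optimal strategies, since the infimum need not be attained.
The discount factors are removed by the uniform bound. -/
theorem exists_abs_toReal_optimalCost_sub_le {P : Measure Paths} [IsProbabilityMeasure P]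
    {M : Model} {D : Demand P M} (hc : D.IsCanonical) (hM : M.Standing) {i : Fin 3} (hi : i ≠ 0) :
    ∃ C : ℝ, ∀ x ∈ Ico M.l M.b, ∀ y ∈ Ico M.l M.b, x ≤ y →
      |(optimalCost D i x).toReal - (optimalCost D i y).toReal| ≤ C * (y - x) := by
  obtain ⟨C₀, h₀⟩ := exists_abs_optimalCost_le hc hM hi
  obtain ⟨C₁, h₁⟩ := Strategy.exists_wait_cost_le hc hM hi
  obtain ⟨C₂, hC₂, h₂⟩ := D.exists_setLIntegral_dominating_le hM
  set C₃ := (3 * M.maxK * C₂).toReal * M.lam + M.maxK.toReal * M.q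
  have hσ2 := hM.σ_two_pos
  have hσi : 0 < M.σ i := hσ2.trans_le (hM.σ_pos hi)
  have hlq : 0 < M.lam + M.q := add_pos hM.lam_pos hM.q_pos
  have hC₃ : 0 ≤ C₃ := add_nonneg (mul_nonneg ENNReal.toReal_nonneg hM.lam_pos.le)
    (mul_nonneg ENNReal.toReal_nonneg hM.q_pos.le)
  have hnear : ∀ {x v ε : ℝ}, optimalCost D i x = v → 0 < ε →
      ∃ π : Strategy Paths, π.Admissible D x i ∧ π.cost D x ≤ ((v + ε : ℝ) : EReal) := by
    intro x v ε hv hε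
    have h1 : optimalCost D i x < ((v + ε : ℝ) : EReal) := by
      rw [hv, EReal.coe_lt_coe_iff]
      linarith
    unfold optimalCost at h1
    obtain ⟨π, hπ⟩ := iInf_lt_iff.1 h1
    obtain ⟨hadm, hlt⟩ := iInf_lt_iff.1 hπ
    exact ⟨π, hadm, hlt.le⟩
  have hdiscount : ∀ {u : ℝ} (t : ℝ≥0), |u| ≤ C₀ →
      |u - Real.exp (-((M.lam + M.q) * t)) * u| ≤ (M.lam + M.q) * |C₀| * t := by
    intro u t hu
    have h4 := Real.add_one_le_exp (-((M.lam + M.q) * t))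
    have h5 : Real.exp (-((M.lam + M.q) * t)) ≤ 1 :=
      Real.exp_le_one_iff.2 (neg_nonpos.2 (mul_nonneg hlq.le t.coe_nonneg))
    rw [← one_sub_mul, abs_mul, abs_of_nonneg (by linarith)]
    calc _ ≤ ((M.lam + M.q) * t) * |C₀| := mul_le_mul (by linarith) (hu.trans (le_abs_self _))
          (abs_nonneg _) (mul_nonneg hlq.le t.coe_nonneg)
      _ = _ := by ring
  have hexp1 : ∀ t : ℝ≥0, Real.exp (-((M.lam + M.q) * t)) ≤ 1 := fun t =>
    Real.exp_le_one_iff.2 (neg_nonpos.2 (mul_nonneg hlq.le t.coe_nonneg))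
  -- One constant for both directions; every time involved is at most `(y - x) / σ 2`, since `σ 2`
  -- is the smallest positive rate.
  set L := |C₁| + (M.lam + M.q) * |C₀| + C₃ with hL
  have hL0 : 0 ≤ (M.lam + M.q) * |C₀| := mul_nonneg hlq.le (abs_nonneg _)
  refine ⟨L * (1 / M.σ 2), fun x hx y hy hxy => ?_⟩
  obtain ⟨v, hv, hvC⟩ := h₀ x hx
  obtain ⟨u, hu, huC⟩ := h₀ y hy
  rw [hv, hu, EReal.toReal_coe, EReal.toReal_coe]
  have hd2 : L * (1 / M.σ 2) * (y - x) = L * ((y - x) / M.σ 2) := by ring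
  have hd0 : 0 ≤ (y - x) / M.σ 2 := div_nonneg (by linarith) hσ2.le
  rw [hd2]
  refine abs_sub_le_iff.2 ⟨?_, ?_⟩
  · refine le_of_forall_pos_le_add fun ε hε => ?_
    obtain ⟨π, hπ, hcost⟩ := hnear hu hε
    have hs0 : 0 ≤ (y - x) / M.σ i := div_nonneg (by linarith) hσi.le
    obtain ⟨s, hs⟩ : ∃ s : ℝ≥0, (s : ℝ) = (y - x) / M.σ i := ⟨⟨_, hs0⟩, rfl⟩
    have hy' : x + M.σ i * s = y := by
      rw [hs]
      field_simp
      ring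
    have h3 := (optimalCost_le (Strategy.wait_admissible hc hM hi hx hy.2 hy' hπ)).trans
      (h₁ x hx y hy.2 s hy' π hπ _ hcost)
    rw [hv, EReal.coe_le_coe_iff, mul_add] at h3
    have hs2 : (s : ℝ) ≤ (y - x) / M.σ 2 := by
      rw [hs]
      exact div_le_div_of_nonneg_left (by linarith) hσ2 (hM.σ_pos hi)
    have h4 := (abs_le.1 (hdiscount s huC)).1
    have h5 : Real.exp (-((M.lam + M.q) * s)) * ε ≤ ε := mul_le_of_le_one_left hε.le (hexp1 s)
    have h6 : C₁ * s ≤ |C₁| * s := mul_le_mul_of_nonneg_right (le_abs_self _) s.coe_nonneg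
    have h7 : (|C₁| + (M.lam + M.q) * |C₀|) * s ≤ L * ((y - x) / M.σ 2) :=
      mul_le_mul (by linarith) hs2 s.coe_nonneg (by positivity)
    linarith
  · refine le_of_forall_pos_le_add fun ε hε => ?_
    obtain ⟨π, hπ, hcost⟩ := hnear hv hε
    obtain ⟨w, hw, hlt⟩ := hπ.exists_path_lt_W_zero hc hM hd0
    obtain ⟨δ, m, hδ, hr⟩ := hw.exists_reference hM hi hxy hy.2 hlt
    obtain ⟨π', c', hadm, hcost', hle⟩ := hr.exists_cost_le hc hπ hM hi hx.1 hy.1 hC₂ h₂ hcost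
    have h3 := (optimalCost_le hadm).trans hcost'
    rw [hu, EReal.coe_le_coe_iff] at h3
    have h4 := (abs_le.1 (hdiscount δ huC)).2
    have h5 := mul_le_mul_of_nonneg_left h3 (Real.exp_pos (-((M.lam + M.q) * δ))).le
    have h7 : ((M.lam + M.q) * |C₀| + C₃) * δ ≤ L * ((y - x) / M.σ 2) :=
      mul_le_mul (by linarith [abs_nonneg C₁]) hδ δ.coe_nonneg (by positivity)
    linarith

end ProductionInventory

theorem mainTheorem5 {Ω : Type*} [MeasurableSpace Ω] (P : MeasureTheory.Measure Ω)
    [MeasureTheory.IsProbabilityMeasure P] (M : ProductionInventory.Model) (hM : M.Standing)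
    (D : ProductionInventory.Demand P M) (i : Fin 3) (hi : i = 1 ∨ i = 2) :
    (∀ x ∈ Set.Ico M.l M.b, ProductionInventory.optimalCost D i x ≠ ⊥ ∧
      ProductionInventory.optimalCost D i x ≠ ⊤) ∧
    ∃ m : NNReal, LipschitzOnWith m
      (fun x => (ProductionInventory.optimalCost D i x).toReal) (Set.Ico M.l M.b) := by
  have hi' : i ≠ 0 := by
    rcases hi with rfl | rfl <;> decide
  have : IsProbabilityMeasure (P.map D.toPaths) :=
    Measure.isProbabilityMeasure_map (ProductionInventory.Demand.measurable_toPaths D).aemeasurable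
  have hc := ProductionInventory.Demand.isCanonical_canonical D
  constructor
  · intro x hx
    obtain ⟨C, hC⟩ := ProductionInventory.exists_abs_optimalCost_le hc hM hi'
    obtain ⟨v, hv, -⟩ := hC x hx
    rw [ProductionInventory.optimalCost_canonical D hM i hx.1, hv]
    exact ⟨EReal.coe_ne_bot _, EReal.coe_ne_top _⟩
  · obtain ⟨C, hC⟩ := ProductionInventory.exists_abs_toReal_optimalCost_sub_le hc hM hi'
    refine ⟨C.toNNReal, LipschitzOnWith.of_dist_le_mul fun x hx y hy => ?_⟩
    rw [ProductionInventory.optimalCost_canonical D hM i hx.1,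
      ProductionInventory.optimalCost_canonical D hM i hy.1, Real.dist_eq, Real.dist_eq]
    rcases le_total x y with hxy | hxy
    · refine (hC x hx y hy hxy).trans ?_
      rw [abs_sub_comm, abs_of_nonneg (sub_nonneg.2 hxy)]
      exact mul_le_mul_of_nonneg_right (Real.le_coe_toNNReal C) (sub_nonneg.2 hxy)
    · rw [abs_sub_comm]
      refine (hC y hy x hx hxy).trans ?_
      rw [abs_of_nonneg (sub_nonneg.2 hxy)]
      exact mul_le_mul_of_nonneg_right (Real.le_coe_toNNReal C) (sub_nonneg.2 hxy)
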